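/- Setting. Let $\mathbb M$ be a smooth connected (Hausdorff, second countable) manifold of dimension $d+\mathfrak h$ with a smooth bracket-generating distribution $\mathcal H$ of rank $d$ and a smooth fiberwise inner product $g_{\mathcal H}$ on $\mathcal H$. Assume that $\mathbb M$ has transverse symmetries: there is an $\mathfrak h$-dimensional Lie algebra $\mathcal V$ of sub-Riemannian Killing fields (that is, smooth fields $Z$ with $[Z,X]$ horizontal for every horizontal field $X$, and $\mathcal L_Z g_{\mathcal H}=0$) with $T_x\mathbb M=\mathcal H(x)\oplus\mathcal V(x)$ for all $x$. Fix an inner product $g_{\mathcal V}$ on $\mathcal V$, extend $g_{\mathcal H}$ and $g_{\mathcal V}$ by zero to $T\mathbb M$, and put $g_\varepsilon=g_{\mathcal H}\oplus\frac1\varepsilon g_{\mathcal V}$ for $\varepsilon>0$; $\mu$ is the Riemannian volume of $g_1$. An adapted frame on an open set consists of smooth vector fields $X_1,\dots,X_d$ which form a $g_{\mathcal H}$-orthonormal basis of $\mathcal H$ at each point, and a $g_{\mathcal V}$-orthonormal basis $Z_1,\dots,Z_{\mathfrak h}$ of $\mathcal V$; $\theta_i,\nu_m$ is the dual coframe. On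 one-forms, $\langle\cdot,\cdot\rangle_\varepsilon$ is the inner product for which $\theta_i$, $\varepsilon^{-1/2}\nu_m$ are orthonormal. Let $\nabla$ be the canonical connection, characterized by: $\nabla g_\varepsilon=0$ for all $\varepsilon>0$; $\nabla_XY$ is horizontal for horizontal $X,Y$; $\nabla Z=0$ for $Z\in\mathcal V$; and its torsion $T$ satisfies: $T(X,Y)$ is vertical and $T(X,Z)=0$ for $X,Y$ horizontal and $Z\in\mathcal V$. Let $L$ be the sub-Laplacian, that is, the generator of the form $\int\langle\nabla_{\mathcal H}f,\nabla_{\mathcal H}g\rangle_{\mathcal H}\,d\mu$, where $\nabla_{\mathcal H}f=\sum_i(X_if)X_i$. For $Z\in\mathcal V$ let $J_Z$ be defined by $g_{\mathcal H}(J_ZX,Y)=g_{\mathcal V}(Z,T(X,Y))$ for horizontal $X,Y$ and $J_Z=0$ on vertical vectors; on one-forms, $J_Z\theta_i=g_{\mathcal H}(J_ZX_i,\cdot)$ and $J_Z\nu_m=0$; and $J^*J=\sum_mJ_{Z_m}^*J_{Z_m}$. Let $\mathfrak{Ric}_{\mathcal H}$ be the horizontal symmetric endomorphism of the bundle of one-forms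 with $\langle\mathfrak{Ric}_{\mathcal H}(df),dg\rangle=\mathbf{Ricci}(\nabla_{\mathcal H}f,\nabla_{\mathcal H}g)$, where $\mathbf{Ricci}(v,w)=\mathrm{tr}(u\mapsto R(u,v)w)$ is the Ricci curvature of $\nabla$. Define, on one-forms, $$\square_\infty=\sum_i\left(\nabla_{X_i}\nabla_{X_i}-\nabla_{\nabla_{X_i}X_i}\right)+2\sum_mJ_{Z_m}(d\,\iota_{Z_m})-\mathfrak{Ric}_{\mathcal H},\qquad \square_\varepsilon=\square_\infty-\frac1\varepsilon\,T\circ d,$$ where $T$ acts on two-forms by $T(\theta_i\wedge\theta_j)=g_{\mathcal V}(T(X_i,X_j),\cdot)$ and $T(\theta_i\wedge\nu_m)=T(\nu_l\wedge\nu_m)=0$. For $V$ horizontal put $$\mathfrak T^\varepsilon_V\eta=-\sum_j\eta(T(V,X_j))\,\theta_j+\frac1{2\varepsilon}\sum_m\eta(J_{Z_m}V)\,\nu_m,$$ and $(\nabla_{\mathcal H}-\mathfrak T^\varepsilon_{\mathcal H})\eta=\sum_i(\nabla_{X_i}\eta-\mathfrak T^\varepsilon_{X_i}\eta)\otimes\theta_i$,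 a $(0,2)$ tensor. All these objects are independent of the adapted frame. Theorem. The connection $\nabla$ exists, and on smooth functions $L=\sum_i\left(X_i^2-\nabla_{X_i}X_i\right)$; that is, for every smooth $f$ the right side defines a smooth function $Lf$ with $\int\langle\nabla_{\mathcal H}f,\nabla_{\mathcal H}g\rangle_{\mathcal H}\,d\mu=-\int (Lf)\,g\,d\mu$ for all smooth compactly supported $g$. Assume moreover that $\mathbb M$ is of Yang–Mills type: $\sum_i(\nabla_{X_i}T)(X_i,X)=0$ for every horizontal $X$. Then for every $\varepsilon>0$: 1. In every adapted frame, for all smooth one-forms, $$\square_\varepsilon=\sum_{i=1}^d\left[(\nabla_{X_i}-\mathfrak T^\varepsilon_{X_i})^2-(\nabla_{\nabla_{X_i}X_i}-\mathfrak T^\varepsilon_{\nabla_{X_i}X_i})\right]+\frac1{2\varepsilon}\sum_{m=1}^{\mathfrak h}J_{Z_m}^*J_{Z_m}-\mathfrak{Ric}_{\mathcal H}.$$ 2. The operator $\nabla_{\mathcal H}-\mathfrak T^\varepsilon_{\mathcal H}$ has a formal adjoint $(\nabla_{\mathcal H}-\mathfrak T^\varepsilon_{\mathcal H})^*$ with respect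 to $g_{2\varepsilon}$ and $\mu$ (defined on smooth $(0,2)$ tensors, by pairing with smooth compactly supported one-forms), and globally $$\square_\varepsilon=-(\nabla_{\mathcal H}-\mathfrak T^\varepsilon_{\mathcal H})^*(\nabla_{\mathcal H}-\mathfrak T^\varepsilon_{\mathcal H})+\frac1{2\varepsilon}J^*J-\mathfrak{Ric}_{\mathcal H}.$$ 3. For every smooth one-form $\eta$, at every point and for every orthonormal basis $X_1,\dots,X_d$ of $\mathcal H$ at that point, $$\tfrac12L\|\eta\|_{2\varepsilon}^2-\langle\square_\varepsilon\eta,\eta\rangle_{2\varepsilon}=\sum_{i=1}^d\|\nabla_{X_i}\eta-\mathfrak T^\varepsilon_{X_i}\eta\|_{2\varepsilon}^2+\left\langle\left(\mathfrak{Ric}_{\mathcal H}-\tfrac1{2\varepsilon}J^*J\right)\eta,\eta\right\rangle_{2\varepsilon}.$$ -/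

import Mathlib

open Set Filter Topology MeasureTheory Bundle
open scoped Manifold ContDiff

noncomputable section

namespace TransverseSR

/-! ### Tensor calculus of an affine connection on a smooth `n`-manifold -/

section Calculus

variable {n : ℕ} {M : Type*} [TopologicalSpace M] [ChartedSpace (EuclideanSpace ℝ (Fin n)) M]

variable (n M) in
/-- (Not necessarily continuous) vector fields on `M`. -/
abbrev VectorField : Type _ := Π x : M, TangentSpace (𝓡 n) x

variable (n M) in
/-- (Not necessarily continuous) one-forms on `M`. -/
abbrev OneForm : Type _ := Π x : M, (TangentSpace (𝓡 n) x →L[ℝ] ℝ)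

variable (n M) in
/-- (Not necessarily continuous) `(0,2)` tensors on `M`. -/
abbrev Tensor2 : Type _ :=
  Π x : M, (TangentSpace (𝓡 n) x →L[ℝ] TangentSpace (𝓡 n) x →L[ℝ] ℝ)

/-- The differential of a real function, as a one-form. -/
def differential (f : M → ℝ) : OneForm n M := fun x => mvfderiv (𝓡 n) f x

variable [IsManifold (𝓡 n) ∞ M]

/-- The vector field equal to `v` at `x` with constant components, near `x`, in the preferred
chart at `x`.  It is smooth near `x`, and serves to evaluate tensorial expressions at `x`. -/
def extendVec {x : M} (v : TangentSpace (𝓡 n) x) : VectorField n M :=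
  FiberBundle.extend (EuclideanSpace ℝ (Fin n)) v

/-- The vector field `X` is smooth on the set `U`. -/
def SmoothVectorFieldOn (X : VectorField n M) (U : Set M) : Prop :=
  ContMDiffOn (𝓡 n) ((𝓡 n).prod 𝓘(ℝ, EuclideanSpace ℝ (Fin n))) ∞
    (fun x => TotalSpace.mk' (EuclideanSpace ℝ (Fin n)) x (X x)) U

/-- The one-form `η` is smooth. -/
def SmoothOneForm (η : OneForm n M) : Prop :=
  ContMDiff (𝓡 n) ((𝓡 n).prod 𝓘(ℝ, EuclideanSpace ℝ (Fin n) →L[ℝ] ℝ)) ∞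
    (fun x => TotalSpace.mk' (EuclideanSpace ℝ (Fin n) →L[ℝ] ℝ) x (η x))

/-- The `(0,2)` tensor `A` is smooth. -/
def SmoothTensor2 (A : Tensor2 n M) : Prop :=
  ContMDiff (𝓡 n)
    ((𝓡 n).prod 𝓘(ℝ, EuclideanSpace ℝ (Fin n) →L[ℝ] EuclideanSpace ℝ (Fin n) →L[ℝ] ℝ)) ∞
    (fun x => TotalSpace.mk'
      (EuclideanSpace ℝ (Fin n) →L[ℝ] EuclideanSpace ℝ (Fin n) →L[ℝ] ℝ) x (A x))

/-- The one-form `η` is differentiable at `x`. -/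
def DiffOneFormAt (η : OneForm n M) (x : M) : Prop :=
  MDifferentiableAt (𝓡 n) ((𝓡 n).prod 𝓘(ℝ, EuclideanSpace ℝ (Fin n) →L[ℝ] ℝ))
    (fun x => TotalSpace.mk' (EuclideanSpace ℝ (Fin n) →L[ℝ] ℝ) x (η x)) x

variable (n M) in
/-- Affine connections on `M`; `∇ Y x u` is `∇_u Y` at `x`. -/
abbrev Connection : Type _ :=
  CovariantDerivative (𝓡 n) (EuclideanSpace ℝ (Fin n))
    (fun x : M => TangentSpace (𝓡 n) x)

/-- `u ↦ u(η(Y)) - η(∇_u Y)` at `x`. -/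
def covFormAux (cov : Connection n M) (η : OneForm n M) (x : M) (Y : VectorField n M) :
    TangentSpace (𝓡 n) x →L[ℝ] ℝ :=
  differential (fun y => η y (Y y)) x - (η x).comp (cov Y x)

lemma DiffOneFormAt.apply {η : OneForm n M} {x : M} (hη : DiffOneFormAt η x)
    {Y : VectorField n M}
    (hY : MDifferentiableAt (𝓡 n) ((𝓡 n).prod 𝓘(ℝ, EuclideanSpace ℝ (Fin n)))
      (fun x => TotalSpace.mk' (EuclideanSpace ℝ (Fin n)) x (Y x)) x) :
    MDifferentiableAt (𝓡 n) 𝓘(ℝ, ℝ) (fun y => η y (Y y)) x := by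
  have h := MDifferentiableAt.clm_bundle_apply (F₁ := EuclideanSpace ℝ (Fin n)) (F₂ := ℝ)
    (E₁ := fun x : M => TangentSpace (𝓡 n) x) (E₂ := Bundle.Trivial M ℝ)
    (b := fun y : M => y) (ϕ := η) (v := Y) hη hY
  exact ((mdifferentiableAt_totalSpace (𝓡 n) _).1 h).2

lemma covFormAux_tensorial (cov : Connection n M) {η : OneForm n M} {x : M}
    (hη : DiffOneFormAt η x) (u : TangentSpace (𝓡 n) x) :
    TensorialAt (𝓡 n) (EuclideanSpace ℝ (Fin n)) (fun Y => covFormAux cov η x Y u) x where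
  smul {f Y} hf hY := by
    have e : (fun y => η y ((f • Y) y)) = fun y => f y * η y (Y y) := by
      funext y; simp
    simp only [covFormAux, differential, e, mvfderiv_fun_mul hf (hη.apply hY),
      cov.isCovariantDerivativeOn.leibniz hY hf]
    simp
    ring
  add {Y Y'} hY hY' := by
    have e : (fun y => η y ((Y + Y') y)) = fun y => η y (Y y) + η y (Y' y) := by
      funext y; simp
    simp only [covFormAux, differential, e, mvfderiv_fun_add (hη.apply hY) (hη.apply hY'),
      cov.isCovariantDerivativeOn.add hY hY']
    simp
    ring

open Classical in
/-- The covariant derivative of a one-form: `covForm cov η x u = ∇_u η` is characterized by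
`(∇_u η)(Y) = u(η(Y)) - η(∇_u Y)`.  (Zero where `η` is not differentiable.) -/
def covForm (cov : Connection n M) (η : OneForm n M) (x : M) (u : TangentSpace (𝓡 n) x) :
    TangentSpace (𝓡 n) x →L[ℝ] ℝ :=
  if hη : DiffOneFormAt η x then
    TensorialAt.mkHom (fun Y => covFormAux cov η x Y u) x (covFormAux_tensorial cov hη u)
  else 0

lemma covForm_apply (cov : Connection n M) {η : OneForm n M} {x : M}
    (hη : DiffOneFormAt η x) {Y : VectorField n M}
    (hY : MDifferentiableAt (𝓡 n) ((𝓡 n).prod 𝓘(ℝ, EuclideanSpace ℝ (Fin n)))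
      (fun x => TotalSpace.mk' (EuclideanSpace ℝ (Fin n)) x (Y x)) x)
    (u : TangentSpace (𝓡 n) x) :
    covForm cov η x u (Y x) = differential (fun y => η y (Y y)) x u - η x (cov Y x u) := by
  rw [covForm, dif_pos hη, TensorialAt.mkHom_apply _ hY]
  rfl

/-- The covariant derivative `∇_X η` along a vector field. -/
def covFormAlong (cov : Connection n M) (X : VectorField n M) (η : OneForm n M) : OneForm n M :=
  fun x => covForm cov η x (X x)

/-- The second covariant derivative `∇²_{u,v} η = ∇_u (∇_V η) - ∇_{∇_u V} η` at `x`, for a vector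
field `V` extending `v`. -/
def secondCovForm (cov : Connection n M) (η : OneForm n M) (x : M)
    (u v : TangentSpace (𝓡 n) x) : TangentSpace (𝓡 n) x →L[ℝ] ℝ :=
  covForm cov (covFormAlong cov (extendVec v) η) x u - covForm cov η x (cov (extendVec v) x u)

/-- The exterior derivative of a one-form at `x`:
`dη(U, V) = U(η(V)) - V(η(U)) - η([U, V])`, for vector fields extending `u` and `v`. -/
def extDeriv (η : OneForm n M) (x : M) (u v : TangentSpace (𝓡 n) x) : ℝ :=
  differential (fun y => η y (extendVec v y)) x u
    - differential (fun y => η y (extendVec u y)) x v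
    - η x (VectorField.mlieBracket (𝓡 n) (extendVec u) (extendVec v) x)

/-- The curvature `R(u,v)w = ∇_U ∇_V W - ∇_V ∇_U W - ∇_{[U,V]} W` at `x`, for vector fields
extending `u`, `v`, `w`. -/
def curvature (cov : Connection n M) (x : M) (u v w : TangentSpace (𝓡 n) x) :
    TangentSpace (𝓡 n) x :=
  cov (fun y => cov (extendVec w) y (extendVec v y)) x u
    - cov (fun y => cov (extendVec w) y (extendVec u y)) x v
    - cov (extendVec w) x (VectorField.mlieBracket (𝓡 n) (extendVec u) (extendVec v) x)

/-- The covariant derivative of the torsion,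
`(∇_u T)(v,w) = ∇_u (T(V,W)) - T(∇_u V, w) - T(v, ∇_u W)` at `x`, for vector fields extending
`v` and `w`. -/
def covTorsion (cov : Connection n M) (x : M) (u v w : TangentSpace (𝓡 n) x) :
    TangentSpace (𝓡 n) x :=
  cov (fun y => cov.torsion y (extendVec v y) (extendVec w y)) x u
    - cov.torsion x (cov (extendVec v) x u) w
    - cov.torsion x v (cov (extendVec w) x u)

end Calculus

/-! ### Sub-Riemannian manifolds with transverse symmetries -/

section Structure

variable {n : ℕ} {M : Type*} [TopologicalSpace M] [ChartedSpace (EuclideanSpace ℝ (Fin n)) M]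
  [IsManifold (𝓡 n) ∞ M]

/-- Iterated Lie brackets of smooth horizontal vector fields. -/
inductive IteratedBracket (hor : Π x : M, Submodule ℝ (TangentSpace (𝓡 n) x)) :
    VectorField n M → Prop
  | horizontal (X : VectorField n M) (hX : SmoothVectorFieldOn X univ)
      (hhor : ∀ x, X x ∈ hor x) : IteratedBracket hor X
  | bracket (X Y : VectorField n M) (hX : IteratedBracket hor X) (hY : IteratedBracket hor Y) :
      IteratedBracket hor (VectorField.mlieBracket (𝓡 n) X Y)

/-- `Z` is a sub-Riemannian Killing field: bracketing with `Z` preserves (local) horizontal vector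
fields, and `L_Z gH = 0`, i.e. `Z (gH(X,Y)) = gH([Z,X],Y) + gH(X,[Z,Y])` for horizontal `X`, `Y`. -/
structure IsKilling (hor : Π x : M, Submodule ℝ (TangentSpace (𝓡 n) x)) (gH : Tensor2 n M)
    (Z : VectorField n M) : Prop where
  bracket_mem : ∀ (U : Set M) (X : VectorField n M), IsOpen U → SmoothVectorFieldOn X U →
    (∀ x ∈ U, X x ∈ hor x) → ∀ x ∈ U, VectorField.mlieBracket (𝓡 n) Z X x ∈ hor x
  lieDeriv_eq_zero : ∀ (U : Set M) (X Y : VectorField n M), IsOpen U →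
    SmoothVectorFieldOn X U → SmoothVectorFieldOn Y U →
    (∀ x ∈ U, X x ∈ hor x) → (∀ x ∈ U, Y x ∈ hor x) → ∀ x ∈ U,
    differential (fun y => gH y (X y) (Y y)) x (Z x) =
      gH x (VectorField.mlieBracket (𝓡 n) Z X x) (Y x)
        + gH x (X x) (VectorField.mlieBracket (𝓡 n) Z Y x)

/-- Evaluation of vector fields at a point. -/
def evalAt (x : M) : VectorField n M →ₗ[ℝ] TangentSpace (𝓡 n) x := LinearMap.proj x

/-- A positive definite symmetric bilinear form on an `m`-dimensional space has an orthonormal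
basis. -/
lemma exists_orthonormal {V : Type*} [AddCommGroup V] [Module ℝ V] [FiniteDimensional ℝ V]
    {m : ℕ} (hm : Module.finrank ℝ V = m) (B : V →ₗ[ℝ] V →ₗ[ℝ] ℝ)
    (hsymm : ∀ u v, B u v = B v u) (hpos : ∀ v, v ≠ 0 → 0 < B v v) :
    ∃ e : Fin m → V, ∀ i j, B (e i) (e j) = if i = j then 1 else 0 := by
  let c : InnerProductSpace.Core ℝ V :=
    { inner := fun u v => B u v
      conj_inner_symm := fun u v => by simpa using hsymm v u
      re_inner_nonneg := fun v => by
        by_cases hv : v = 0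
        · simp [hv]
        · simpa using (hpos v hv).le
      add_left := fun u v w => by simp
      smul_left := fun u v r => by simp
      definite := fun v hv => by
        by_contra hne
        exact (hpos v hne).ne' hv }
  let : NormedAddCommGroup V := c.toNormedAddCommGroup
  let : InnerProductSpace ℝ V := InnerProductSpace.ofCore c.toCore
  subst hm
  refine ⟨stdOrthonormalBasis ℝ V, fun i j => ?_⟩
  exact orthonormal_iff_ite.1 (stdOrthonormalBasis ℝ V).orthonormal i j

end Structure

/-- A sub-Riemannian structure with transverse symmetries on a manifold `M` of dimension `d + h`. -/
structure TransverseStructure (d h : ℕ) (M : Type*) [TopologicalSpace M]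
    [ChartedSpace (EuclideanSpace ℝ (Fin (d + h))) M] [IsManifold (𝓡 (d + h)) ∞ M] where
  /-- The horizontal distribution. -/
  hor : Π x : M, Submodule ℝ (TangentSpace (𝓡 (d + h)) x)
  /-- The fiberwise inner product on the horizontal distribution, extended to the tangent bundle
  by zero on vertical vectors. -/
  gH : Tensor2 (d + h) M
  /-- The Lie algebra of vertical Killing fields. -/
  vert : Submodule ℝ (VectorField (d + h) M)
  /-- The inner product on the Lie algebra of vertical Killing fields. -/
  gV : vert →ₗ[ℝ] vert →ₗ[ℝ] ℝ
  finrank_hor : ∀ x, Module.finrank ℝ (hor x) = d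
  hor_smooth : ∀ x, ∃ (U : Set M) (X : Fin d → VectorField (d + h) M), IsOpen U ∧ x ∈ U ∧
    (∀ i, SmoothVectorFieldOn (X i) U) ∧
    ∀ y ∈ U, hor y = Submodule.span ℝ (Set.range fun i => X i y)
  bracket_generating : ∀ x,
    Submodule.span ℝ {v | ∃ W : VectorField (d + h) M, IteratedBracket hor W ∧ W x = v} = ⊤
  gH_smooth : SmoothTensor2 gH
  gH_symm : ∀ x u v, gH x u v = gH x v u
  gH_pos : ∀ x, ∀ u ∈ hor x, u ≠ 0 → 0 < gH x u u
  gH_vert : ∀ Z ∈ vert, ∀ x v, gH x (Z x) v = 0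
  finiteDimensional_vert : FiniteDimensional ℝ vert
  finrank_vert : Module.finrank ℝ vert = h
  vert_smooth : ∀ Z ∈ vert, SmoothVectorFieldOn Z univ
  vert_bracket : ∀ Z ∈ vert, ∀ W ∈ vert, VectorField.mlieBracket (𝓡 (d + h)) Z W ∈ vert
  vert_killing : ∀ Z ∈ vert, IsKilling hor gH Z
  isCompl : ∀ x, IsCompl (hor x) (vert.map (evalAt x))
  gV_symm : ∀ Z W, gV Z W = gV W Z
  gV_pos : ∀ Z, Z ≠ 0 → 0 < gV Z Z

namespace TransverseStructure

variable {d h : ℕ} {M : Type*} [TopologicalSpace M]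
  [ChartedSpace (EuclideanSpace ℝ (Fin (d + h))) M] [IsManifold (𝓡 (d + h)) ∞ M]
  (S : TransverseStructure d h M)

/-- The vertical subspace at `x`. -/
def verSpace (x : M) : Submodule ℝ (TangentSpace (𝓡 (d + h)) x) := S.vert.map (evalAt x)

lemma finrank_tangent (x : M) : Module.finrank ℝ (TangentSpace (𝓡 (d + h)) x) = d + h := by
  change Module.finrank ℝ (EuclideanSpace ℝ (Fin (d + h))) = d + h
  simp

instance (x : M) : FiniteDimensional ℝ (TangentSpace (𝓡 (d + h)) x) :=
  inferInstanceAs (FiniteDimensional ℝ (EuclideanSpace ℝ (Fin (d + h))))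

instance (x : M) : T2Space (TangentSpace (𝓡 (d + h)) x) :=
  inferInstanceAs (T2Space (EuclideanSpace ℝ (Fin (d + h))))

/-- The evaluation map from the vertical Lie algebra to the tangent space. -/
def evalVert (x : M) : S.vert →ₗ[ℝ] TangentSpace (𝓡 (d + h)) x :=
  (evalAt x).comp S.vert.subtype

lemma range_evalVert (x : M) : LinearMap.range (S.evalVert x) = S.verSpace x := by
  rw [evalVert, LinearMap.range_comp, Submodule.range_subtype, verSpace]

lemma finrank_verSpace (x : M) : Module.finrank ℝ (S.verSpace x) = h := by
  have h1 := Submodule.finrank_add_eq_of_isCompl (S.isCompl x)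
  have h2 := finrank_tangent (d := d) (h := h) x
  have h3 := S.finrank_hor x
  have h4 : Module.finrank ℝ (S.verSpace x) = Module.finrank ℝ (S.vert.map (evalAt x)) := rfl
  omega

lemma evalVert_injective (x : M) : Function.Injective (S.evalVert x) := by
  have := S.finiteDimensional_vert
  have h1 := LinearMap.finrank_range_add_finrank_ker (S.evalVert x)
  rw [range_evalVert, finrank_verSpace, S.finrank_vert] at h1
  rw [← LinearMap.ker_eq_bot]
  exact Submodule.finrank_eq_zero.1 (by omega)

/-- The unique element of the vertical Lie algebra whose value at `x` is the vertical component
of the tangent vector `u`. -/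
def vertLift (x : M) : TangentSpace (𝓡 (d + h)) x →ₗ[ℝ] S.vert :=
  (LinearEquiv.ofInjective (S.evalVert x) (S.evalVert_injective x)).symm.toLinearMap.comp
    ((LinearEquiv.ofEq _ _ (S.range_evalVert x).symm).toLinearMap.comp
      (Submodule.projectionOnto (S.verSpace x) (S.hor x) (S.isCompl x).symm))

lemma vertLift_vert (x : M) (Z : S.vert) : S.vertLift x (Z.1 x) = Z := by
  have hmem : S.evalVert x Z ∈ S.verSpace x := S.range_evalVert x ▸ LinearMap.mem_range_self _ Z
  have h1 : Submodule.projectionOnto (S.verSpace x) (S.hor x) (S.isCompl x).symm (Z.1 x)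
      = ⟨S.evalVert x Z, hmem⟩ :=
    Submodule.projectionOnto_apply_left (S.isCompl x).symm ⟨S.evalVert x Z, hmem⟩
  simp only [vertLift, LinearMap.comp_apply, h1]
  exact (LinearEquiv.symm_apply_eq _).2 rfl

lemma vertLift_hor (x : M) {u : TangentSpace (𝓡 (d + h)) x} (hu : u ∈ S.hor x) :
    S.vertLift x u = 0 := by
  have h1 : Submodule.projectionOnto (S.verSpace x) (S.hor x) (S.isCompl x).symm u = 0 :=
    Submodule.projectionOnto_apply_right (S.isCompl x).symm ⟨u, hu⟩
  simp only [vertLift, LinearMap.comp_apply, h1, map_zero]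

/-- The inner product of vertical components. -/
def gVer (x : M) (u v : TangentSpace (𝓡 (d + h)) x) : ℝ := S.gV (S.vertLift x u) (S.vertLift x v)

/-- The one-form `gV(u, ·)` at `x`. -/
def flatVer (x : M) (u : TangentSpace (𝓡 (d + h)) x) : TangentSpace (𝓡 (d + h)) x →L[ℝ] ℝ :=
  LinearMap.toContinuousLinearMap ((S.gV (S.vertLift x u)).comp (S.vertLift x))

/-- The Riemannian metric `g_ε = gH ⊕ ε⁻¹ gV`. -/
def metric (ε : ℝ) (x : M) (u v : TangentSpace (𝓡 (d + h)) x) : ℝ :=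
  S.gH x u v + ε⁻¹ * S.gVer x u v

lemma exists_horBasis (x : M) : ∃ e : Fin d → TangentSpace (𝓡 (d + h)) x,
    (∀ i, e i ∈ S.hor x) ∧ ∀ i j, S.gH x (e i) (e j) = if i = j then 1 else 0 := by
  let B : S.hor x →ₗ[ℝ] S.hor x →ₗ[ℝ] ℝ :=
    LinearMap.mk₂ ℝ (fun u v => S.gH x u v) (by simp) (by simp) (by simp) (by simp)
  obtain ⟨e, he⟩ := exists_orthonormal (S.finrank_hor x) B (fun u v => S.gH_symm x u v)
    (fun v hv => S.gH_pos x v v.2 (by simpa using hv))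
  exact ⟨fun i => e i, fun i => (e i).2, he⟩

/-- A `gH`-orthonormal basis of the horizontal space at `x`. -/
def horBasis (x : M) : Fin d → TangentSpace (𝓡 (d + h)) x := (S.exists_horBasis x).choose

lemma exists_vertBasis : ∃ Z : Fin h → S.vert,
    ∀ i j, S.gV (Z i) (Z j) = if i = j then 1 else 0 := by
  have := S.finiteDimensional_vert
  exact exists_orthonormal S.finrank_vert S.gV S.gV_symm S.gV_pos

/-- A `gV`-orthonormal basis of the vertical Lie algebra. -/
def vertBasis : Fin h → S.vert := S.exists_vertBasis.choose

/-- The one-form `gH(u, ·)` at `x`. -/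
def flatHor (x : M) (u : TangentSpace (𝓡 (d + h)) x) : TangentSpace (𝓡 (d + h)) x →L[ℝ] ℝ :=
  S.gH x u

/-- The horizontal component of a tangent vector (recall that `gH` kills vertical vectors). -/
def horProj (x : M) (u : TangentSpace (𝓡 (d + h)) x) : TangentSpace (𝓡 (d + h)) x :=
  ∑ i, S.gH x (S.horBasis x i) u • S.horBasis x i

/-- The inner product on one-forms for which the forms dual to a horizontal orthonormal frame are
orthonormal and vertical forms are in the kernel. -/
def coHor (x : M) (α β : TangentSpace (𝓡 (d + h)) x →L[ℝ] ℝ) : ℝ :=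
  ∑ i, α (S.horBasis x i) * β (S.horBasis x i)

/-- The inner product `g_ε = gH ⊕ ε gV` on one-forms: if `θ_i`, `ν_m` is the coframe dual to an
adapted frame, then the forms `θ_i`, `ε^{-1/2} ν_m` are orthonormal. -/
def cometric (ε : ℝ) (x : M) (α β : TangentSpace (𝓡 (d + h)) x →L[ℝ] ℝ) : ℝ :=
  S.coHor x α β + ε * ∑ m, α ((S.vertBasis m).1 x) * β ((S.vertBasis m).1 x)

/-- The inner product induced by `g_ε` on `(0,2)` tensors. -/
def tensorInner (ε : ℝ) (x : M)
    (A B : TangentSpace (𝓡 (d + h)) x →L[ℝ] TangentSpace (𝓡 (d + h)) x →L[ℝ] ℝ) : ℝ :=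
  ∑ i, S.cometric ε x (A (S.horBasis x i)) (B (S.horBasis x i))
    + ε * ∑ m, S.cometric ε x (A ((S.vertBasis m).1 x)) (B ((S.vertBasis m).1 x))

/-- `e` is an orthonormal basis of the horizontal space at `x`. -/
def IsHorOrthonormal (x : M) (e : Fin d → TangentSpace (𝓡 (d + h)) x) : Prop :=
  (∀ i, e i ∈ S.hor x) ∧ ∀ i j, S.gH x (e i) (e j) = if i = j then 1 else 0

/-- `Z` is an orthonormal basis of the vertical Lie algebra. -/
def IsVertOrthonormal (Z : Fin h → S.vert) : Prop :=
  ∀ i j, S.gV (Z i) (Z j) = if i = j then 1 else 0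

/-- `X_1, …, X_d, Z_1, …, Z_h` is an adapted frame on the open set `U`. -/
structure IsAdaptedFrame (U : Set M) (X : Fin d → VectorField (d + h) M) (Z : Fin h → S.vert) :
    Prop where
  isOpen : IsOpen U
  smooth : ∀ i, SmoothVectorFieldOn (X i) U
  horizontal : ∀ x ∈ U, S.IsHorOrthonormal x (fun i => X i x)
  vertical : S.IsVertOrthonormal Z

/-! #### The canonical connection -/

/-- The canonical connection: the smooth metric connection which preserves horizontal fields,
parallelizes the vertical Lie algebra, and whose torsion is vertical on pairs of horizontal vectors
and zero on pairs of a horizontal and a vertical vector. -/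
structure IsCanonicalConnection (cov : Connection (d + h) M) : Prop where
  smooth : ∀ U : Set M, IsOpen U →
    ContMDiffCovariantDerivativeOn (EuclideanSpace ℝ (Fin (d + h))) ∞ cov.toFun U
  metric : ∀ ε : ℝ, 0 < ε → ∀ (x : M) (Y W : VectorField (d + h) M) (U : Set M), IsOpen U →
    x ∈ U → SmoothVectorFieldOn Y U → SmoothVectorFieldOn W U →
    ∀ u, differential (fun y => S.metric ε y (Y y) (W y)) x u =
      S.metric ε x (cov Y x u) (W x) + S.metric ε x (Y x) (cov W x u)
  horizontal : ∀ (x : M) (Y : VectorField (d + h) M) (U : Set M), IsOpen U → x ∈ U →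
    SmoothVectorFieldOn Y U → (∀ y ∈ U, Y y ∈ S.hor y) → ∀ u ∈ S.hor x, cov Y x u ∈ S.hor x
  vertical : ∀ Z ∈ S.vert, ∀ x, cov Z x = 0
  torsion_hor_hor : ∀ x, ∀ u ∈ S.hor x, ∀ v ∈ S.hor x, cov.torsion x u v ∈ S.verSpace x
  torsion_hor_vert : ∀ x, ∀ u ∈ S.hor x, ∀ Z ∈ S.vert, cov.torsion x u (Z x) = 0

variable (cov : Connection (d + h) M)

/-- The Yang-Mills condition: the horizontal trace of `∇T` vanishes on horizontal vectors. -/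
def IsYangMills : Prop :=
  ∀ x, ∀ w ∈ S.hor x, ∑ i, covTorsion cov x (S.horBasis x i) (S.horBasis x i) w = 0

/-! #### The sub-Laplacian on functions -/

/-- The horizontal gradient. -/
def gradHor (f : M → ℝ) (x : M) : TangentSpace (𝓡 (d + h)) x :=
  ∑ i, differential (n := d + h) f x (S.horBasis x i) • S.horBasis x i

/-- The sub-Laplacian on functions, `L f = ∑ X_i X_i f - (∇_{X_i} X_i) f = ∑ (∇_{X_i} df)(X_i)`. -/
def subLaplacian (f : M → ℝ) (x : M) : ℝ :=
  ∑ i, covForm cov (differential f) x (S.horBasis x i) (S.horBasis x i)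

/-- The Riemannian volume of `g_1` in the preferred chart at `x`: the push-forward of
`√(det g_1) dy`, with `g_1` expressed in the coordinates. -/
def chartVolume [MeasurableSpace M] (x : M) : Measure M :=
  Measure.map (chartAt (EuclideanSpace ℝ (Fin (d + h))) x).symm
    ((volume.restrict (chartAt (EuclideanSpace ℝ (Fin (d + h))) x).target).withDensity
      fun y => ENNReal.ofReal (Real.sqrt (Matrix.det (Matrix.of fun a b : Fin (d + h) =>
        S.metric 1 ((chartAt (EuclideanSpace ℝ (Fin (d + h))) x).symm y)
          (mfderiv (𝓡 (d + h)) (𝓡 (d + h))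
            (chartAt (EuclideanSpace ℝ (Fin (d + h))) x).symm y (EuclideanSpace.single a 1))
          (mfderiv (𝓡 (d + h)) (𝓡 (d + h))
            (chartAt (EuclideanSpace ℝ (Fin (d + h))) x).symm y (EuclideanSpace.single b 1))))))

/-- The Riemannian volume measure of `g_1`: the measures `chartVolume x` agree on the overlaps of
the charts, and this is the measure on `M` which restricts to each of them. -/
def volumeMeasure [MeasurableSpace M] : Measure M := ⨆ x : M, S.chartVolume x

/-- `L` is the generator of the form `∫ ⟨∇_H f, ∇_H g⟩_H dμ`. -/
def IsDirichletGenerator [MeasurableSpace M] (L : (M → ℝ) → M → ℝ) : Prop :=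
  ∀ f : M → ℝ, ContMDiff (𝓡 (d + h)) 𝓘(ℝ, ℝ) ∞ f →
    ContMDiff (𝓡 (d + h)) 𝓘(ℝ, ℝ) ∞ (L f) ∧
    ∀ g : M → ℝ, ContMDiff (𝓡 (d + h)) 𝓘(ℝ, ℝ) ∞ g → HasCompactSupport g →
      ∫ x, S.gH x (S.gradHor f x) (S.gradHor g x) ∂S.volumeMeasure
        = - ∫ x, L f x * g x ∂S.volumeMeasure

/-! #### Tensors and operators on one-forms -/

/-- The map `J_Z`, given by `gH(J_Z u, v) = gV(Z, T(u, v))` for horizontal `u`, `v`, and zero on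
vertical vectors. -/
def JVec (Z : S.vert) (x : M) (u : TangentSpace (𝓡 (d + h)) x) : TangentSpace (𝓡 (d + h)) x :=
  ∑ i, S.gV Z (S.vertLift x (cov.torsion x (S.horProj x u) (S.horBasis x i))) • S.horBasis x i

/-- `J_Z` on one-forms, by duality: `θ_i = gH(X_i, ·)` is mapped to `gH(J_Z X_i, ·)`, and vertical
forms are mapped to zero. -/
def JForm (Z : S.vert) (x : M) (α : TangentSpace (𝓡 (d + h)) x →L[ℝ] ℝ) :
    TangentSpace (𝓡 (d + h)) x →L[ℝ] ℝ :=
  ∑ i, α (S.horBasis x i) • S.flatHor x (S.JVec cov Z x (S.horBasis x i))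

/-- The adjoint of `J_Z` on one-forms, `J_Z^* α = ∑ ⟨α, J_Z θ_i⟩ θ_i`. -/
def JFormAdj (Z : S.vert) (x : M) (α : TangentSpace (𝓡 (d + h)) x →L[ℝ] ℝ) :
    TangentSpace (𝓡 (d + h)) x →L[ℝ] ℝ :=
  ∑ i, S.coHor x α (S.JForm cov Z x (S.flatHor x (S.horBasis x i))) •
    S.flatHor x (S.horBasis x i)

/-- `∑ J_{Z_m}^* J_{Z_m}` on one-forms, for a family `Z_1, …, Z_h`. -/
def sumJStarJ (Z : Fin h → S.vert) (x : M) (α : TangentSpace (𝓡 (d + h)) x →L[ℝ] ℝ) :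
    TangentSpace (𝓡 (d + h)) x →L[ℝ] ℝ :=
  ∑ m, S.JFormAdj cov (Z m) x (S.JForm cov (Z m) x α)

/-- `J^* J = ∑ J_{Z_m}^* J_{Z_m}`, for an orthonormal basis of the vertical Lie algebra. -/
def JStarJ (x : M) (α : TangentSpace (𝓡 (d + h)) x →L[ℝ] ℝ) :
    TangentSpace (𝓡 (d + h)) x →L[ℝ] ℝ :=
  S.sumJStarJ cov S.vertBasis x α

/-- The Ricci curvature of the connection, `Ric(v, w) = tr (u ↦ R(u, v) w)`. -/
def ricci (x : M) (v w : TangentSpace (𝓡 (d + h)) x) : ℝ :=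
  ∑ i, S.gH x (curvature cov x (S.horBasis x i) v w) (S.horBasis x i)
    + ∑ m, S.gVer x (curvature cov x ((S.vertBasis m).1 x) v w) ((S.vertBasis m).1 x)

/-- The map `Ric_H` on one-forms: `⟨Ric_H(df), dg⟩ = Ric(∇_H f, ∇_H g)`. -/
def ricHor (x : M) (α : TangentSpace (𝓡 (d + h)) x →L[ℝ] ℝ) :
    TangentSpace (𝓡 (d + h)) x →L[ℝ] ℝ :=
  ∑ i, ∑ j, (α (S.horBasis x i) * S.ricci cov x (S.horBasis x i) (S.horBasis x j)) •
    S.flatHor x (S.horBasis x j)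

/-- The covariant extension of the sub-Laplacian to one-forms,
`L = ∑ ∇_{X_i} ∇_{X_i} - ∇_{∇_{X_i} X_i}`. -/
def subLaplacianForm (η : OneForm (d + h) M) : OneForm (d + h) M :=
  fun x => ∑ i, secondCovForm cov η x (S.horBasis x i) (S.horBasis x i)

/-- The first order operator `∑ J_{Z_m} (d (ι_{Z_m} η))`. -/
def opJ (η : OneForm (d + h) M) : OneForm (d + h) M :=
  fun x => ∑ m, S.JForm cov (S.vertBasis m) x
    (differential (fun y => η y ((S.vertBasis m).1 y)) x)

/-- The operator `L + 2 ∑ J_{Z_m} (d ι_{Z_m}) - Ric_H`. -/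
def boxInfty (η : OneForm (d + h) M) : OneForm (d + h) M :=
  fun x => S.subLaplacianForm cov η x + (2 : ℝ) • S.opJ cov η x - S.ricHor cov x (η x)

/-- The map from two-forms to one-forms dual to the torsion of horizontal vectors: it sends
`θ_i ∧ θ_j` to `gV(T(X_i, X_j), ·)`, and kills the forms `θ_i ∧ ν_m` and `ν_l ∧ ν_m`. -/
def torsionDual (x : M)
    (om : TangentSpace (𝓡 (d + h)) x → TangentSpace (𝓡 (d + h)) x → ℝ) :
    TangentSpace (𝓡 (d + h)) x →L[ℝ] ℝ :=
  (1 / 2 : ℝ) • ∑ i, ∑ j, om (S.horBasis x i) (S.horBasis x j) •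
    S.flatVer x (cov.torsion x (S.horBasis x i) (S.horBasis x j))

/-- The operator `□_ε = □_∞ - ε⁻¹ T ∘ d`. -/
def box (ε : ℝ) (η : OneForm (d + h) M) : OneForm (d + h) M :=
  fun x => S.boxInfty cov η x - ε⁻¹ • S.torsionDual cov x (extDeriv η x)

/-- The map
`𝔗^ε_v α = - ∑ α(T(v, X_j)) θ_j + (2 ε)⁻¹ ∑ α(J_{Z_m} v) ν_m`, for a horizontal vector `v`. -/
def frakT (ε : ℝ) (x : M) (v : TangentSpace (𝓡 (d + h)) x)
    (α : TangentSpace (𝓡 (d + h)) x →L[ℝ] ℝ) : TangentSpace (𝓡 (d + h)) x →L[ℝ] ℝ :=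
  - ∑ j, α (cov.torsion x v (S.horBasis x j)) • S.flatHor x (S.horBasis x j)
    + (1 / (2 * ε)) • ∑ m, α (S.JVec cov (S.vertBasis m) x v) •
      S.flatVer x ((S.vertBasis m).1 x)

/-- The operator `∇_v - 𝔗^ε_v` at `x`. -/
def twisted (ε : ℝ) (η : OneForm (d + h) M) (x : M) (v : TangentSpace (𝓡 (d + h)) x) :
    TangentSpace (𝓡 (d + h)) x →L[ℝ] ℝ :=
  covForm cov η x v - S.frakT cov ε x v (η x)

/-- The operator `∇_X - 𝔗^ε_X`, for a vector field `X`. -/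
def twistedAlong (ε : ℝ) (X : VectorField (d + h) M) (η : OneForm (d + h) M) :
    OneForm (d + h) M :=
  fun x => S.twisted cov ε η x (X x)

/-- The operator `∇_H - 𝔗^ε_H` from one-forms to `(0,2)` tensors,
`∑ θ_i ⊗ (∇_{X_i} η - 𝔗^ε_{X_i} η)`, with the direction of differentiation as first argument. -/
def twistedHor (ε : ℝ) (η : OneForm (d + h) M) : Tensor2 (d + h) M :=
  fun x => ∑ i, (S.flatHor x (S.horBasis x i)).smulRight (S.twisted cov ε η x (S.horBasis x i))

/-- `Dstar` is the formal adjoint, for the metric `g_ε` and the volume measure, of the operator `D`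
from one-forms to `(0,2)` tensors. -/
def IsFormalAdjoint [MeasurableSpace M] (ε : ℝ) (D : OneForm (d + h) M → Tensor2 (d + h) M)
    (Dstar : Tensor2 (d + h) M → OneForm (d + h) M) : Prop :=
  ∀ A : Tensor2 (d + h) M, SmoothTensor2 A →
    SmoothOneForm (Dstar A) ∧
    ∀ η : OneForm (d + h) M, SmoothOneForm η → IsCompact (closure {x | η x ≠ 0}) →
      ∫ x, S.tensorInner ε x (D η x) (A x) ∂S.volumeMeasure
        = ∫ x, S.cometric ε x (η x) (Dstar A x) ∂S.volumeMeasure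

end TransverseStructure
end TransverseSR

end

/-! Existence of the connection. The horizontal part of ∇_u Y is prescribed by the Koszul formula
for the degenerate form `gH`, the vertical part by differentiating the components of Y in a basis of
`vert`. Tensoriality and the Leibniz rule of the Koszul expression use only that `gH` is bilinear
and symmetric. The degeneracy is harmless because L_Z `gH` = 0 holds on all fields, not only on
horizontal ones (`lieDeriv_gH`), so the expression vanishes as soon as its second or third slot lies
in `vert`. The third slot shows that it is represented by a horizontal vector, the second that Z is
parallel.

Sum of squares (`box_eq_sum_of_squares`). Expanding (∇_X - 𝔗_X)² gives ∇², the derivative of 𝔗, the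
term -2 𝔗_X ∇_X and the term 𝔗_X². Since `gH` and the forms ν_Z are parallel, differentiating 𝔗 only
produces ∇T, whose horizontal trace is zero by the Yang-Mills condition. On a horizontal vector, -2
𝔗_X ∇_X sums to 2 ∑ J_Z(d ι_Z η), because Z is parallel, and 𝔗_X² sums to -(2ε)⁻¹ J*J η, which the
explicit J*J term compensates. On Z, dη is the antisymmetrized ∇η plus η ∘ T; its ∇η part matches -2
𝔗_X ∇_X, and its torsion part matches 𝔗_X². The Ricci term is the same on both sides and plays no
role.

Bochner identity (`bochner`). The connection preserves every cometric (`differential_cometric`), and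
𝔗^ε_v is skew for exactly the weight 2ε (`cometric_frakT`). Hence ∇ - 𝔗 is metric for g_{2ε} in
horizontal directions, and applying ∑ X_i² - ∇_{X_i} X_i to ‖η‖² gives twice ⟨∑ squares, η⟩ + ∑ ‖(∇
- 𝔗)η‖². The sum of squares formula does the rest.

Integration. Both the Dirichlet form and the formal adjoint reduce to one fact: the trace of ∇W
integrates to zero for a compactly supported horizontal field W (`integral_divergence`). As ∇
preserves g_1 and the endomorphism T(w, ·) is trace-free for horizontal w, this trace is the
Riemannian divergence: in a chart ρ tr ∇W = ∑ ∂_a(ρ W^a), where ρ = √det g_1 is differentiated by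
Jacobi's formula. The volume measure is a supremum of chart measures. These agree on overlaps by
change of variables, so its restriction to a chart domain is the chart measure, and a partition of
unity concludes.

The pointwise bases `horBasis` carry no regularity. Every statement involving derivatives is
therefore moved to a smooth adapted frame, using that traces of bilinear maps do not depend on the
orthonormal basis (`IsHorOrthonormal.sum_bilin_eq`). -/

noncomputable section

namespace TransverseSR

/-! ### Local smoothness of functions and sections -/

section Toolkit

variable {n : ℕ} {M : Type*} [TopologicalSpace M] [ChartedSpace (EuclideanSpace ℝ (Fin n)) M]

/-- The function `f` is smooth on a neighborhood of `x`. -/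
def SmoothFunNear (f : M → ℝ) (x : M) : Prop :=
  ∀ᶠ y in 𝓝 x, ContMDiffAt (𝓡 n) 𝓘(ℝ, ℝ) ∞ f y

/-- The section `σ` of the bundle `V` is smooth on a neighborhood of `x`. -/
def SmoothNear {n : ℕ} {M : Type*} [TopologicalSpace M]
    [ChartedSpace (EuclideanSpace ℝ (Fin n)) M] (F : Type*) [NormedAddCommGroup F]
    [NormedSpace ℝ F] {V : M → Type*} [TopologicalSpace (TotalSpace F V)]
    [∀ x, TopologicalSpace (V x)] [FiberBundle F V] (σ : Π x, V x) (x : M) : Prop :=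
  ∀ᶠ y in 𝓝 x, ContMDiffAt (𝓡 n) ((𝓡 n).prod 𝓘(ℝ, F)) ∞ (fun y => TotalSpace.mk' F y (σ y)) y

namespace SmoothFunNear

variable {f g : M → ℝ} {x : M}

lemma contMDiffAt (hf : SmoothFunNear (n := n) f x) : ContMDiffAt (𝓡 n) 𝓘(ℝ, ℝ) ∞ f x :=
  Eventually.self_of_nhds hf

lemma mdiff (hf : SmoothFunNear (n := n) f x) : MDifferentiableAt (𝓡 n) 𝓘(ℝ, ℝ) f x :=
  hf.contMDiffAt.mdifferentiableAt (by simp)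

lemma congr (hf : SmoothFunNear (n := n) f x) (h : ∀ᶠ y in 𝓝 x, g y = f y) :
    SmoothFunNear (n := n) g x := by
  filter_upwards [hf, eventually_eventually_nhds.2 h] with y h1 h2
  exact h1.congr_of_eventuallyEq h2

lemma add (hf : SmoothFunNear (n := n) f x) (hg : SmoothFunNear (n := n) g x) :
    SmoothFunNear (n := n) (fun y => f y + g y) x := by
  filter_upwards [hf, hg] with y h1 h2 using h1.add h2

lemma sub (hf : SmoothFunNear (n := n) f x) (hg : SmoothFunNear (n := n) g x) :
    SmoothFunNear (n := n) (fun y => f y - g y) x := by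
  filter_upwards [hf, hg] with y h1 h2 using h1.sub h2

lemma neg (hf : SmoothFunNear (n := n) f x) : SmoothFunNear (n := n) (fun y => - f y) x := by
  filter_upwards [hf] with y h1 using h1.neg

lemma mul (hf : SmoothFunNear (n := n) f x) (hg : SmoothFunNear (n := n) g x) :
    SmoothFunNear (n := n) (fun y => f y * g y) x := by
  filter_upwards [hf, hg] with y h1 h2 using h1.mul h2

lemma const (c : ℝ) : SmoothFunNear (n := n) (fun _ : M => c) x :=
  Eventually.of_forall fun _ => contMDiffAt_const

lemma sum {ι : Type*} {s : Finset ι} {f : ι → M → ℝ}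
    (hf : ∀ i ∈ s, SmoothFunNear (n := n) (f i) x) :
    SmoothFunNear (n := n) (fun y => ∑ i ∈ s, f i y) x := by
  classical
  induction s using Finset.induction_on with
  | empty => simpa using const 0
  | insert a s ha ih =>
    simp only [Finset.sum_insert ha]
    exact (hf a (by simp)).add (ih fun i hi => hf i (by simp [hi]))

lemma comp {φ : ℝ → ℝ} (hf : SmoothFunNear (n := n) f x)
    (hφ' : ∀ᶠ t in 𝓝 (f x), ContDiffAt ℝ ∞ φ t) :
    SmoothFunNear (n := n) (fun y => φ (f y)) x := by
  filter_upwards [hf, hf.contMDiffAt.continuousAt.eventually hφ'] with y h1 h2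
  exact (h2.contMDiffAt).comp y h1

end SmoothFunNear

namespace SmoothNear

variable {F : Type*} [NormedAddCommGroup F] [NormedSpace ℝ F] {V : M → Type*}
  [TopologicalSpace (TotalSpace F V)] [∀ x, TopologicalSpace (V x)] [FiberBundle F V]
  {σ τ : Π x, V x} {x : M}

lemma contMDiffAt (hσ : SmoothNear (n := n) F σ x) :
    ContMDiffAt (𝓡 n) ((𝓡 n).prod 𝓘(ℝ, F)) ∞ (fun y => TotalSpace.mk' F y (σ y)) x :=
  Eventually.self_of_nhds hσ

lemma mdiff (hσ : SmoothNear (n := n) F σ x) :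
    MDifferentiableAt (𝓡 n) ((𝓡 n).prod 𝓘(ℝ, F)) (fun y => TotalSpace.mk' F y (σ y)) x :=
  hσ.contMDiffAt.mdifferentiableAt (by simp)

lemma eventually (hσ : SmoothNear (n := n) F σ x) : ∀ᶠ y in 𝓝 x, SmoothNear (n := n) F σ y :=
  eventually_eventually_nhds.2 hσ

lemma congr (hσ : SmoothNear (n := n) F σ x) (h : ∀ᶠ y in 𝓝 x, τ y = σ y) :
    SmoothNear (n := n) F τ x := by
  filter_upwards [hσ, eventually_eventually_nhds.2 h] with y h1 h2
  exact h1.congr_of_eventuallyEq (h2.mono fun z hz => by simp [hz])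

variable [∀ x, AddCommGroup (V x)] [∀ x, Module ℝ (V x)]

lemma extend (v : V x) [VectorBundle ℝ F V] [ContMDiffVectorBundle ∞ F V (𝓡 n)] :
    SmoothNear (n := n) F (FiberBundle.extend F v) x := by
  obtain ⟨s, hs, h⟩ := FiberBundle.exists_contMDiffOn_extend (k := ∞) (𝓡 n) F v
  filter_upwards [eventually_mem_nhds_iff.2 hs] with y hy
  exact h.contMDiffAt hy

variable [VectorBundle ℝ F V]

lemma add (hσ : SmoothNear (n := n) F σ x) (hτ : SmoothNear (n := n) F τ x) :
    SmoothNear (n := n) F (fun y => σ y + τ y) x := by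
  filter_upwards [hσ, hτ] with y h1 h2 using h1.add_section h2

lemma sub (hσ : SmoothNear (n := n) F σ x) (hτ : SmoothNear (n := n) F τ x) :
    SmoothNear (n := n) F (fun y => σ y - τ y) x := by
  filter_upwards [hσ, hτ] with y h1 h2 using h1.sub_section h2

lemma neg (hσ : SmoothNear (n := n) F σ x) : SmoothNear (n := n) F (fun y => - σ y) x := by
  filter_upwards [hσ] with y h1 using h1.neg_section

lemma smul {f : M → ℝ} (hf : SmoothFunNear (n := n) f x) (hσ : SmoothNear (n := n) F σ x) :
    SmoothNear (n := n) F (fun y => f y • σ y) x := by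
  filter_upwards [hf, hσ] with y h1 h2 using h1.smul_section h2

lemma sum {ι : Type*} {s : Finset ι} {σ : ι → Π x, V x}
    (hσ : ∀ i ∈ s, SmoothNear (n := n) F (σ i) x) :
    SmoothNear (n := n) F (fun y => ∑ i ∈ s, σ i y) x := by
  have := (Filter.eventually_all_finset s).2 hσ
  filter_upwards [this] with y h1 using ContMDiffAt.sum_section h1

lemma zero : SmoothNear (n := n) F (fun y => (0 : V y)) x := by
  simpa using sum (n := n) (x := x) (F := F) (V := V) (s := (∅ : Finset ℕ)) (σ := fun _ _ => 0)
    (by simp)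

end SmoothNear

/-- A differentiable version of evaluation of a bundle homomorphism at a section. -/
lemma mdiff_clm_apply {F₁ F₂ : Type*} [NormedAddCommGroup F₁] [NormedSpace ℝ F₁]
    [NormedAddCommGroup F₂] [NormedSpace ℝ F₂] {V₁ V₂ : M → Type*}
    [TopologicalSpace (TotalSpace F₁ V₁)] [∀ x, TopologicalSpace (V₁ x)]
    [FiberBundle F₁ V₁] [∀ x, AddCommGroup (V₁ x)] [∀ x, Module ℝ (V₁ x)] [VectorBundle ℝ F₁ V₁]
    [TopologicalSpace (TotalSpace F₂ V₂)] [∀ x, TopologicalSpace (V₂ x)]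
    [FiberBundle F₂ V₂] [∀ x, AddCommGroup (V₂ x)] [∀ x, Module ℝ (V₂ x)] [VectorBundle ℝ F₂ V₂]
    [∀ x, IsTopologicalAddGroup (V₂ x)] [∀ x, ContinuousSMul ℝ (V₂ x)]
    {ϕ : Π x, V₁ x →L[ℝ] V₂ x} {σ : Π x, V₁ x} {x : M}
    (hϕ : MDifferentiableAt (𝓡 n) ((𝓡 n).prod 𝓘(ℝ, F₁ →L[ℝ] F₂))
      (fun y => TotalSpace.mk' (F₁ →L[ℝ] F₂) y (ϕ y)) x)
    (hσ : MDifferentiableAt (𝓡 n) ((𝓡 n).prod 𝓘(ℝ, F₁)) (fun y => TotalSpace.mk' F₁ y (σ y)) x) :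
    MDifferentiableAt (𝓡 n) ((𝓡 n).prod 𝓘(ℝ, F₂))
      (fun y => TotalSpace.mk' F₂ y (ϕ y (σ y))) x :=
  MDifferentiableAt.clm_bundle_apply (b := fun y : M => y) hϕ hσ

namespace SmoothNear

section Hom

variable {F₁ F₂ : Type*} [NormedAddCommGroup F₁] [NormedSpace ℝ F₁]
    [NormedAddCommGroup F₂] [NormedSpace ℝ F₂] {V₁ V₂ : M → Type*}
    [TopologicalSpace (TotalSpace F₁ V₁)] [∀ x, TopologicalSpace (V₁ x)]
    [FiberBundle F₁ V₁] [∀ x, AddCommGroup (V₁ x)] [∀ x, Module ℝ (V₁ x)] [VectorBundle ℝ F₁ V₁]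
    [TopologicalSpace (TotalSpace F₂ V₂)] [∀ x, TopologicalSpace (V₂ x)]
    [FiberBundle F₂ V₂] [∀ x, AddCommGroup (V₂ x)] [∀ x, Module ℝ (V₂ x)] [VectorBundle ℝ F₂ V₂]
    [∀ x, IsTopologicalAddGroup (V₂ x)] [∀ x, ContinuousSMul ℝ (V₂ x)]
    {ϕ : Π x, V₁ x →L[ℝ] V₂ x} {σ : Π x, V₁ x} {x : M}

lemma apply (hϕ : SmoothNear (n := n) (F₁ →L[ℝ] F₂) ϕ x) (hσ : SmoothNear (n := n) F₁ σ x) :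
    SmoothNear (n := n) F₂ (fun y => ϕ y (σ y)) x := by
  filter_upwards [hϕ, hσ] with y h1 h2
  exact ContMDiffAt.clm_bundle_apply (b := fun y : M => y) h1 h2

/-- In trivializations the extensions of a basis of the fiber are constant. The images of these
extensions are thus the columns of the matrix of `ϕ`, which is rebuilt from them as a finite sum of
rank-one maps. -/
lemma contMDiffAt_hom_of_apply [FiniteDimensional ℝ F₁] [ContMDiffVectorBundle ∞ F₁ V₁ (𝓡 n)]
    (h : ∀ v : V₁ x, ContMDiffAt (𝓡 n) ((𝓡 n).prod 𝓘(ℝ, F₂)) ∞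
      (fun y => TotalSpace.mk' F₂ y (ϕ y (FiberBundle.extend F₁ v y))) x) :
    ContMDiffAt (𝓡 n) ((𝓡 n).prod 𝓘(ℝ, F₁ →L[ℝ] F₂)) ∞
      (fun y => TotalSpace.mk' (F₁ →L[ℝ] F₂) y (ϕ y)) x := by
  rw [contMDiffAt_hom_bundle]
  refine ⟨contMDiffAt_id, ?_⟩
  let t := trivializationAt F₁ V₁ x
  have x_mem : x ∈ t.baseSet := FiberBundle.mem_baseSet_trivializationAt F₁ V₁ x
  let t₂ := trivializationAt F₂ V₂ x
  have x_mem₂ : x ∈ t₂.baseSet := FiberBundle.mem_baseSet_trivializationAt F₂ V₂ x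
  let b := Module.finBasis ℝ F₁
  let L : Fin (Module.finrank ℝ F₁) → F₂ →L[ℝ] (F₁ →L[ℝ] F₂) := fun i =>
    ContinuousLinearMap.smulRightL ℝ F₁ F₂ (LinearMap.toContinuousLinearMap (b.coord i))
  have key : ∀ i, ContMDiffAt (𝓡 n) 𝓘(ℝ, F₂) ∞
      (fun y => (t₂ ⟨y, ϕ y (FiberBundle.extend F₁ (t.symm x (b i)) y)⟩).2) x := fun i =>
    (contMDiffAt_section x).1 (h _)
  have hsum : ContMDiffAt (𝓡 n) 𝓘(ℝ, F₁ →L[ℝ] F₂) ∞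
      (fun y => ∑ i, L i ((t₂ ⟨y, ϕ y (FiberBundle.extend F₁ (t.symm x (b i)) y)⟩).2)) x :=
    contMDiffAt_finsetSum fun i _ => (L i).contMDiff.contMDiffAt.comp x (key i)
  refine hsum.congr_of_eventuallyEq ?_
  filter_upwards [t.open_baseSet.mem_nhds x_mem, t₂.open_baseSet.mem_nhds x_mem₂] with y hy hy₂
  refine ContinuousLinearMap.coe_injective (b.ext fun j => ?_)
  simp only [ContinuousLinearMap.coe_coe]
  rw [ContinuousLinearMap.inCoordinates_eq hy hy₂]
  -- On the `j`-th basis vector only the `j`-th rank-one map survives.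
  simp only [FunLike.coe_sum, Finset.sum_apply, L]
  rw [Finset.sum_eq_single j]
  · simp [t, t₂, FiberBundle.extend, x_mem]
  · intro i _ hij
    simp [hij.symm]
  · simp

/-- The test sections vary with the nearby point `y`, since the criterion at `y` uses sections
extended from `y`, and these are smooth only near `y`. -/
lemma of_apply [FiniteDimensional ℝ F₁] [ContMDiffVectorBundle ∞ F₁ V₁ (𝓡 n)]
    (h : ∀ᶠ y in 𝓝 x, ∀ σ : Π x, V₁ x, SmoothNear (n := n) F₁ σ y →
      SmoothNear (n := n) F₂ (fun z => ϕ z (σ z)) y) :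
    SmoothNear (n := n) (F₁ →L[ℝ] F₂) ϕ x := by
  filter_upwards [h] with y hy
  exact contMDiffAt_hom_of_apply fun v => (hy _ (.extend v)).contMDiffAt

end Hom
end SmoothNear

variable [IsManifold (𝓡 n) ∞ M]

/-- The vector field `X` is smooth on a neighborhood of `x`. -/
abbrev SmoothVecNear (X : VectorField n M) (x : M) : Prop :=
  SmoothNear (n := n) (EuclideanSpace ℝ (Fin n)) X x

/-- The one-form `η` is smooth on a neighborhood of `x`. -/
abbrev SmoothFormNear (η : OneForm n M) (x : M) : Prop :=
  SmoothNear (n := n) (EuclideanSpace ℝ (Fin n) →L[ℝ] ℝ) η x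

/-- The vector field `X` is differentiable at `x`. -/
abbrev DiffVecAt (X : VectorField n M) (x : M) : Prop :=
  MDifferentiableAt (𝓡 n) ((𝓡 n).prod 𝓘(ℝ, EuclideanSpace ℝ (Fin n)))
    (fun y => TotalSpace.mk' (EuclideanSpace ℝ (Fin n)) y (X y)) x

lemma SmoothVectorFieldOn.smoothVecNear {X : VectorField n M} {U : Set M} {x : M}
    (hX : SmoothVectorFieldOn X U) (hU : U ∈ 𝓝 x) : SmoothVecNear X x := by
  filter_upwards [eventually_mem_nhds_iff.2 hU] with y hy
  exact hX.contMDiffAt hy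

lemma SmoothVecNear.exists_isOpen {X : VectorField n M} {x : M} (hX : SmoothVecNear X x) :
    ∃ U : Set M, IsOpen U ∧ x ∈ U ∧ SmoothVectorFieldOn X U := by
  obtain ⟨U, h, hU, hx⟩ := eventually_nhds_iff.1 hX
  exact ⟨U, hU, hx, fun y hy => (h y hy).contMDiffWithinAt⟩

lemma SmoothOneForm.smoothFormNear {η : OneForm n M} (hη : SmoothOneForm η) (x : M) :
    SmoothFormNear η x :=
  Eventually.of_forall fun y => hη y

lemma smoothOneForm_of_near {η : OneForm n M} (hη : ∀ x, SmoothFormNear η x) :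
    SmoothOneForm η := fun x => (hη x).contMDiffAt

lemma SmoothTensor2.smoothNear {A : Tensor2 n M} (hA : SmoothTensor2 A) (x : M) :
    SmoothNear (n := n) (EuclideanSpace ℝ (Fin n) →L[ℝ] EuclideanSpace ℝ (Fin n) →L[ℝ] ℝ) A x :=
  Eventually.of_forall fun y => hA y

lemma smoothVecNear_extendVec {x : M} (v : TangentSpace (𝓡 n) x) :
    SmoothVecNear (extendVec v) x := SmoothNear.extend v

lemma diffVecAt_extendVec {x : M} (v : TangentSpace (𝓡 n) x) : DiffVecAt (extendVec v) x :=
  (smoothVecNear_extendVec v).mdiff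

@[simp] lemma extendVec_self {x : M} (v : TangentSpace (𝓡 n) x) : extendVec v x = v :=
  FiberBundle.extend_apply_self _ v

lemma SmoothFormNear.diffOneFormAt {η : OneForm n M} {x : M} (hη : SmoothFormNear η x) :
    DiffOneFormAt η x := hη.mdiff

omit [IsManifold (𝓡 n) ∞ M] in
lemma smoothFunNear_iff_trivial {f : M → ℝ} {x : M} :
    SmoothFunNear (n := n) f x ↔ SmoothNear (n := n) ℝ (V := Bundle.Trivial M ℝ) f x := by
  refine eventually_congr (Eventually.of_forall fun y => ?_)
  rw [contMDiffAt_section (F := ℝ) (E := Bundle.Trivial M ℝ)]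
  rfl

lemma SmoothNear.form_apply {η : OneForm n M} {X : VectorField n M} {x : M}
    (hη : SmoothFormNear η x) (hX : SmoothVecNear X x) :
    SmoothFunNear (n := n) (fun y => η y (X y)) x :=
  smoothFunNear_iff_trivial.2 (SmoothNear.apply (V₂ := Bundle.Trivial M ℝ) hη hX)

/-- The main way of proving smoothness of forms below: it reduces every tensor to real functions
obtained by inserting smooth fields. -/
lemma smoothFormNear_of_apply {η : OneForm n M} {x : M}
    (h : ∀ᶠ y in 𝓝 x, ∀ X : VectorField n M, SmoothVecNear X y →
      SmoothFunNear (n := n) (fun z => η z (X z)) y) : SmoothFormNear η x :=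
  SmoothNear.of_apply (V₂ := Bundle.Trivial M ℝ)
    (h.mono fun _ hy X hX => smoothFunNear_iff_trivial.1 (hy X hX))

lemma SmoothVecNear.mlieBracket {X Y : VectorField n M} {x : M} (hX : SmoothVecNear X x)
    (hY : SmoothVecNear Y x) : SmoothVecNear (VectorField.mlieBracket (𝓡 n) X Y) x := by
  have : IsManifold (𝓡 n) (minSmoothness ℝ 2) M := by
    rw [minSmoothness_of_isRCLikeNormedField]; infer_instance
  have : IsManifold (𝓡 n) (((⊤ : ℕ∞) : WithTop ℕ∞) + 1) M := ‹IsManifold (𝓡 n) ∞ M›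
  filter_upwards [hX, hY] with y h1 h2
  exact ContMDiffAt.mlieBracket_vectorField (n := ⊤) (m := ⊤) h1 h2
    (by rw [minSmoothness_of_isRCLikeNormedField]; rfl)

section differential

omit [IsManifold (𝓡 n) ∞ M]

variable {f g : M → ℝ} {x : M}

lemma differential_add (hf : MDifferentiableAt (𝓡 n) 𝓘(ℝ, ℝ) f x)
    (hg : MDifferentiableAt (𝓡 n) 𝓘(ℝ, ℝ) g x) :
    differential (n := n) (fun y => f y + g y) x = differential f x + differential g x :=
  mvfderiv_fun_add hf hg

lemma differential_mul (hf : MDifferentiableAt (𝓡 n) 𝓘(ℝ, ℝ) f x)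
    (hg : MDifferentiableAt (𝓡 n) 𝓘(ℝ, ℝ) g x) :
    differential (n := n) (fun y => f y * g y) x
      = f x • differential g x + g x • differential f x :=
  mvfderiv_fun_mul hf hg

lemma differential_neg : differential (n := n) (fun y => - f y) x = - differential f x :=
  mvfderiv_fun_neg

lemma differential_const (c : ℝ) : differential (n := n) (fun _ : M => c) x = 0 :=
  mvfderiv_const c

lemma differential_const_mul (c : ℝ) (hf : MDifferentiableAt (𝓡 n) 𝓘(ℝ, ℝ) f x) :
    differential (n := n) (fun y => c * f y) x = c • differential f x := by
  rw [differential_mul mdifferentiableAt_const hf, differential_const, smul_zero, add_zero]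

lemma mdifferentiableAt_sum {ι : Type*} {s : Finset ι} {f : ι → M → ℝ}
    (hf : ∀ i ∈ s, MDifferentiableAt (𝓡 n) 𝓘(ℝ, ℝ) (f i) x) :
    MDifferentiableAt (𝓡 n) 𝓘(ℝ, ℝ) (fun y => ∑ i ∈ s, f i y) x := by
  classical
  induction s using Finset.induction_on with
  | empty => simpa using mdifferentiableAt_const
  | insert a s ha ih =>
    simp only [Finset.sum_insert ha]
    exact (hf a (by simp)).add (ih fun i hi => hf i (by simp [hi]))

lemma differential_sum {ι : Type*} {s : Finset ι} {f : ι → M → ℝ}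
    (hf : ∀ i ∈ s, MDifferentiableAt (𝓡 n) 𝓘(ℝ, ℝ) (f i) x) :
    differential (n := n) (fun y => ∑ i ∈ s, f i y) x = ∑ i ∈ s, differential (f i) x := by
  classical
  induction s using Finset.induction_on with
  | empty => simpa using differential_const 0
  | insert a s ha ih =>
    have h2 : ∀ i ∈ s, MDifferentiableAt (𝓡 n) 𝓘(ℝ, ℝ) (f i) x := fun i hi => hf i (by simp [hi])
    simp only [Finset.sum_insert ha]
    rw [differential_add (hf a (by simp)) (mdifferentiableAt_sum h2), ih h2]

lemma differential_congr (h : ∀ᶠ y in 𝓝 x, f y = g y) :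
    differential (n := n) f x = differential g x := by
  have h1 : f x = g x := h.self_of_nhds
  unfold differential mvfderiv
  rw [Filter.EventuallyEq.mfderiv_eq h]
  rw [h1]

end differential

lemma SmoothFunNear.differential {f : M → ℝ} {x : M} (hf : SmoothFunNear (n := n) f x) :
    SmoothFormNear (n := n) (differential f) x := by
  filter_upwards [hf] with y hy
  rw [contMDiffAt_hom_bundle]
  refine ⟨contMDiffAt_id, ?_⟩
  have := ContMDiffAt.mfderiv_const (m := ∞) hy (by rfl)
  convert! this using 2
  ext v
  simp [inTangentCoordinates, ContinuousLinearMap.inCoordinates]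
  rfl

end Toolkit
end TransverseSR

/-! ### Tensor calculus of a smooth connection -/

namespace TransverseSR

section CovariantCalculus

variable {n : ℕ} {M : Type*} [TopologicalSpace M] [ChartedSpace (EuclideanSpace ℝ (Fin n)) M]
  [IsManifold (𝓡 n) ∞ M]

instance (x : M) : FiniteDimensional ℝ (TangentSpace (𝓡 n) x) :=
  inferInstanceAs (FiniteDimensional ℝ (EuclideanSpace ℝ (Fin n)))

instance (x : M) : T2Space (TangentSpace (𝓡 n) x) :=
  inferInstanceAs (T2Space (EuclideanSpace ℝ (Fin n)))

/-- The connection maps smooth vector fields to smooth tensor fields. -/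
def SmoothConnection (cov : Connection n M) : Prop :=
  ∀ U : Set M, IsOpen U →
    ContMDiffCovariantDerivativeOn (EuclideanSpace ℝ (Fin n)) ∞ cov.toFun U

variable (cov : Connection n M) {x : M}

lemma cov_add {Y W : VectorField n M} (hY : DiffVecAt Y x) (hW : DiffVecAt W x) :
    cov (fun y => Y y + W y) x = cov Y x + cov W x :=
  cov.isCovariantDerivativeOnUniv.add hY hW

lemma cov_smul {f : M → ℝ} {Y : VectorField n M} (hf : MDifferentiableAt (𝓡 n) 𝓘(ℝ, ℝ) f x)
    (hY : DiffVecAt Y x) (u : TangentSpace (𝓡 n) x) :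
    cov (fun y => f y • Y y) x u = f x • cov Y x u + differential f x u • Y x := by
  have h : (fun y => f y • Y y) = f • Y := rfl
  rw [h, cov.isCovariantDerivativeOnUniv.leibniz hY hf]
  rfl

lemma cov_sum {ι : Type*} {s : Finset ι} {Y : ι → VectorField n M}
    (hY : ∀ i ∈ s, DiffVecAt (Y i) x) :
    cov (fun y => ∑ i ∈ s, Y i y) x = ∑ i ∈ s, cov (Y i) x := by
  classical
  induction s using Finset.induction_on with
  | empty =>
    simp only [Finset.sum_empty]
    exact cov.isCovariantDerivativeOnUniv.zero
  | insert a s ha ih =>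
    have h2 : ∀ i ∈ s, DiffVecAt (Y i) x := fun i hi => hY i (by simp [hi])
    simp only [Finset.sum_insert ha]
    rw [cov_add cov (hY a (by simp)) (.sum_section h2), ih h2]

lemma DiffVecAt.congr {Y W : VectorField n M} (hW : DiffVecAt W x) (h : ∀ᶠ y in 𝓝 x, Y y = W y) :
    DiffVecAt Y x :=
  MDifferentiableAt.congr_of_eventuallyEq hW (h.mono fun y hy => by simp [hy])

lemma cov_congr {Y W : VectorField n M} (hW : DiffVecAt W x) (h : ∀ᶠ y in 𝓝 x, Y y = W y) :
    cov Y x = cov W x :=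
  cov.isCovariantDerivativeOnUniv.congr_of_eventuallyEq (hW.congr h) hW univ_mem h

variable {cov}

lemma SmoothConnection.smoothNear (hcov : SmoothConnection cov) {Y : VectorField n M}
    (hY : SmoothVecNear Y x) :
    SmoothNear (n := n) (EuclideanSpace ℝ (Fin n) →L[ℝ] EuclideanSpace ℝ (Fin n)) (cov Y) x := by
  obtain ⟨U, hU, hx, h⟩ := hY.exists_isOpen
  filter_upwards [hU.mem_nhds hx] with y hy
  exact ((hcov U hU).contMDiff (σ := Y) h).contMDiffAt (hU.mem_nhds hy)

lemma SmoothConnection.smoothVecNear (hcov : SmoothConnection cov) {X Y : VectorField n M}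
    (hX : SmoothVecNear X x) (hY : SmoothVecNear Y x) :
    SmoothVecNear (fun y => cov Y y (X y)) x :=
  (hcov.smoothNear hY).apply hX

/-! ### Covariant derivatives of one-forms -/

/-- Where `η` is not differentiable the default value 0 is linear as well, so linearity in the
direction is unconditional and `covFormTensor` is defined for every form. -/
lemma covForm_add_dir (η : OneForm n M) (u v : TangentSpace (𝓡 n) x) :
    covForm cov η x (u + v) = covForm cov η x u + covForm cov η x v := by
  by_cases hη : DiffOneFormAt η x
  · ext w
    have h := fun u => covForm_apply cov hη (diffVecAt_extendVec w) u
    simp only [extendVec_self] at h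
    simp only [add_apply, h, map_add]
    ring
  · simp [covForm, hη]

lemma covForm_smul_dir (η : OneForm n M) (c : ℝ) (u : TangentSpace (𝓡 n) x) :
    covForm cov η x (c • u) = c • covForm cov η x u := by
  by_cases hη : DiffOneFormAt η x
  · ext w
    have h := fun u => covForm_apply cov hη (diffVecAt_extendVec w) u
    simp only [extendVec_self] at h
    simp only [smul_apply, h, map_smul, smul_eq_mul]
    ring
  · simp [covForm, hη]

variable (cov) in
/-- The covariant derivative of a one-form, as a tensor. -/
def covFormTensor (η : OneForm n M) : Tensor2 n M := fun x =>
  LinearMap.toContinuousLinearMap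
    { toFun := covForm cov η x
      map_add' := covForm_add_dir η
      map_smul' := covForm_smul_dir η }

lemma covForm_eval {η : OneForm n M} (hη : DiffOneFormAt η x) {Y : VectorField n M}
    (hY : DiffVecAt Y x) (u : TangentSpace (𝓡 n) x) :
    covForm cov η x u (Y x) = differential (fun y => η y (Y y)) x u - η x (cov Y x u) :=
  covForm_apply cov hη hY u

lemma DiffOneFormAt.congr {η ξ : OneForm n M} (hη : DiffOneFormAt η x)
    (h : ∀ᶠ y in 𝓝 x, ξ y = η y) : DiffOneFormAt ξ x :=
  MDifferentiableAt.congr_of_eventuallyEq hη (h.mono fun y hy => by simp [hy])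

lemma DiffOneFormAt.add {η ξ : OneForm n M} (hη : DiffOneFormAt η x) (hξ : DiffOneFormAt ξ x) :
    DiffOneFormAt (fun y => η y + ξ y) x := mdifferentiableAt_add_section hη hξ

lemma covForm_congr {η ξ : OneForm n M} (hη : DiffOneFormAt η x) (h : ∀ᶠ y in 𝓝 x, ξ y = η y)
    (u : TangentSpace (𝓡 n) x) : covForm cov ξ x u = covForm cov η x u := by
  ext w
  have h1 := covForm_eval (cov := cov) hη (diffVecAt_extendVec w) u
  have h2 := covForm_eval (cov := cov) (hη.congr h) (diffVecAt_extendVec w) u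
  simp only [extendVec_self] at h1 h2
  rw [h1, h2, h.self_of_nhds, differential_congr (h.mono fun y hy => by rw [hy])]

lemma covForm_add {η ξ : OneForm n M} (hη : DiffOneFormAt η x) (hξ : DiffOneFormAt ξ x)
    (u : TangentSpace (𝓡 n) x) :
    covForm cov (fun y => η y + ξ y) x u = covForm cov η x u + covForm cov ξ x u := by
  ext w
  have h1 := covForm_eval (cov := cov) hη (diffVecAt_extendVec w) u
  have h2 := covForm_eval (cov := cov) hξ (diffVecAt_extendVec w) u
  have h3 := covForm_eval (cov := cov) (hη.add hξ) (diffVecAt_extendVec w) u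
  simp only [extendVec_self, add_apply] at h1 h2 h3 ⊢
  rw [h1, h2, h3, differential_add (hη.apply (diffVecAt_extendVec w))
    (hξ.apply (diffVecAt_extendVec w))]
  simp only [add_apply]
  ring

lemma covForm_smul {f : M → ℝ} {η : OneForm n M} (hf : MDifferentiableAt (𝓡 n) 𝓘(ℝ, ℝ) f x)
    (hη : DiffOneFormAt η x) (u : TangentSpace (𝓡 n) x) :
    covForm cov (fun y => f y • η y) x u = f x • covForm cov η x u + differential f x u • η x := by
  ext w
  have h1 := covForm_eval (cov := cov) hη (diffVecAt_extendVec w) u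
  have hfη : DiffOneFormAt (fun y => f y • η y) x := hf.smul_section hη
  have h3 := covForm_eval (cov := cov) hfη (diffVecAt_extendVec w) u
  simp only [extendVec_self, add_apply, smul_apply,
    smul_eq_mul] at h1 h3 ⊢
  rw [h1, h3, differential_mul hf (hη.apply (diffVecAt_extendVec w))]
  simp only [add_apply, smul_apply, smul_eq_mul,
    extendVec_self]
  ring

lemma covForm_sub {η ξ : OneForm n M} (hη : DiffOneFormAt η x) (hξ : DiffOneFormAt ξ x)
    (u : TangentSpace (𝓡 n) x) :
    covForm cov (fun y => η y - ξ y) x u = covForm cov η x u - covForm cov ξ x u := by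
  have hd : DiffOneFormAt (fun y => η y - ξ y) x := mdifferentiableAt_sub_section hη hξ
  have h := covForm_add (cov := cov) hd hξ u
  simp only [sub_add_cancel] at h
  rw [eq_sub_iff_add_eq, ← h]

/-- Tested on two smooth fields, the tensor is X(η(Y)) - η(∇_X Y), a smooth function. -/
lemma SmoothConnection.covFormTensor (hcov : SmoothConnection cov) {η : OneForm n M}
    (hη : SmoothFormNear η x) :
    SmoothNear (n := n) (EuclideanSpace ℝ (Fin n) →L[ℝ] EuclideanSpace ℝ (Fin n) →L[ℝ] ℝ)
      (covFormTensor cov η) x := by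
  refine SmoothNear.of_apply (V₂ := fun x : M => TangentSpace (𝓡 n) x →L[ℝ] ℝ) ?_
  filter_upwards [hη.eventually] with y hy X hX
  refine smoothFormNear_of_apply ?_
  filter_upwards [hX.eventually, hy.eventually] with z hz hηz Y hY
  have h1 : SmoothFunNear (n := n) (fun w => differential (fun y => η y (Y y)) w (X w)
      - η w (cov Y w (X w))) z :=
    ((hηz.form_apply hY).differential.form_apply hz).sub
      (hηz.form_apply (hcov.smoothVecNear hz hY))
  refine h1.congr ?_
  filter_upwards [hηz.eventually, hY.eventually] with w hw hYw
  exact covForm_eval (SmoothNear.mdiff hw) (SmoothNear.mdiff hYw) _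

lemma SmoothConnection.covFormAlong (hcov : SmoothConnection cov) {η : OneForm n M}
    (hη : SmoothFormNear η x) {X : VectorField n M} (hX : SmoothVecNear X x) :
    SmoothFormNear (covFormAlong cov X η) x :=
  (hcov.covFormTensor hη).apply (V₂ := fun x : M => TangentSpace (𝓡 n) x →L[ℝ] ℝ) hX

lemma SmoothConnection.diff_covFormAlong (hcov : SmoothConnection cov) {η : OneForm n M}
    (hη : SmoothFormNear η x) {X : VectorField n M} (hX : DiffVecAt X x) :
    DiffOneFormAt (TransverseSR.covFormAlong cov X η) x :=
  mdiff_clm_apply (V₂ := fun x : M => TangentSpace (𝓡 n) x →L[ℝ] ℝ)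
    (hcov.covFormTensor hη).mdiff hX

/-- For fV both ∇_u ∇_{fV} η and ∇_{∇_u (fV)} η produce the term u(f) ∇_V η, which cancels. Any
differentiable extension of the vector may then be used, in particular a field of an adapted frame
(`secondCovForm_eq`). -/
lemma secondCovForm_tensorial (hcov : SmoothConnection cov) {η : OneForm n M}
    (hη : SmoothFormNear η x) (u : TangentSpace (𝓡 n) x) :
    TensorialAt (𝓡 n) (EuclideanSpace ℝ (Fin n)) (fun V : VectorField n M =>
      covForm cov (covFormAlong cov V η) x u - covForm cov η x (cov V x u)) x where
  smul {f V} hf hV := by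
    have h1 : covFormAlong cov (f • V) η = fun y => f y • covFormAlong cov V η y := by
      funext y; exact covForm_smul_dir η _ _
    have h2 := cov_smul cov hf hV u
    change cov (f • V) x u = _ at h2
    simp only [h1, h2, covForm_smul hf (hcov.diff_covFormAlong hη hV), covForm_add_dir,
      covForm_smul_dir]
    simp only [covFormAlong]
    module
  add {V W} hV hW := by
    have h1 : covFormAlong cov (V + W) η
        = fun y => covFormAlong cov V η y + covFormAlong cov W η y := by
      funext y; exact covForm_add_dir η _ _
    have h2 := cov_add cov hV hW
    change cov (V + W) x = _ at h2
    simp only [h1, h2, covForm_add (hcov.diff_covFormAlong hη hV) (hcov.diff_covFormAlong hη hW),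
      covForm_add_dir, add_apply]
    module

lemma secondCovForm_eq (hcov : SmoothConnection cov) {η : OneForm n M}
    (hη : SmoothFormNear η x) (u : TangentSpace (𝓡 n) x) {V : VectorField n M}
    (hV : DiffVecAt V x) :
    secondCovForm cov η x u (V x)
      = covForm cov (covFormAlong cov V η) x u - covForm cov η x (cov V x u) :=
  (secondCovForm_tensorial hcov hη u).pointwise (diffVecAt_extendVec _) hV (by simp)

lemma secondCovForm_add_left (η : OneForm n M) (u u' v : TangentSpace (𝓡 n) x) :
    secondCovForm cov η x (u + u') v = secondCovForm cov η x u v + secondCovForm cov η x u' v := by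
  simp only [secondCovForm, map_add, covForm_add_dir]
  module

lemma secondCovForm_smul_left (η : OneForm n M) (c : ℝ) (u v : TangentSpace (𝓡 n) x) :
    secondCovForm cov η x (c • u) v = c • secondCovForm cov η x u v := by
  simp only [secondCovForm, map_smul, covForm_smul_dir]
  module

lemma secondCovForm_add_right (hcov : SmoothConnection cov) {η : OneForm n M}
    (hη : SmoothFormNear η x) (u v v' : TangentSpace (𝓡 n) x) :
    secondCovForm cov η x u (v + v') = secondCovForm cov η x u v + secondCovForm cov η x u v' := by
  have h := (secondCovForm_tensorial hcov hη u).add (diffVecAt_extendVec v)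
    (diffVecAt_extendVec v')
  have h2 := secondCovForm_eq hcov hη u (V := extendVec v + extendVec v')
    (mdifferentiableAt_add_section (diffVecAt_extendVec v) (diffVecAt_extendVec v'))
  simp only [Pi.add_apply, extendVec_self] at h2
  rw [h2]
  exact h

lemma secondCovForm_smul_right (hcov : SmoothConnection cov) {η : OneForm n M}
    (hη : SmoothFormNear η x) (c : ℝ) (u v : TangentSpace (𝓡 n) x) :
    secondCovForm cov η x u (c • v) = c • secondCovForm cov η x u v := by
  have h := (secondCovForm_tensorial hcov hη u).smul (f := fun _ => c) mdifferentiableAt_const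
    (diffVecAt_extendVec v)
  have h2 := secondCovForm_eq hcov hη u (V := (fun _ : M => c) • extendVec v)
    (mdifferentiableAt_const.smul_section (diffVecAt_extendVec v))
  have h3 : ((fun _ : M => c) • extendVec v) x = c • v := by
    change c • extendVec v x = _
    simp
  rw [h3] at h2
  rw [h2]
  exact h

/-- In the definition of dη the bracket is replaced by ∇_U V - ∇_V U - T(U, V). -/
lemma extDeriv_eq {η : OneForm n M} (hη : DiffOneFormAt η x) (u v : TangentSpace (𝓡 n) x) :
    extDeriv η x u v = covForm cov η x u v - covForm cov η x v u + η x (cov.torsion x u v) := by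
  have h1 := covForm_eval (cov := cov) hη (diffVecAt_extendVec v) u
  have h2 := covForm_eval (cov := cov) hη (diffVecAt_extendVec u) v
  have h3 := cov.torsion_apply (diffVecAt_extendVec u) (diffVecAt_extendVec v)
  simp only [extendVec_self] at h1 h2 h3
  rw [h1, h2, h3, extDeriv]
  simp only [map_sub]
  ring

/-! ### The torsion -/

lemma SmoothConnection.torsion_vec (hcov : SmoothConnection cov) {X Y : VectorField n M}
    (hX : SmoothVecNear X x) (hY : SmoothVecNear Y x) :
    SmoothVecNear (fun y => cov.torsion y (X y) (Y y)) x := by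
  have h : SmoothVecNear (fun y => cov Y y (X y) - cov X y (Y y)
      - VectorField.mlieBracket (𝓡 n) X Y y) x :=
    ((hcov.smoothVecNear hX hY).sub (hcov.smoothVecNear hY hX)).sub (hX.mlieBracket hY)
  refine h.congr ?_
  filter_upwards [hX.eventually, hY.eventually] with y h1 h2
  exact cov.torsion_apply h1.mdiff h2.mdiff

/-- As a smooth section of a bundle of homomorphisms, the torsion can be applied to fields that are
merely differentiable at a point, as tensoriality arguments require. -/
lemma SmoothConnection.torsion (hcov : SmoothConnection cov) :
    SmoothNear (n := n) (EuclideanSpace ℝ (Fin n) →L[ℝ] EuclideanSpace ℝ (Fin n) →L[ℝ]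
      EuclideanSpace ℝ (Fin n)) cov.torsion x := by
  refine SmoothNear.of_apply
    (V₂ := fun x : M => TangentSpace (𝓡 n) x →L[ℝ] TangentSpace (𝓡 n) x) ?_
  refine Eventually.of_forall fun y X hX => SmoothNear.of_apply ?_
  filter_upwards [hX.eventually] with z hz Y hY
  exact hcov.torsion_vec hz hY

lemma SmoothConnection.torsion_diff (hcov : SmoothConnection cov) {X Y : VectorField n M}
    (hX : DiffVecAt X x) (hY : DiffVecAt Y x) :
    DiffVecAt (fun y => cov.torsion y (X y) (Y y)) x :=
  mdiff_clm_apply (mdiff_clm_apply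
    (V₂ := fun x : M => TangentSpace (𝓡 n) x →L[ℝ] TangentSpace (𝓡 n) x)
    hcov.torsion.mdiff hX) hY

/-- The expression is tensorial in both slots: the derivative of a factor f in ∇_u(T(fV, W)) is
removed by T(∇_u(fV), W), and likewise for W. -/
lemma covTorsion_eq (hcov : SmoothConnection cov) (u : TangentSpace (𝓡 n) x)
    {V W : VectorField n M} (hV : DiffVecAt V x) (hW : DiffVecAt W x) :
    covTorsion cov x u (V x) (W x) = cov (fun y => cov.torsion y (V y) (W y)) x u
      - cov.torsion x (cov V x u) (W x) - cov.torsion x (V x) (cov W x u) := by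
  let Φ : VectorField n M → VectorField n M → TangentSpace (𝓡 n) x := fun V W =>
    cov (fun y => cov.torsion y (V y) (W y)) x u
      - cov.torsion x (cov V x u) (W x) - cov.torsion x (V x) (cov W x u)
  have h := TensorialAt.pointwise₂ (I := 𝓡 n) (F := EuclideanSpace ℝ (Fin n))
    (F' := EuclideanSpace ℝ (Fin n)) (Φ := Φ) (x := x) (fun W hW => ?_) (fun V hV => ?_)
    (diffVecAt_extendVec (V x)) hV (diffVecAt_extendVec (W x)) hW (by simp) (by simp)
  · simpa [Φ, covTorsion] using h
  · refine ⟨fun {f V} hf hV => ?_, fun {V V'} hV hV' => ?_⟩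
    · have e : (fun y => cov.torsion y ((f • V) y) (W y))
          = fun y => f y • cov.torsion y (V y) (W y) := by
        funext y; simp
      have h2 := cov_smul cov hf hV u
      change cov (f • V) x u = _ at h2
      simp only [Φ, e, cov_smul cov hf (hcov.torsion_diff hV hW) u, h2]
      simp
      module
    · have e : (fun y => cov.torsion y ((V + V') y) (W y))
          = fun y => cov.torsion y (V y) (W y) + cov.torsion y (V' y) (W y) := by
        funext y; simp
      have h2 := cov_add cov hV hV'
      change cov (V + V') x = _ at h2
      simp only [Φ, e, cov_add cov (hcov.torsion_diff hV hW) (hcov.torsion_diff hV' hW), h2]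
      simp
      module
  · refine ⟨fun {f W} hf hW => ?_, fun {W W'} hW hW' => ?_⟩
    · have e : (fun y => cov.torsion y (V y) ((f • W) y))
          = fun y => f y • cov.torsion y (V y) (W y) := by
        funext y; simp
      have h2 := cov_smul cov hf hW u
      change cov (f • W) x u = _ at h2
      simp only [Φ, e, cov_smul cov hf (hcov.torsion_diff hV hW) u, h2]
      simp
      module
    · have e : (fun y => cov.torsion y (V y) ((W + W') y))
          = fun y => cov.torsion y (V y) (W y) + cov.torsion y (V y) (W' y) := by
        funext y; simp
      have h2 := cov_add cov hW hW'
      change cov (W + W') x = _ at h2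
      simp only [Φ, e, cov_add cov (hcov.torsion_diff hV hW) (hcov.torsion_diff hV hW'), h2]
      simp
      module

end CovariantCalculus
end TransverseSR

/-! ### Pointwise linear algebra of the splitting -/

namespace TransverseSR
namespace TransverseStructure

variable {d h : ℕ} {M : Type*} [TopologicalSpace M]
  [ChartedSpace (EuclideanSpace ℝ (Fin (d + h))) M] [IsManifold (𝓡 (d + h)) ∞ M]
  (S : TransverseStructure d h M) {x : M}

lemma mem_verSpace {u : TangentSpace (𝓡 (d + h)) x} :
    u ∈ S.verSpace x ↔ ∃ Z : S.vert, Z.1 x = u := by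
  rw [← S.range_evalVert]
  exact Iff.rfl

lemma vert_mem_verSpace (Z : S.vert) : Z.1 x ∈ S.verSpace x := S.mem_verSpace.2 ⟨Z, rfl⟩

lemma gH_ver_left {u : TangentSpace (𝓡 (d + h)) x} (hu : u ∈ S.verSpace x)
    (v : TangentSpace (𝓡 (d + h)) x) : S.gH x u v = 0 := by
  obtain ⟨Z, rfl⟩ := S.mem_verSpace.1 hu
  exact S.gH_vert Z.1 Z.2 x v

lemma gH_ver_right {u : TangentSpace (𝓡 (d + h)) x} (hu : u ∈ S.verSpace x)
    (v : TangentSpace (𝓡 (d + h)) x) : S.gH x v u = 0 := by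
  rw [S.gH_symm, S.gH_ver_left hu]

lemma exists_hor_add_ver (u : TangentSpace (𝓡 (d + h)) x) :
    ∃ v ∈ S.hor x, ∃ Z : S.vert, u = v + Z.1 x := by
  have h1 : u ∈ S.hor x ⊔ S.verSpace x := (S.isCompl x).sup_eq_top ▸ Submodule.mem_top
  obtain ⟨v, hv, z, hz, rfl⟩ := Submodule.mem_sup.1 h1
  obtain ⟨Z, rfl⟩ := S.mem_verSpace.1 hz
  exact ⟨v, hv, Z, rfl⟩

lemma isHorOrthonormal_horBasis (x : M) : S.IsHorOrthonormal x (S.horBasis x) :=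
  (S.exists_horBasis x).choose_spec

lemma isVertOrthonormal_vertBasis : S.IsVertOrthonormal S.vertBasis :=
  S.exists_vertBasis.choose_spec

variable {S}

/-- Pairing with `e j` recovers the `j`-th coefficient of a combination. This gives independence,
hence spanning because `hor x` has dimension `d`, and identifies the coefficients. -/
lemma IsHorOrthonormal.sum_eq {e : Fin d → TangentSpace (𝓡 (d + h)) x}
    (he : S.IsHorOrthonormal x e) {u : TangentSpace (𝓡 (d + h)) x} (hu : u ∈ S.hor x) :
    ∑ i, S.gH x (e i) u • e i = u := by
  have hpair : ∀ (c : Fin d → ℝ) j, S.gH x (e j) (∑ i, c i • e i) = c j := by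
    intro c j
    simp [map_sum, he.2]
  have hli : LinearIndependent ℝ (fun i => (⟨e i, he.1 i⟩ : S.hor x)) := by
    rw [Fintype.linearIndependent_iff]
    intro c hc j
    have h1 : ∑ i, c i • e i = 0 := by
      have := congrArg (fun z : S.hor x => (z : TangentSpace (𝓡 (d + h)) x)) hc
      simpa using this
    rw [← hpair c j, h1, map_zero]
  have hspan := hli.span_eq_top_of_card_eq_finrank' (by simp [S.finrank_hor x])
  have hmem : (⟨u, hu⟩ : S.hor x) ∈ Submodule.span ℝ (Set.range fun i => (⟨e i, he.1 i⟩ : S.hor x)) :=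
    hspan ▸ Submodule.mem_top
  obtain ⟨c, hc⟩ := (Submodule.mem_span_range_iff_exists_fun ℝ).1 hmem
  have h1 : u = ∑ i, c i • e i := by
    have := congrArg (fun z : S.hor x => (z : TangentSpace (𝓡 (d + h)) x)) hc
    simpa using this.symm
  rw [h1]
  simp only [hpair]

lemma IsVertOrthonormal.sum_eq {Z : Fin h → S.vert} (hZ : S.IsVertOrthonormal Z) (W : S.vert) :
    ∑ m, S.gV (Z m) W • Z m = W := by
  have := S.finiteDimensional_vert
  have hpair : ∀ (c : Fin h → ℝ) j, S.gV (Z j) (∑ i, c i • Z i) = c j := by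
    intro c j
    have hj := hZ j
    simp [map_sum, hj]
  have hli : LinearIndependent ℝ Z := by
    rw [Fintype.linearIndependent_iff]
    intro c hc j
    rw [← hpair c j, hc, map_zero]
  have hspan := hli.span_eq_top_of_card_eq_finrank' (by simp [S.finrank_vert])
  have hmem : W ∈ Submodule.span ℝ (Set.range Z) := hspan ▸ Submodule.mem_top
  obtain ⟨c, rfl⟩ := (Submodule.mem_span_range_iff_exists_fun ℝ).1 hmem
  simp only [hpair]

variable (S)

/-- The horizontal projection as a continuous linear map. -/
def horProjL (x : M) : TangentSpace (𝓡 (d + h)) x →L[ℝ] TangentSpace (𝓡 (d + h)) x :=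
  ∑ i, (S.gH x (S.horBasis x i)).smulRight (S.horBasis x i)

@[simp] lemma horProjL_apply (u : TangentSpace (𝓡 (d + h)) x) :
    S.horProjL x u = S.horProj x u := by
  simp [horProjL, horProj]

lemma horProj_add (u v : TangentSpace (𝓡 (d + h)) x) :
    S.horProj x (u + v) = S.horProj x u + S.horProj x v := by
  simp only [← horProjL_apply, map_add]

lemma horProj_smul (c : ℝ) (u : TangentSpace (𝓡 (d + h)) x) :
    S.horProj x (c • u) = c • S.horProj x u := by
  simp only [← horProjL_apply, map_smul]

lemma horProj_mem (u : TangentSpace (𝓡 (d + h)) x) : S.horProj x u ∈ S.hor x :=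
  Submodule.sum_mem _ fun i _ => Submodule.smul_mem _ _ ((S.isHorOrthonormal_horBasis x).1 i)

lemma horProj_of_mem {u : TangentSpace (𝓡 (d + h)) x} (hu : u ∈ S.hor x) : S.horProj x u = u :=
  (S.isHorOrthonormal_horBasis x).sum_eq hu

lemma horProj_of_ver {u : TangentSpace (𝓡 (d + h)) x} (hu : u ∈ S.verSpace x) :
    S.horProj x u = 0 := by
  simp [horProj, S.gH_ver_right hu]

@[simp] lemma horProj_vert (Z : S.vert) : S.horProj x (Z.1 x) = 0 :=
  S.horProj_of_ver (S.vert_mem_verSpace Z)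

@[simp] lemma horProj_horProj (u : TangentSpace (𝓡 (d + h)) x) :
    S.horProj x (S.horProj x u) = S.horProj x u := S.horProj_of_mem (S.horProj_mem u)

@[simp] lemma vertLift_horProj (u : TangentSpace (𝓡 (d + h)) x) :
    S.vertLift x (S.horProj x u) = 0 := S.vertLift_hor x (S.horProj_mem u)

lemma horProj_add_vertLift (u : TangentSpace (𝓡 (d + h)) x) :
    S.horProj x u + (S.vertLift x u).1 x = u := by
  obtain ⟨v, hv, Z, rfl⟩ := S.exists_hor_add_ver u
  rw [S.horProj_add, S.horProj_of_mem hv, S.horProj_vert, map_add, S.vertLift_hor x hv,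
    S.vertLift_vert]
  simp

lemma vertLift_ver {u : TangentSpace (𝓡 (d + h)) x} (hu : u ∈ S.verSpace x) :
    (S.vertLift x u).1 x = u := by
  obtain ⟨Z, rfl⟩ := S.mem_verSpace.1 hu
  rw [S.vertLift_vert]

@[simp] lemma gH_horProj_left (u v : TangentSpace (𝓡 (d + h)) x) :
    S.gH x (S.horProj x u) v = S.gH x u v := by
  conv_rhs => rw [← S.horProj_add_vertLift u]
  rw [map_add, add_apply, S.gH_ver_left (S.vert_mem_verSpace _), add_zero]

@[simp] lemma gH_horProj_right (u v : TangentSpace (𝓡 (d + h)) x) :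
    S.gH x u (S.horProj x v) = S.gH x u v := by
  rw [S.gH_symm, gH_horProj_left, S.gH_symm]

variable {S} in
lemma IsHorOrthonormal.horProj_eq {e : Fin d → TangentSpace (𝓡 (d + h)) x}
    (he : S.IsHorOrthonormal x e) (u : TangentSpace (𝓡 (d + h)) x) :
    S.horProj x u = ∑ i, S.gH x (e i) u • e i := by
  rw [← he.sum_eq (S.horProj_mem u)]
  simp

lemma hor_ext {u v : TangentSpace (𝓡 (d + h)) x} (hu : u ∈ S.hor x) (hv : v ∈ S.hor x)
    (huv : ∀ w ∈ S.hor x, S.gH x u w = S.gH x v w) : u = v := by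
  by_contra hne
  have h1 := S.gH_pos x (u - v) (Submodule.sub_mem _ hu hv) (sub_ne_zero.2 hne)
  have h2 := huv (u - v) (Submodule.sub_mem _ hu hv)
  have h3 : S.gH x (u - v) (u - v) = S.gH x u (u - v) - S.gH x v (u - v) := by
    rw [map_sub (S.gH x)]; rfl
  rw [h3, h2, sub_self] at h1
  exact lt_irrefl _ h1

/-- The kernel of `gH` is exactly the vertical space; this is how the torsion is shown to be
vertical. -/
lemma mem_verSpace_of_gH_eq_zero {u : TangentSpace (𝓡 (d + h)) x}
    (hu : ∀ w ∈ S.hor x, S.gH x u w = 0) : u ∈ S.verSpace x := by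
  have h1 : S.horProj x u = 0 :=
    S.hor_ext (S.horProj_mem u) (Submodule.zero_mem _) fun w hw => by simp [hu w hw]
  rw [← S.horProj_add_vertLift u, h1, zero_add]
  exact S.vert_mem_verSpace _

variable {S} in
/-- The trace of a bilinear map over a horizontal orthonormal basis does not depend on the basis. -/
lemma IsHorOrthonormal.sum_bilin_eq {N : Type*} [AddCommGroup N] [Module ℝ N]
    {e e' : Fin d → TangentSpace (𝓡 (d + h)) x} (he : S.IsHorOrthonormal x e)
    (he' : S.IsHorOrthonormal x e')
    (B : TangentSpace (𝓡 (d + h)) x →ₗ[ℝ] TangentSpace (𝓡 (d + h)) x →ₗ[ℝ] N) :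
    ∑ i, B (e i) (e i) = ∑ i, B (e' i) (e' i) := by
  have h1 : ∀ i, B (e i) (e i) = ∑ j, S.gH x (e' j) (e i) • B (e' j) (e i) := fun i => by
    refine (congrArg (fun z => B z (e i)) (he'.sum_eq (he.1 i))).symm.trans ?_
    simp only [map_sum, map_smul, LinearMap.sum_apply, LinearMap.smul_apply]
  have h2 : ∀ j, B (e' j) (e' j) = ∑ i, S.gH x (e i) (e' j) • B (e' j) (e i) := fun j => by
    refine (congrArg (fun z => B (e' j) z) (he.sum_eq (he'.1 j))).symm.trans ?_
    simp only [map_sum, map_smul]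
  simp only [h1, h2]
  rw [Finset.sum_comm]
  simp only [S.gH_symm x (e' _)]

variable {S} in
lemma IsVertOrthonormal.sum_bilin_eq {N : Type*} [AddCommGroup N] [Module ℝ N]
    {Z Z' : Fin h → S.vert} (hZ : S.IsVertOrthonormal Z) (hZ' : S.IsVertOrthonormal Z')
    (B : S.vert →ₗ[ℝ] S.vert →ₗ[ℝ] N) : ∑ i, B (Z i) (Z i) = ∑ i, B (Z' i) (Z' i) := by
  have h1 : ∀ i, B (Z i) (Z i) = ∑ j, S.gV (Z' j) (Z i) • B (Z' j) (Z i) := fun i => by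
    refine (congrArg (fun z => B z (Z i)) (hZ'.sum_eq (Z i))).symm.trans ?_
    simp only [map_sum, map_smul, LinearMap.sum_apply, LinearMap.smul_apply]
  have h2 : ∀ j, B (Z' j) (Z' j) = ∑ i, S.gV (Z i) (Z' j) • B (Z' j) (Z i) := fun j => by
    refine (congrArg (fun z => B (Z' j) z) (hZ.sum_eq (Z' j))).symm.trans ?_
    simp only [map_sum, map_smul]
  simp only [h1, h2]
  rw [Finset.sum_comm]
  simp only [S.gV_symm (Z' _)]

/-- The one-form `gV(Z, ·)`. -/
def nu (Z : S.vert) : OneForm (d + h) M := fun x =>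
  LinearMap.toContinuousLinearMap ((S.gV Z).comp (S.vertLift x))

lemma nu_apply (Z : S.vert) (u : TangentSpace (𝓡 (d + h)) x) :
    S.nu Z x u = S.gV Z (S.vertLift x u) := rfl

lemma nu_hor (Z : S.vert) {u : TangentSpace (𝓡 (d + h)) x} (hu : u ∈ S.hor x) :
    S.nu Z x u = 0 := by
  rw [nu_apply, S.vertLift_hor x hu, map_zero]

@[simp] lemma nu_horProj (Z : S.vert) (u : TangentSpace (𝓡 (d + h)) x) :
    S.nu Z x (S.horProj x u) = 0 := S.nu_hor Z (S.horProj_mem u)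

@[simp] lemma nu_vert (Z W : S.vert) : S.nu Z x (W.1 x) = S.gV Z W := by
  rw [nu_apply, S.vertLift_vert]

lemma flatVer_vert (Z : S.vert) : S.flatVer x (Z.1 x) = S.nu Z x := by
  unfold flatVer nu
  rw [S.vertLift_vert]

variable {S} in
lemma IsVertOrthonormal.sum_nu {Z : Fin h → S.vert} (hZ : S.IsVertOrthonormal Z)
    (u : TangentSpace (𝓡 (d + h)) x) : ∑ m, S.nu (Z m) x u • Z m = S.vertLift x u := hZ.sum_eq _

variable {S} in
lemma IsVertOrthonormal.sum_nu_eval {Z : Fin h → S.vert} (hZ : S.IsVertOrthonormal Z)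
    (u : TangentSpace (𝓡 (d + h)) x) :
    ∑ m, S.nu (Z m) x u • (Z m).1 x = (S.vertLift x u).1 x := by
  have h1 := congrArg (fun W : S.vert => S.evalVert x W) (hZ.sum_nu u)
  simp only [map_sum, map_smul] at h1
  exact h1

variable {S} in
lemma decomp {e : Fin d → TangentSpace (𝓡 (d + h)) x} (he : S.IsHorOrthonormal x e)
    {Z : Fin h → S.vert} (hZ : S.IsVertOrthonormal Z) (u : TangentSpace (𝓡 (d + h)) x) :
    u = ∑ i, S.gH x (e i) u • e i + ∑ m, S.nu (Z m) x u • (Z m).1 x := by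
  rw [← he.horProj_eq, hZ.sum_nu_eval, S.horProj_add_vertLift]

/-! ### The inner products on one-forms -/

variable {S} in
lemma IsHorOrthonormal.coHor_eq {e : Fin d → TangentSpace (𝓡 (d + h)) x}
    (he : S.IsHorOrthonormal x e) (α β : TangentSpace (𝓡 (d + h)) x →L[ℝ] ℝ) :
    S.coHor x α β = ∑ i, α (e i) * β (e i) :=
  (S.isHorOrthonormal_horBasis x).sum_bilin_eq he
    (LinearMap.mk₂ ℝ (fun u v => α u * β v) (by intros; simp; ring) (by intros; simp; ring)
      (by intros; simp; ring) (by intros; simp; ring))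

variable {S} in
lemma IsVertOrthonormal.sum_mul_eq {Z Z' : Fin h → S.vert} (hZ : S.IsVertOrthonormal Z)
    (hZ' : S.IsVertOrthonormal Z') (α β : TangentSpace (𝓡 (d + h)) x →L[ℝ] ℝ) :
    ∑ m, α ((Z m).1 x) * β ((Z m).1 x) = ∑ m, α ((Z' m).1 x) * β ((Z' m).1 x) :=
  hZ.sum_bilin_eq hZ'
    (LinearMap.mk₂ ℝ (fun u v : S.vert => α (u.1 x) * β (v.1 x)) (by intros; simp; ring)
      (by intros; simp; ring) (by intros; simp; ring) (by intros; simp; ring))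

variable {S} in
lemma IsHorOrthonormal.cometric_eq {e : Fin d → TangentSpace (𝓡 (d + h)) x}
    (he : S.IsHorOrthonormal x e) {Z : Fin h → S.vert} (hZ : S.IsVertOrthonormal Z) (ε : ℝ)
    (α β : TangentSpace (𝓡 (d + h)) x →L[ℝ] ℝ) :
    S.cometric ε x α β
      = ∑ i, α (e i) * β (e i) + ε * ∑ m, α ((Z m).1 x) * β ((Z m).1 x) := by
  rw [cometric, he.coHor_eq, S.isVertOrthonormal_vertBasis.sum_mul_eq hZ]

lemma cometric_symm (ε : ℝ) (α β : TangentSpace (𝓡 (d + h)) x →L[ℝ] ℝ) :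
    S.cometric ε x α β = S.cometric ε x β α := by
  simp only [cometric, coHor, mul_comm]

lemma cometric_add_left (ε : ℝ) (α α' β : TangentSpace (𝓡 (d + h)) x →L[ℝ] ℝ) :
    S.cometric ε x (α + α') β = S.cometric ε x α β + S.cometric ε x α' β := by
  simp only [cometric, coHor, add_apply, add_mul, Finset.sum_add_distrib]
  ring

lemma cometric_smul_left (ε c : ℝ) (α β : TangentSpace (𝓡 (d + h)) x →L[ℝ] ℝ) :
    S.cometric ε x (c • α) β = c * S.cometric ε x α β := by
  simp only [cometric, coHor, smul_apply, smul_eq_mul, mul_assoc, ← Finset.mul_sum]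
  ring

/-- The inner product of one-forms as a bilinear map. -/
def cometricL (ε : ℝ) (x : M) : (TangentSpace (𝓡 (d + h)) x →L[ℝ] ℝ) →ₗ[ℝ]
    (TangentSpace (𝓡 (d + h)) x →L[ℝ] ℝ) →ₗ[ℝ] ℝ :=
  LinearMap.mk₂ ℝ (S.cometric ε x) (S.cometric_add_left ε) (S.cometric_smul_left ε)
    (fun α β β' => by
      rw [S.cometric_symm, S.cometric_add_left, S.cometric_symm ε β, S.cometric_symm ε β'])
    (fun c α β => by
      rw [S.cometric_symm, S.cometric_smul_left, S.cometric_symm ε β]; rfl)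

lemma cometricL_apply (ε : ℝ) (α β : TangentSpace (𝓡 (d + h)) x →L[ℝ] ℝ) :
    S.cometricL ε x α β = S.cometric ε x α β := rfl

/-! ### The maps `J` and `𝔗` -/

variable (cov : Connection (d + h) M)

lemma JVec_mem (Z : S.vert) (u : TangentSpace (𝓡 (d + h)) x) : S.JVec cov Z x u ∈ S.hor x :=
  Submodule.sum_mem _ fun i _ => Submodule.smul_mem _ _ ((S.isHorOrthonormal_horBasis x).1 i)

/-- Both sides ignore vertical components, so no property of the connection is needed; the
projections disappear in `gH_JVec_hor` for the canonical connection. -/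
lemma gH_JVec (Z : S.vert) (u w : TangentSpace (𝓡 (d + h)) x) :
    S.gH x (S.JVec cov Z x u) w = S.nu Z x (cov.torsion x (S.horProj x u) (S.horProj x w)) := by
  have h1 : S.horProj x w = ∑ i, S.gH x (S.horBasis x i) w • S.horBasis x i := rfl
  rw [h1]
  simp only [JVec, map_sum, map_smul, smul_eq_mul, FunLike.coe_sum, Finset.sum_apply, smul_apply,
    nu_apply]
  exact Finset.sum_congr rfl fun i _ => mul_comm _ _

variable {S} in
lemma IsHorOrthonormal.JVec_eq {e : Fin d → TangentSpace (𝓡 (d + h)) x}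
    (he : S.IsHorOrthonormal x e) (Z : S.vert) {u : TangentSpace (𝓡 (d + h)) x}
    (hu : u ∈ S.hor x) :
    S.JVec cov Z x u = ∑ i, S.nu Z x (cov.torsion x u (e i)) • e i := by
  rw [← he.sum_eq (S.JVec_mem cov Z u)]
  refine Finset.sum_congr rfl fun i _ => ?_
  rw [S.gH_symm, S.gH_JVec, S.horProj_of_mem hu, S.horProj_of_mem (he.1 i)]

lemma JVec_add (Z : S.vert) (u v : TangentSpace (𝓡 (d + h)) x) :
    S.JVec cov Z x (u + v) = S.JVec cov Z x u + S.JVec cov Z x v := by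
  simp only [JVec, S.horProj_add, map_add, add_apply, add_smul, Finset.sum_add_distrib]

lemma JVec_smul (Z : S.vert) (c : ℝ) (u : TangentSpace (𝓡 (d + h)) x) :
    S.JVec cov Z x (c • u) = c • S.JVec cov Z x u := by
  simp only [JVec, S.horProj_smul, map_smul, smul_apply, smul_assoc, Finset.smul_sum]

lemma JVec_add_vert (Z W : S.vert) (u : TangentSpace (𝓡 (d + h)) x) :
    S.JVec cov (Z + W) x u = S.JVec cov Z x u + S.JVec cov W x u := by
  simp only [JVec, map_add, LinearMap.add_apply, add_smul, Finset.sum_add_distrib]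

lemma JVec_smul_vert (c : ℝ) (Z : S.vert) (u : TangentSpace (𝓡 (d + h)) x) :
    S.JVec cov (c • Z) x u = c • S.JVec cov Z x u := by
  simp only [JVec, map_smul, LinearMap.smul_apply, smul_assoc, Finset.smul_sum]

/-- `J` as a bilinear map. -/
def JVecL (x : M) : S.vert →ₗ[ℝ] TangentSpace (𝓡 (d + h)) x →ₗ[ℝ] TangentSpace (𝓡 (d + h)) x :=
  LinearMap.mk₂ ℝ (fun Z u => S.JVec cov Z x u) (S.JVec_add_vert cov) (S.JVec_smul_vert cov)
    (S.JVec_add cov) (fun c Z u => S.JVec_smul cov Z c u)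

lemma JVecL_apply (Z : S.vert) (u : TangentSpace (𝓡 (d + h)) x) :
    S.JVecL cov x Z u = S.JVec cov Z x u := rfl

@[simp] lemma JVec_horProj (Z : S.vert) (u : TangentSpace (𝓡 (d + h)) x) :
    S.JVec cov Z x (S.horProj x u) = S.JVec cov Z x u := by
  simp only [JVec, S.horProj_horProj]

lemma JVec_vert (Z W : S.vert) : S.JVec cov Z x (W.1 x) = 0 := by
  rw [← JVec_horProj, S.horProj_vert, ← JVecL_apply, map_zero]

lemma gH_JVec_skew (Z : S.vert) (u w : TangentSpace (𝓡 (d + h)) x) :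
    S.gH x (S.JVec cov Z x u) w = - S.gH x u (S.JVec cov Z x w) := by
  rw [S.gH_symm x u, S.gH_JVec, S.gH_JVec, cov.torsion_antisymm, map_neg]

/-- The sign comes from skewness: gH(J_Z X_i, w) = -gH(X_i, J_Z w). Together with `JFormAdj_apply`,
where the sign is opposite, it gives J*J α = -∑ α ∘ J_Z². -/
lemma JForm_apply (Z : S.vert) (α : TangentSpace (𝓡 (d + h)) x →L[ℝ] ℝ)
    (w : TangentSpace (𝓡 (d + h)) x) : S.JForm cov Z x α w = - α (S.JVec cov Z x w) := by
  conv_rhs => rw [← (S.isHorOrthonormal_horBasis x).sum_eq (S.JVec_mem cov Z w)]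
  simp only [JForm, flatHor, FunLike.coe_sum, Finset.sum_apply, smul_apply, smul_eq_mul,
    S.gH_JVec_skew, map_sum, map_smul, ← Finset.sum_neg_distrib]
  exact Finset.sum_congr rfl fun i _ => by ring

lemma JFormAdj_apply (Z : S.vert) (α : TangentSpace (𝓡 (d + h)) x →L[ℝ] ℝ)
    (w : TangentSpace (𝓡 (d + h)) x) : S.JFormAdj cov Z x α w = α (S.JVec cov Z x w) := by
  have h1 : S.JVec cov Z x w
      = ∑ i, S.gH x (S.horBasis x i) w • S.JVec cov Z x (S.horBasis x i) := by
    rw [← JVec_horProj, horProj]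
    simp only [← JVecL_apply, map_sum, map_smul]
  have h2 : ∀ i, S.coHor x α (S.JForm cov Z x (S.flatHor x (S.horBasis x i)))
      = α (S.JVec cov Z x (S.horBasis x i)) := fun i => by
    conv_rhs => rw [← (S.isHorOrthonormal_horBasis x).sum_eq (S.JVec_mem cov Z (S.horBasis x i))]
    simp only [coHor, S.JForm_apply, flatHor, map_sum, map_smul, smul_eq_mul]
    refine Finset.sum_congr rfl fun j _ => ?_
    rw [← S.gH_JVec_skew, S.gH_symm x (S.horBasis x j)]
    ring
  rw [h1]
  simp only [JFormAdj, FunLike.coe_sum, Finset.sum_apply, smul_apply, smul_eq_mul, h2, map_sum,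
    map_smul]
  simp only [flatHor]
  exact Finset.sum_congr rfl fun i _ => by ring

lemma sumJStarJ_apply (Z : Fin h → S.vert) (α : TangentSpace (𝓡 (d + h)) x →L[ℝ] ℝ)
    (w : TangentSpace (𝓡 (d + h)) x) :
    S.sumJStarJ cov Z x α w = - ∑ m, α (S.JVec cov (Z m) x (S.JVec cov (Z m) x w)) := by
  simp only [sumJStarJ, FunLike.coe_sum, Finset.sum_apply, S.JFormAdj_apply, S.JForm_apply,
    Finset.sum_neg_distrib]

/-- Frame-free form: summing over the ν_m collapses to a single J indexed by the vertical part of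
`w`, because J is linear in Z. -/
lemma frakT_apply (ε : ℝ) (v : TangentSpace (𝓡 (d + h)) x)
    (α : TangentSpace (𝓡 (d + h)) x →L[ℝ] ℝ) (w : TangentSpace (𝓡 (d + h)) x) :
    S.frakT cov ε x v α w = - α (cov.torsion x v (S.horProj x w))
      + 1 / (2 * ε) * α (S.JVec cov (S.vertLift x w) x v) := by
  have h1 : S.horProj x w = ∑ i, S.gH x (S.horBasis x i) w • S.horBasis x i := rfl
  have h2 := S.isVertOrthonormal_vertBasis.sum_nu w
  rw [h1, ← h2, ← JVecL_apply]
  simp only [frakT, flatHor, FunLike.coe_sum, Finset.sum_apply, smul_apply, smul_eq_mul, add_apply,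
    neg_apply, map_sum, map_smul, S.flatVer_vert, LinearMap.sum_apply, LinearMap.smul_apply,
    JVecL_apply]
  congr 2
  · exact Finset.sum_congr rfl fun i _ => mul_comm _ _
  · exact Finset.sum_congr rfl fun i _ => mul_comm _ _

/-- `𝔗` as a bilinear map. -/
def frakTL (ε : ℝ) (x : M) : TangentSpace (𝓡 (d + h)) x →ₗ[ℝ]
    (TangentSpace (𝓡 (d + h)) x →L[ℝ] ℝ) →ₗ[ℝ] (TangentSpace (𝓡 (d + h)) x →L[ℝ] ℝ) :=
  LinearMap.mk₂ ℝ (S.frakT cov ε x)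
    (fun u v α => by
      ext w; simp only [frakT_apply, map_add, add_apply, S.JVec_add]; ring)
    (fun c u α => by
      ext w; simp only [frakT_apply, map_smul, smul_apply, S.JVec_smul, smul_eq_mul]; ring)
    (fun u α β => by ext w; simp only [frakT_apply, add_apply]; ring)
    (fun c u α => by ext w; simp only [frakT_apply, smul_apply, smul_eq_mul]; ring)

lemma frakTL_apply (ε : ℝ) (v : TangentSpace (𝓡 (d + h)) x)
    (α : TangentSpace (𝓡 (d + h)) x →L[ℝ] ℝ) : S.frakTL cov ε x v α = S.frakT cov ε x v α := rfl

end TransverseStructure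
end TransverseSR

/-! ### Smooth frames and smoothness of the splitting -/

namespace TransverseSR

section Frames

variable {n : ℕ} {M : Type*} [TopologicalSpace M] [ChartedSpace (EuclideanSpace ℝ (Fin n)) M]
  [IsManifold (𝓡 n) ∞ M]

/-- The coefficients of a smooth vector field in a smooth frame are smooth. -/
lemma contMDiffAt_frame_coeff {ι : Type*} [Fintype ι] (hι : Fintype.card ι = n)
    {E : ι → VectorField n M} {Y : VectorField n M} {c : ι → M → ℝ} {x : M}
    (hE : ∀ i, SmoothVecNear (E i) x) (hY : SmoothVecNear Y x)
    (hli : LinearIndependent ℝ fun i => E i x)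
    (hsum : ∀ᶠ y in 𝓝 x, Y y = ∑ i, c i y • E i y) (i : ι) :
    ContMDiffAt (𝓡 n) 𝓘(ℝ, ℝ) ∞ (c i) x := by
  let t := trivializationAt (EuclideanSpace ℝ (Fin n)) (fun x : M => TangentSpace (𝓡 n) x) x
  have x_mem : x ∈ t.baseSet := FiberBundle.mem_baseSet_trivializationAt _ _ x
  let s : ι → M → EuclideanSpace ℝ (Fin n) := fun i y => (t ⟨y, E i y⟩).2
  have hs : ∀ i, ContMDiffAt (𝓡 n) 𝓘(ℝ, EuclideanSpace ℝ (Fin n)) ∞ (s i) x := fun i =>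
    (contMDiffAt_section x).1 (hE i).contMDiffAt
  have hw : ContMDiffAt (𝓡 n) 𝓘(ℝ, EuclideanSpace ℝ (Fin n)) ∞ (fun y => (t ⟨y, Y y⟩).2) x :=
    (contMDiffAt_section x).1 hY.contMDiffAt
  -- The frame read in a trivialization, as a linear map from coefficients to vectors. It depends
  -- smoothly on the point, so the coefficients of `Y` come from its inverse.
  let A : M → (ι → ℝ) →L[ℝ] EuclideanSpace ℝ (Fin n) := fun y =>
    ∑ i, (ContinuousLinearMap.proj (R := ℝ) (φ := fun _ : ι => ℝ) i).smulRight (s i y)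
  have hA : ContMDiffAt (𝓡 n) 𝓘(ℝ, (ι → ℝ) →L[ℝ] EuclideanSpace ℝ (Fin n)) ∞ A x :=
    contMDiffAt_finsetSum fun i _ =>
      ((ContinuousLinearMap.smulRightL ℝ (ι → ℝ) (EuclideanSpace ℝ (Fin n))
        (ContinuousLinearMap.proj i)).contMDiff.contMDiffAt.comp x (hs i))
  have hAapp : ∀ y a, A y a = ∑ i, a i • s i y := fun y a => by simp [A]
  have hinv : (A x).IsInvertible := by
    have hinj : Function.Injective (A x) := by
      rw [injective_iff_map_eq_zero]
      intro a ha
      rw [hAapp] at ha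
      have h1 : t.linearEquivAt ℝ x x_mem (∑ i, a i • E i x) = 0 := by
        rw [map_sum, ← ha]
        refine Finset.sum_congr rfl fun i _ => ?_
        rw [map_smul]
        rfl
      have h2 := (map_eq_zero_iff _ (t.linearEquivAt ℝ x x_mem).injective).1 h1
      funext i
      exact Fintype.linearIndependent_iff.1 hli a h2 i
    have hfin : Module.finrank ℝ (ι → ℝ) = Module.finrank ℝ (EuclideanSpace ℝ (Fin n)) := by
      simp [hι]
    exact ⟨(LinearEquiv.ofInjectiveOfFinrankEq (A x).toLinearMap hinj hfin).toContinuousLinearEquiv,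
      by ext; rfl⟩
  have hAi : ContMDiffAt (𝓡 n) 𝓘(ℝ, EuclideanSpace ℝ (Fin n) →L[ℝ] (ι → ℝ)) ∞
      (fun y => (A y).inverse) x :=
    hinv.contDiffAt_map_inverse.contMDiffAt.comp x hA
  have hc : ContMDiffAt (𝓡 n) 𝓘(ℝ, ι → ℝ) ∞ (fun y => (A y).inverse (t ⟨y, Y y⟩).2) x :=
    hAi.clm_apply hw
  have hci := (ContinuousLinearMap.proj (R := ℝ) (φ := fun _ : ι => ℝ) i).contMDiff.contMDiffAt.comp
    x hc
  refine hci.congr_of_eventuallyEq ?_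
  -- Independence is assumed at `x` only; invertible maps form an open set, so it persists nearby.
  have hev : ∀ᶠ y in 𝓝 x, (A y).IsInvertible := by
    have hopen : {L : (ι → ℝ) →L[ℝ] EuclideanSpace ℝ (Fin n) | L.IsInvertible} ∈ 𝓝 (A x) :=
      ContinuousLinearEquiv.nhds hinv.choose |> fun h => by
        rw [hinv.choose_spec] at h
        exact h
    exact hA.continuousAt hopen
  filter_upwards [hev, hsum, t.open_baseSet.mem_nhds x_mem] with y h1 h2 h3
  have h4 : (t ⟨y, Y y⟩).2 = A y (fun i => c i y) := by
    have h5 : (t ⟨y, Y y⟩).2 = t.linearEquivAt ℝ y h3 (Y y) := rfl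
    rw [h5, h2, map_sum, hAapp]
    refine Finset.sum_congr rfl fun i _ => ?_
    rw [map_smul]
    rfl
  simp only [Function.comp_apply, h4, ContinuousLinearMap.proj_apply]
  rw [h1.inverse_apply_eq.2 rfl]

end Frames

namespace TransverseStructure

variable {d h : ℕ} {M : Type*} [TopologicalSpace M]
  [ChartedSpace (EuclideanSpace ℝ (Fin (d + h))) M] [IsManifold (𝓡 (d + h)) ∞ M]
  (S : TransverseStructure d h M) {x : M}

lemma smooth_gH {X Y : VectorField (d + h) M} (hX : SmoothVecNear X x) (hY : SmoothVecNear Y x) :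
    SmoothFunNear (n := d + h) (fun y => S.gH y (X y) (Y y)) x :=
  SmoothNear.form_apply (η := fun y => S.gH y (X y))
    (SmoothNear.apply (V₂ := fun x : M => TangentSpace (𝓡 (d + h)) x →L[ℝ] ℝ)
      (S.gH_smooth.smoothNear x) hX) hY

/-- Gram-Schmidt orthonormalization of horizontal vector fields. -/
lemma exists_orthonormalization (k : ℕ) : ∀ Y : Fin k → VectorField (d + h) M,
    (∀ i, SmoothVecNear (Y i) x) → (∀ᶠ y in 𝓝 x, ∀ i, Y i y ∈ S.hor y) →
    (∀ᶠ y in 𝓝 x, LinearIndependent ℝ fun i => Y i y) →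
    ∃ X : Fin k → VectorField (d + h) M, (∀ i, SmoothVecNear (X i) x) ∧
      ∀ᶠ y in 𝓝 x, ∀ i, X i y ∈ Submodule.span ℝ (Set.range fun i => Y i y) ∧
        ∀ j, S.gH y (X i y) (X j y) = if i = j then 1 else 0 := by
  induction k with
  | zero => exact fun Y _ _ _ => ⟨Y, fun i => i.elim0, Eventually.of_forall fun y i => i.elim0⟩
  | succ k ih =>
    intro Y hY hhor hli
    obtain ⟨X, hX, hX'⟩ := ih (fun i => Y i.castSucc) (fun i => hY _)
      (hhor.mono fun y hy i => hy _)
      (hli.mono fun y hy => hy.comp _ (Fin.castSucc_injective k))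
    let W : VectorField (d + h) M := fun y =>
      Y (Fin.last k) y - ∑ i, S.gH y (X i y) (Y (Fin.last k) y) • X i y
    have hW : SmoothVecNear W x :=
      (hY _).sub (.sum fun i _ => .smul (S.smooth_gH (hX i) (hY _)) (hX i))
    have hWs : SmoothFunNear (n := d + h) (fun y => S.gH y (W y) (W y)) x := S.smooth_gH hW hW
    have hprop : ∀ᶠ y in 𝓝 x, W y ∈ Submodule.span ℝ (Set.range fun i => Y i y) ∧
        0 < S.gH y (W y) (W y) ∧ ∀ i, S.gH y (X i y) (W y) = 0 := by
      filter_upwards [hhor, hli, hX'] with y h1 h2 h3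
      have hsub : Submodule.span ℝ (Set.range fun i : Fin k => Y i.castSucc y) ≤
          Submodule.span ℝ (Set.range fun i => Y i y) :=
        Submodule.span_mono (by rintro _ ⟨i, rfl⟩; exact ⟨i.castSucc, rfl⟩)
      have hmem : W y ∈ Submodule.span ℝ (Set.range fun i => Y i y) :=
        Submodule.sub_mem _ (Submodule.subset_span ⟨Fin.last k, rfl⟩)
          (Submodule.sum_mem _ fun i _ => Submodule.smul_mem _ _ (hsub (h3 i).1))
      -- Otherwise the last field would lie in the span of the previous ones, against linear
      -- independence.
      have hne : W y ≠ 0 := by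
        intro h0
        have h4 : Y (Fin.last k) y ∈ Submodule.span ℝ (Set.range fun i : Fin k => Y i.castSucc y) := by
          rw [sub_eq_zero.1 h0]
          exact Submodule.sum_mem _ fun i _ => Submodule.smul_mem _ _ (h3 i).1
        have h5 : (Set.range fun i : Fin k => Y i.castSucc y)
            = (fun i => Y i y) '' (Set.range Fin.castSucc) := by
          rw [← Set.range_comp]; rfl
        rw [h5] at h4
        have h6 := h2.notMem_span_image (s := Set.range Fin.castSucc) (x := Fin.last k)
          (by rintro ⟨i, hi⟩; exact (Fin.castSucc_lt_last i).ne hi)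
        exact h6 h4
      have hhorW : W y ∈ S.hor y :=
        (Submodule.span_le.2 (by rintro _ ⟨i, rfl⟩; exact h1 i)) hmem
      refine ⟨hmem, S.gH_pos y _ hhorW hne, fun i => ?_⟩
      simp [W, (h3 _).2, map_sub]
    -- The normalizing factor is smooth because the squared norm is positive at `x`, and t ↦ 1/√t is
    -- smooth on positive reals.
    let c : M → ℝ := fun y => (Real.sqrt (S.gH y (W y) (W y)))⁻¹
    have hc : SmoothFunNear (n := d + h) c x := by
      refine hWs.comp (φ := fun t => (Real.sqrt t)⁻¹) ?_
      have h0 : 0 < S.gH x (W x) (W x) := hprop.self_of_nhds.2.1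
      filter_upwards [lt_mem_nhds h0] with t ht
      exact (Real.contDiffAt_sqrt ht.ne').inv (Real.sqrt_pos.2 ht).ne'
    refine ⟨Fin.snoc X (fun y => c y • W y), fun i => ?_, ?_⟩
    · refine Fin.lastCases ?_ (fun i => ?_) i
      · simpa only [Fin.snoc_last] using SmoothNear.smul hc hW
      · simpa only [Fin.snoc_castSucc] using hX i
    · filter_upwards [hX', hprop] with y h1 h2
      have hsub : Submodule.span ℝ (Set.range fun i : Fin k => Y i.castSucc y) ≤
          Submodule.span ℝ (Set.range fun i => Y i y) :=
        Submodule.span_mono (by rintro _ ⟨i, rfl⟩; exact ⟨i.castSucc, rfl⟩)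
      have hcc : c y * (c y * S.gH y (W y) (W y)) = 1 := by
        have h3 := Real.mul_self_sqrt h2.2.1.le
        have h4 := (Real.sqrt_pos.2 h2.2.1).ne'
        simp only [c]
        conv_lhs => rw [← h3]
        rw [Real.sqrt_mul_self (Real.sqrt_nonneg _)]
        field_simp
      intro i
      refine Fin.lastCases ?_ (fun i => ?_) i
      · refine ⟨by simpa only [Fin.snoc_last] using Submodule.smul_mem _ _ h2.1, fun j => ?_⟩
        refine Fin.lastCases ?_ (fun j => ?_) j
        · simp only [Fin.snoc_last, map_smul, smul_apply, smul_eq_mul, hcc, if_true]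
        · simp only [Fin.snoc_last, Fin.snoc_castSucc, map_smul, smul_apply, smul_eq_mul]
          rw [S.gH_symm, h2.2.2, mul_zero, if_neg (Fin.castSucc_lt_last j).ne']
      · refine ⟨by simpa only [Fin.snoc_castSucc] using hsub (h1 i).1, fun j => ?_⟩
        refine Fin.lastCases ?_ (fun j => ?_) j
        · simp only [Fin.snoc_last, Fin.snoc_castSucc, map_smul, smul_eq_mul]
          rw [h2.2.2, mul_zero, if_neg (Fin.castSucc_lt_last i).ne]
        · simp only [Fin.snoc_castSucc, (h1 i).2 j, Fin.castSucc_inj]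

lemma exists_adaptedFrame (x : M) : ∃ (U : Set M) (X : Fin d → VectorField (d + h) M),
    x ∈ U ∧ S.IsAdaptedFrame U X S.vertBasis := by
  obtain ⟨U, Y, hU, hx, hY, hspan⟩ := S.hor_smooth x
  -- `d` fields spanning a space of dimension `d` are independent.
  have hli : ∀ᶠ y in 𝓝 x, LinearIndependent ℝ fun i => Y i y := by
    filter_upwards [hU.mem_nhds hx] with y hy
    rw [linearIndependent_iff_card_eq_finrank_span, Set.finrank, ← hspan y hy, S.finrank_hor]
    simp
  obtain ⟨X, hX, hX'⟩ := S.exists_orthonormalization d Y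
    (fun i => (hY i).smoothVecNear (hU.mem_nhds hx))
    (by
      filter_upwards [hU.mem_nhds hx] with y hy i
      rw [hspan y hy]
      exact Submodule.subset_span ⟨i, rfl⟩) hli
  have hall : ∀ᶠ y in 𝓝 x, (∀ i, ContMDiffAt (𝓡 (d + h))
      ((𝓡 (d + h)).prod 𝓘(ℝ, EuclideanSpace ℝ (Fin (d + h)))) ∞
      (fun y => TotalSpace.mk' (EuclideanSpace ℝ (Fin (d + h))) y (X i y)) y) ∧
      S.IsHorOrthonormal y (fun i => X i y) := by
    filter_upwards [eventually_all.2 hX, hX', hU.mem_nhds hx] with y h1 h2 h3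
    refine ⟨h1, fun i => ?_, fun i j => (h2 i).2 j⟩
    rw [hspan y h3]
    exact (h2 i).1
  obtain ⟨V, hV, hVo, hxV⟩ := eventually_nhds_iff.1 hall
  exact ⟨V, X, hxV, hVo, fun i y hy => ((hV y hy).1 i).contMDiffWithinAt,
    fun y hy => (hV y hy).2, S.isVertOrthonormal_vertBasis⟩

variable {S} in
lemma IsAdaptedFrame.smoothVecNear {U : Set M} {X : Fin d → VectorField (d + h) M}
    {Z : Fin h → S.vert} (hf : S.IsAdaptedFrame U X Z) (hx : x ∈ U) (i : Fin d) :
    SmoothVecNear (X i) x := (hf.smooth i).smoothVecNear (hf.isOpen.mem_nhds hx)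

variable {S} in
lemma IsAdaptedFrame.eventually {U : Set M} {X : Fin d → VectorField (d + h) M}
    {Z : Fin h → S.vert} (hf : S.IsAdaptedFrame U X Z) (hx : x ∈ U) :
    ∀ᶠ y in 𝓝 x, S.IsHorOrthonormal y (fun i => X i y) := by
  filter_upwards [hf.isOpen.mem_nhds hx] with y hy using hf.horizontal y hy

lemma smooth_vert (Z : S.vert) : SmoothVecNear (fun y => Z.1 y) x :=
  (S.vert_smooth Z.1 Z.2).smoothVecNear univ_mem

lemma smooth_horProj {Y : VectorField (d + h) M} (hY : SmoothVecNear Y x) :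
    SmoothVecNear (fun y => S.horProj y (Y y)) x := by
  obtain ⟨U, X, hx, hf⟩ := S.exists_adaptedFrame x
  have h1 : SmoothVecNear (fun y => ∑ i, S.gH y (X i y) (Y y) • X i y) x :=
    .sum fun i _ => .smul (S.smooth_gH (hf.smoothVecNear hx i) hY) (hf.smoothVecNear hx i)
  refine h1.congr ?_
  filter_upwards [hf.eventually hx] with y hy using hy.horProj_eq _

lemma diff_gH {X Y : VectorField (d + h) M} (hX : DiffVecAt X x) (hY : DiffVecAt Y x) :
    MDifferentiableAt (𝓡 (d + h)) 𝓘(ℝ, ℝ) (fun y => S.gH y (X y) (Y y)) x := by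
  have h1 : DiffOneFormAt (fun y => S.gH y (X y)) x :=
    mdiff_clm_apply (V₂ := fun x : M => TangentSpace (𝓡 (d + h)) x →L[ℝ] ℝ)
      (S.gH_smooth.smoothNear x).mdiff hX
  exact h1.apply hY

/-- The values ν_m(Y) are the last `h` coefficients of Y in the frame formed by an adapted
horizontal frame and the global basis `vertBasis`, hence smooth. A general ν_Z is a constant
combination of these. -/
lemma smooth_nu (Z : S.vert) : SmoothFormNear (S.nu Z) x := by
  refine smoothFormNear_of_apply (Eventually.of_forall fun y Y hY => ?_)
  have key : ∀ m, SmoothFunNear (n := d + h) (fun z => S.nu (S.vertBasis m) z (Y z)) y := by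
    intro m
    filter_upwards [hY.eventually] with z hz
    obtain ⟨U, X, hx, hf⟩ := S.exists_adaptedFrame z
    refine contMDiffAt_frame_coeff (n := d + h) (ι := Fin d ⊕ Fin h) (by simp)
      (E := Sum.elim X (fun m y => (S.vertBasis m).1 y)) (Y := Y)
      (c := Sum.elim (fun i y => S.gH y (X i y) (Y y)) (fun m y => S.nu (S.vertBasis m) y (Y y)))
      ?_ hz ?_ ?_ (Sum.inr m)
    · rintro (i | m)
      · exact hf.smoothVecNear hx i
      · exact S.smooth_vert _
    -- Pairing a vanishing combination with gH(X_j, ·) isolates a horizontal coefficient, and with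
    -- ν_l a vertical one.
    · rw [Fintype.linearIndependent_iff]
      intro a ha
      have he := hf.horizontal z hx
      simp only [Fintype.sum_sum_type, Sum.elim_inl, Sum.elim_inr] at ha
      rintro (j | l)
      · have h1 := congrArg (S.gH z (X j z)) ha
        have h2 : ∀ m, S.gH z (X j z) ((S.vertBasis m).1 z) = 0 := fun m =>
          S.gH_ver_right (S.vert_mem_verSpace _) _
        have h3 : ∀ i, S.gH z (X j z) (X i z) = if j = i then 1 else 0 := fun i => he.2 j i
        simpa [map_add, map_sum, h2, h3] using h1
      · have h1 := congrArg (S.nu (S.vertBasis l) z) ha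
        have h2 : ∀ i, S.nu (S.vertBasis l) z (X i z) = 0 := fun i => S.nu_hor _ (he.1 i)
        have h3 : ∀ m, S.gV (S.vertBasis l) (S.vertBasis m) = if l = m then 1 else 0 := fun m =>
          S.isVertOrthonormal_vertBasis l m
        simpa [map_add, map_sum, h2, h3] using h1
    · filter_upwards [hf.eventually hx] with w hw
      simpa [Fintype.sum_sum_type] using decomp hw S.isVertOrthonormal_vertBasis (Y w)
  have h1 : SmoothFunNear (n := d + h)
      (fun z => ∑ m, S.gV Z (S.vertBasis m) * S.nu (S.vertBasis m) z (Y z)) y :=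
    .sum fun m _ => (SmoothFunNear.const _).mul (key m)
  refine h1.congr (Eventually.of_forall fun z => ?_)
  rw [nu_apply, ← S.isVertOrthonormal_vertBasis.sum_nu]
  simp [map_sum, mul_comm]

end TransverseStructure
end TransverseSR

/-! ### The Koszul formula and existence of the canonical connection -/

namespace TransverseSR

section Bracket

variable {n : ℕ} {M : Type*} [TopologicalSpace M] [ChartedSpace (EuclideanSpace ℝ (Fin n)) M]
  [IsManifold (𝓡 n) ∞ M] {x : M} {f : M → ℝ} {V W : VectorField n M}

lemma bracket_smul_left (hf : MDifferentiableAt (𝓡 n) 𝓘(ℝ, ℝ) f x) (hV : DiffVecAt V x) :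
    VectorField.mlieBracket (𝓡 n) (f • V) W x
      = - differential f x (W x) • V x + f x • VectorField.mlieBracket (𝓡 n) V W x :=
  VectorField.mlieBracket_smul_left hf hV

lemma bracket_smul_right (hf : MDifferentiableAt (𝓡 n) 𝓘(ℝ, ℝ) f x) (hW : DiffVecAt W x) :
    VectorField.mlieBracket (𝓡 n) V (f • W) x
      = differential f x (V x) • W x + f x • VectorField.mlieBracket (𝓡 n) V W x :=
  VectorField.mlieBracket_smul_right hf hW

end Bracket

namespace TransverseStructure

variable {d h : ℕ} {M : Type*} [TopologicalSpace M]
  [ChartedSpace (EuclideanSpace ℝ (Fin (d + h))) M] [IsManifold (𝓡 (d + h)) ∞ M]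
  (S : TransverseStructure d h M) {x : M}

lemma differential_gH_smul_left {f : M → ℝ} {X Y : VectorField (d + h) M}
    (hf : MDifferentiableAt (𝓡 (d + h)) 𝓘(ℝ, ℝ) f x) (hX : DiffVecAt X x) (hY : DiffVecAt Y x) :
    differential (n := d + h) (fun y => S.gH y ((f • X) y) (Y y)) x
      = f x • differential (fun y => S.gH y (X y) (Y y)) x + S.gH x (X x) (Y x) • differential f x := by
  rw [← differential_mul hf (S.diff_gH hX hY)]
  congr 1
  funext y
  simp

lemma differential_gH_smul_right {f : M → ℝ} {X Y : VectorField (d + h) M}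
    (hf : MDifferentiableAt (𝓡 (d + h)) 𝓘(ℝ, ℝ) f x) (hX : DiffVecAt X x) (hY : DiffVecAt Y x) :
    differential (n := d + h) (fun y => S.gH y (X y) ((f • Y) y)) x
      = f x • differential (fun y => S.gH y (X y) (Y y)) x + S.gH x (X x) (Y x) • differential f x := by
  rw [← differential_mul hf (S.diff_gH hX hY)]
  congr 1
  funext y
  simp

lemma differential_gH_add_left {X X' Y : VectorField (d + h) M}
    (hX : DiffVecAt X x) (hX' : DiffVecAt X' x) (hY : DiffVecAt Y x) :
    differential (n := d + h) (fun y => S.gH y ((X + X') y) (Y y)) x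
      = differential (fun y => S.gH y (X y) (Y y)) x
        + differential (fun y => S.gH y (X' y) (Y y)) x := by
  rw [← differential_add (S.diff_gH hX hY) (S.diff_gH hX' hY)]
  congr 1
  funext y
  simp

lemma differential_gH_add_right {X Y Y' : VectorField (d + h) M}
    (hX : DiffVecAt X x) (hY : DiffVecAt Y x) (hY' : DiffVecAt Y' x) :
    differential (n := d + h) (fun y => S.gH y (X y) ((Y + Y') y)) x
      = differential (fun y => S.gH y (X y) (Y y)) x
        + differential (fun y => S.gH y (X y) (Y' y)) x := by
  rw [← differential_add (S.diff_gH hX hY) (S.diff_gH hX hY')]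
  congr 1
  funext y
  simp

lemma bracket_vert_mem_hor (Z : S.vert) {X : VectorField (d + h) M} (hX : SmoothVecNear X x)
    (hhor : ∀ᶠ y in 𝓝 x, X y ∈ S.hor y) :
    VectorField.mlieBracket (𝓡 (d + h)) Z.1 X x ∈ S.hor x := by
  obtain ⟨U, hU, hxU, hXU⟩ := hX.exists_isOpen
  obtain ⟨V, hV, hVo, hxV⟩ := eventually_nhds_iff.1 hhor
  exact (S.vert_killing Z.1 Z.2).bracket_mem (U ∩ V) X (hU.inter hVo)
    (hXU.mono inter_subset_left) (fun y hy => hV y hy.2) x ⟨hxU, hxV⟩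

/-- The Lie derivative of `gH` along a vertical field vanishes. -/
lemma lieDeriv_gH (Z : S.vert) {X Y : VectorField (d + h) M} (hX : DiffVecAt X x)
    (hY : DiffVecAt Y x) :
    differential (n := d + h) (fun y => S.gH y (X y) (Y y)) x (Z.1 x)
      = S.gH x (VectorField.mlieBracket (𝓡 (d + h)) Z.1 X x) (Y x)
        + S.gH x (X x) (VectorField.mlieBracket (𝓡 (d + h)) Z.1 Y x) := by
  -- The defect in the identity. It is tensorial in both slots, so it may be computed on other
  -- fields with the same values at `x`, namely a horizontal field plus an element of `vert`.
  let Φ : VectorField (d + h) M → VectorField (d + h) M → ℝ := fun X Y =>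
    differential (n := d + h) (fun y => S.gH y (X y) (Y y)) x (Z.1 x)
      - S.gH x (VectorField.mlieBracket (𝓡 (d + h)) Z.1 X x) (Y x)
      - S.gH x (X x) (VectorField.mlieBracket (𝓡 (d + h)) Z.1 Y x)
  have hΦ₁ : ∀ Y : VectorField (d + h) M, DiffVecAt Y x →
      TensorialAt (𝓡 (d + h)) (EuclideanSpace ℝ (Fin (d + h))) (fun X => Φ X Y) x := by
    intro Y hY
    refine ⟨fun {f X} hf hX => ?_, fun {X X'} hX hX' => ?_⟩
    · simp only [Φ, S.differential_gH_smul_left hf hX hY, bracket_smul_right hf hX]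
      simp
      ring
    · simp only [Φ, S.differential_gH_add_left hX hX' hY,
        VectorField.mlieBracket_add_right hX hX']
      simp
      ring
  have hΦ₂ : ∀ X : VectorField (d + h) M, DiffVecAt X x →
      TensorialAt (𝓡 (d + h)) (EuclideanSpace ℝ (Fin (d + h))) (fun Y => Φ X Y) x := by
    intro X hX
    refine ⟨fun {f Y} hf hY => ?_, fun {Y Y'} hY hY' => ?_⟩
    · simp only [Φ, S.differential_gH_smul_right hf hX hY, bracket_smul_right hf hY]
      simp
      ring
    · simp only [Φ, S.differential_gH_add_right hX hY hY',
        VectorField.mlieBracket_add_right hY hY']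
      simp
      ring
  have hvert : ∀ W : S.vert, ∀ y v, S.gH y (W.1 y) v = 0 := fun W y v => S.gH_vert W.1 W.2 y v
  have hvert' : ∀ W : S.vert, ∀ y v, S.gH y v (W.1 y) = 0 := fun W y v => by
    rw [S.gH_symm, hvert]
  have hZW : ∀ W : S.vert, ∀ v, S.gH x (VectorField.mlieBracket (𝓡 (d + h)) Z.1 W.1 x) v = 0 :=
    fun W v => hvert ⟨_, S.vert_bracket Z.1 Z.2 W.1 W.2⟩ x v
  have hZW' : ∀ W : S.vert, ∀ v, S.gH x v (VectorField.mlieBracket (𝓡 (d + h)) Z.1 W.1 x) = 0 :=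
    fun W v => by rw [S.gH_symm, hZW]
  have hext : ∀ u : TangentSpace (𝓡 (d + h)) x, SmoothVecNear
      (fun y => S.horProj y (extendVec u y)) x := fun u =>
    S.smooth_horProj (smoothVecNear_extendVec u)
  have hd0 : differential (n := d + h) (fun _ : M => (0 : ℝ)) x = 0 := differential_const 0
  have hbr : ∀ u : TangentSpace (𝓡 (d + h)) x, VectorField.mlieBracket (𝓡 (d + h)) Z.1
      (fun y => S.horProj y (extendVec u y)) x ∈ S.hor x := fun u =>
    S.bracket_vert_mem_hor Z (hext u) (Eventually.of_forall fun y => S.horProj_mem _)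
  have key : ∀ u v : TangentSpace (𝓡 (d + h)) x,
      Φ ((fun y => S.horProj y (extendVec u y)) + (S.vertLift x u).1)
        ((fun y => S.horProj y (extendVec v y)) + (S.vertLift x v).1) = 0 := by
    intro u v
    have hu := (hext u).mdiff
    have hv := (hext v).mdiff
    have hzu := (S.smooth_vert (x := x) (S.vertLift x u)).mdiff
    have hzv := (S.smooth_vert (x := x) (S.vertLift x v)).mdiff
    rw [(hΦ₁ _ (mdifferentiableAt_add_section hv hzv)).add hu hzu, (hΦ₂ _ hu).add hv hzv,
      (hΦ₂ _ hzu).add hv hzv]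
    -- Only this pair needs the Killing equation. The other three vanish because `gH` annihilates
    -- `vert`, which is closed under brackets.
    have e1 : Φ (fun y => S.horProj y (extendVec u y)) (fun y => S.horProj y (extendVec v y)) = 0 := by
      obtain ⟨U, hU, hxU, hXU⟩ := (hext u).exists_isOpen
      obtain ⟨V, hV, hxV, hXV⟩ := (hext v).exists_isOpen
      have := (S.vert_killing Z.1 Z.2).lieDeriv_eq_zero (U ∩ V) _ _ (hU.inter hV)
        (hXU.mono inter_subset_left) (hXV.mono inter_subset_right)
        (fun y _ => S.horProj_mem _) (fun y _ => S.horProj_mem _) x ⟨hxU, hxV⟩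
      simp only [Φ, this]
      ring
    have e2 : Φ (fun y => S.horProj y (extendVec u y)) (S.vertLift x v).1 = 0 := by
      simp only [Φ, hvert', hZW', hd0]
      simp
    have e3 : Φ (S.vertLift x u).1 (fun y => S.horProj y (extendVec v y)) = 0 := by
      simp only [Φ, hvert, hZW, hd0]
      simp
    have e4 : Φ (S.vertLift x u).1 (S.vertLift x v).1 = 0 := by
      simp only [Φ, hvert, hvert', hd0]
      simp
    rw [e1, e2, e3, e4]
    simp
  have hval : ∀ u : TangentSpace (𝓡 (d + h)) x,
      u = ((fun y => S.horProj y (extendVec u y)) + (S.vertLift x u).1) x := fun u => by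
    simp [S.horProj_add_vertLift]
  have hdiff : ∀ u : TangentSpace (𝓡 (d + h)) x,
      DiffVecAt ((fun y => S.horProj y (extendVec u y)) + (S.vertLift x u).1) x := fun u =>
    mdifferentiableAt_add_section (hext u).mdiff (S.smooth_vert (x := x) (S.vertLift x u)).mdiff
  have := TensorialAt.pointwise₂ (I := 𝓡 (d + h)) (F := EuclideanSpace ℝ (Fin (d + h)))
    (F' := EuclideanSpace ℝ (Fin (d + h))) (Φ := Φ) (x := x) hΦ₁ hΦ₂ hX (hdiff (X x)) hY
    (hdiff (Y x)) (hval _) (hval _)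
  rw [key] at this
  simp only [Φ] at this
  linarith

/-- The Koszul expression. -/
def koszul (U Y W : VectorField (d + h) M) (x : M) : ℝ :=
  (1 / 2) * (differential (n := d + h) (fun y => S.gH y (Y y) (W y)) x (U x)
    + differential (n := d + h) (fun y => S.gH y (U y) (W y)) x (Y x)
    - differential (n := d + h) (fun y => S.gH y (U y) (Y y)) x (W x)
    + S.gH x (VectorField.mlieBracket (𝓡 (d + h)) U Y x) (W x)
    - S.gH x (VectorField.mlieBracket (𝓡 (d + h)) U W x) (Y x)
    - S.gH x (VectorField.mlieBracket (𝓡 (d + h)) Y W x) (U x))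

variable {U Y W : VectorField (d + h) M}

/-- The derivatives of the factor cancel between the metric terms and the bracket terms.
Nondegeneracy of `gH` is never involved. -/
lemma koszul_tensorial_left (hY : DiffVecAt Y x) (hW : DiffVecAt W x) :
    TensorialAt (𝓡 (d + h)) (EuclideanSpace ℝ (Fin (d + h))) (fun U => S.koszul U Y W x) x where
  smul {f U} hf hU := by
    simp only [koszul, S.differential_gH_smul_left hf hU hY, S.differential_gH_smul_left hf hU hW,
      bracket_smul_left hf hU]
    simp
    ring
  add {U U'} hU hU' := by
    simp only [koszul, S.differential_gH_add_left hU hU' hY, S.differential_gH_add_left hU hU' hW,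
      VectorField.mlieBracket_add_left hU hU']
    simp
    ring

lemma koszul_tensorial_right (hU : DiffVecAt U x) (hY : DiffVecAt Y x) :
    TensorialAt (𝓡 (d + h)) (EuclideanSpace ℝ (Fin (d + h))) (fun W => S.koszul U Y W x) x where
  smul {f W} hf hW := by
    simp only [koszul, S.differential_gH_smul_right hf hY hW, S.differential_gH_smul_right hf hU hW,
      bracket_smul_right hf hW]
    simp [S.gH_symm x (W x)]
    ring
  add {W W'} hW hW' := by
    simp only [koszul, S.differential_gH_add_right hY hW hW', S.differential_gH_add_right hU hW hW',
      VectorField.mlieBracket_add_right hW hW']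
    simp
    ring

/-- In the middle slot the terms with U(f) add up instead of cancelling, which with the factor 1/2
is the Leibniz rule for gH(∇_U Y, W). -/
lemma koszul_smul_mid {f : M → ℝ} (hf : MDifferentiableAt (𝓡 (d + h)) 𝓘(ℝ, ℝ) f x)
    (hU : DiffVecAt U x) (hY : DiffVecAt Y x) (hW : DiffVecAt W x) :
    S.koszul U (f • Y) W x
      = f x * S.koszul U Y W x + differential f x (U x) * S.gH x (Y x) (W x) := by
  simp only [koszul, S.differential_gH_smul_left hf hY hW, S.differential_gH_smul_right hf hU hY,
      bracket_smul_right hf hY, bracket_smul_left hf hY]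
  simp [S.gH_symm x (Y x) (U x)]
  ring

lemma koszul_add_mid {Y' : VectorField (d + h) M} (hU : DiffVecAt U x) (hY : DiffVecAt Y x)
    (hY' : DiffVecAt Y' x) (hW : DiffVecAt W x) :
    S.koszul U (Y + Y') W x = S.koszul U Y W x + S.koszul U Y' W x := by
  simp only [koszul, S.differential_gH_add_left hY hY' hW, S.differential_gH_add_right hU hY hY',
      VectorField.mlieBracket_add_right hY hY', VectorField.mlieBracket_add_left hY hY']
  simp
  ring

open Classical in
/-- The tensor `(u, w) ↦ gH(∇_u Y, w)` of the canonical connection. -/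
def koszulHom (Y : VectorField (d + h) M) (x : M) :
    TangentSpace (𝓡 (d + h)) x →L[ℝ] TangentSpace (𝓡 (d + h)) x →L[ℝ] ℝ :=
  if hY : DiffVecAt Y x then
    TensorialAt.mkHom₂ (fun U W => S.koszul U Y W x) x
      (fun _ hW => S.koszul_tensorial_left hY hW) (fun _ hU => S.koszul_tensorial_right hU hY)
  else 0

lemma koszulHom_apply (hU : DiffVecAt U x) (hY : DiffVecAt Y x) (hW : DiffVecAt W x) :
    S.koszulHom Y x (U x) (W x) = S.koszul U Y W x := by
  rw [koszulHom, dif_pos hY]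
  exact TensorialAt.mkHom₂_apply (Φ := fun U W => S.koszul U Y W x)
    (fun _ hW => S.koszul_tensorial_left hY hW) (fun _ hU => S.koszul_tensorial_right hU hY) hU hW

lemma koszulHom_eq (hY : DiffVecAt Y x) (u w : TangentSpace (𝓡 (d + h)) x) :
    S.koszulHom Y x u w = S.koszul (extendVec u) Y (extendVec w) x := by
  simpa using S.koszulHom_apply (diffVecAt_extendVec u) hY (diffVecAt_extendVec w)

/-- The canonical connection as a function. -/
def canonicalFun (Y : VectorField (d + h) M) (x : M) :
    TangentSpace (𝓡 (d + h)) x →L[ℝ] TangentSpace (𝓡 (d + h)) x :=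
  LinearMap.toContinuousLinearMap
    { toFun := fun u => ∑ i, S.koszulHom Y x u (S.horBasis x i) • S.horBasis x i
        + ∑ m, differential (n := d + h) (fun y => S.nu (S.vertBasis m) y (Y y)) x u
          • (S.vertBasis m).1 x
      map_add' := fun u v => by
        simp only [map_add, add_apply, add_smul, Finset.sum_add_distrib]
        abel
      map_smul' := fun c u => by
        simp only [map_smul, smul_apply, smul_eq_mul, mul_smul, RingHom.id_apply, smul_add,
          Finset.smul_sum] }

lemma canonicalFun_apply (Y : VectorField (d + h) M) (u : TangentSpace (𝓡 (d + h)) x) :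
    S.canonicalFun Y x u = ∑ i, S.koszulHom Y x u (S.horBasis x i) • S.horBasis x i
      + ∑ m, differential (n := d + h) (fun y => S.nu (S.vertBasis m) y (Y y)) x u
        • (S.vertBasis m).1 x := rfl

lemma diff_nu (Z : S.vert) (hY : DiffVecAt Y x) :
    MDifferentiableAt (𝓡 (d + h)) 𝓘(ℝ, ℝ) (fun y => S.nu Z y (Y y)) x :=
  (S.smooth_nu Z).diffOneFormAt.apply hY

/-- The canonical connection. -/
def canonicalConnection : Connection (d + h) M where
  toFun := S.canonicalFun
  isCovariantDerivativeOnUniv :=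
    { add := fun {Y Y' x} hY hY' _ => by
        ext1 u
        have e : ∀ m, differential (n := d + h) (fun y => S.nu (S.vertBasis m) y ((Y + Y') y)) x
            = differential (fun y => S.nu (S.vertBasis m) y (Y y)) x
              + differential (fun y => S.nu (S.vertBasis m) y (Y' y)) x := fun m => by
          rw [← differential_add (S.diff_nu _ hY) (S.diff_nu _ hY')]
          congr 1
          funext y
          simp
        rw [add_apply]
        simp only [canonicalFun_apply, e, S.koszulHom_eq (mdifferentiableAt_add_section hY hY'),
          S.koszulHom_eq hY, S.koszulHom_eq hY',
          S.koszul_add_mid (diffVecAt_extendVec u) hY hY' (diffVecAt_extendVec _), add_apply,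
          add_smul, Finset.sum_add_distrib]
        abel
      leibniz := fun {Y f x} hY hf _ => by
        ext1 u
        have e : ∀ m, differential (n := d + h) (fun y => S.nu (S.vertBasis m) y ((f • Y) y)) x
            = f x • differential (fun y => S.nu (S.vertBasis m) y (Y y)) x
              + S.nu (S.vertBasis m) x (Y x) • differential f x := fun m => by
          rw [← differential_mul hf (S.diff_nu _ hY)]
          congr 1
          funext y
          simp
        change S.canonicalFun (f • Y) x u
          = f x • S.canonicalFun Y x u + differential (n := d + h) f x u • Y x
        -- Expanding Y(x) in the basis splits the term u(f) Y(x) into the contributions of the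
        -- Koszul part and of the ν-part.
        conv_rhs => rw [decomp (S.isHorOrthonormal_horBasis x) S.isVertOrthonormal_vertBasis (Y x)]
        simp only [canonicalFun_apply, e, S.koszulHom_eq (hf.smul_section hY),
          S.koszulHom_eq hY, S.koszul_smul_mid hf (diffVecAt_extendVec u) hY (diffVecAt_extendVec _),
          extendVec_self, add_apply, smul_apply, smul_eq_mul, add_smul, Finset.sum_add_distrib,
          smul_add, Finset.smul_sum, smul_smul, S.gH_symm x (Y x)]
        simp only [mul_comm (S.nu _ x (Y x))]
        abel }

lemma canonicalConnection_apply (Y : VectorField (d + h) M) (u : TangentSpace (𝓡 (d + h)) x) :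
    S.canonicalConnection Y x u = ∑ i, S.koszulHom Y x u (S.horBasis x i) • S.horBasis x i
      + ∑ m, differential (n := d + h) (fun y => S.nu (S.vertBasis m) y (Y y)) x u
        • (S.vertBasis m).1 x := S.canonicalFun_apply Y u

/-- What remains of the six terms is -1/2 times (L_Z gH)(U, Y). Consequently the Koszul form sees
only the horizontal part of its last argument and is represented by a horizontal vector. -/
lemma koszul_vert_right (Z : S.vert) (hU : DiffVecAt U x) (hY : DiffVecAt Y x) :
    S.koszul U Y Z.1 x = 0 := by
  have hvert' : ∀ y v, S.gH y v (Z.1 y) = 0 := fun y v => by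
    rw [S.gH_symm, S.gH_vert Z.1 Z.2]
  have hd0 : differential (n := d + h) (fun _ : M => (0 : ℝ)) x = 0 := differential_const 0
  have hl := S.lieDeriv_gH Z hU hY
  rw [koszul, VectorField.mlieBracket_swap_apply (V := U) (W := Z.1),
    VectorField.mlieBracket_swap_apply (V := Y) (W := Z.1)]
  simp only [hvert', hd0, hl]
  simp [S.gH_symm x _ (U x)]

/-- The same cancellation, now with (L_Z gH)(U, W); it gives the horizontal half of ∇Z = 0. -/
lemma koszul_vert_mid (Z : S.vert) (hU : DiffVecAt U x) (hW : DiffVecAt W x) :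
    S.koszul U Z.1 W x = 0 := by
  have hvert : ∀ y v, S.gH y (Z.1 y) v = 0 := fun y v => S.gH_vert Z.1 Z.2 y v
  have hvert' : ∀ y v, S.gH y v (Z.1 y) = 0 := fun y v => by rw [S.gH_symm, hvert]
  have hd0 : differential (n := d + h) (fun _ : M => (0 : ℝ)) x = 0 := differential_const 0
  have hl := S.lieDeriv_gH Z hU hW
  rw [koszul, VectorField.mlieBracket_swap_apply (V := U) (W := Z.1)]
  simp only [hvert, hvert', hd0, hl]
  simp [S.gH_symm x _ (U x)]

lemma gH_canonicalConnection (hY : DiffVecAt Y x) (u w : TangentSpace (𝓡 (d + h)) x) :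
    S.gH x (S.canonicalConnection Y x u) w = S.koszulHom Y x u w := by
  have h1 : S.koszulHom Y x u w = S.koszulHom Y x u (S.horProj x w) := by
    conv_lhs => rw [← S.horProj_add_vertLift w]
    have h2 := S.koszulHom_apply (diffVecAt_extendVec u) hY
      (S.smooth_vert (x := x) (S.vertLift x w)).mdiff
    rw [S.koszul_vert_right _ (diffVecAt_extendVec u) hY, extendVec_self] at h2
    rw [map_add, h2, add_zero]
  rw [h1, canonicalConnection_apply, map_add, add_apply]
  have h3 : S.gH x (∑ m, differential (n := d + h) (fun y => S.nu (S.vertBasis m) y (Y y)) x u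
        • (S.vertBasis m).1 x) w = 0 :=
    S.gH_ver_left (Submodule.sum_mem _ fun m _ => Submodule.smul_mem _ _ (S.vert_mem_verSpace _)) _
  rw [h3, add_zero, horProj]
  simp only [map_sum, map_smul, FunLike.coe_sum, Finset.sum_apply, smul_apply, smul_eq_mul]
  exact Finset.sum_congr rfl fun i _ => mul_comm _ _

/-- The forms ν_Z are parallel by construction, first for the chosen basis, then for all Z by
constant combinations. -/
lemma nu_canonicalConnection (Z : S.vert) (hY : DiffVecAt Y x) (u : TangentSpace (𝓡 (d + h)) x) :
    S.nu Z x (S.canonicalConnection Y x u) = differential (fun y => S.nu Z y (Y y)) x u := by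
  have h1 : S.nu Z x (∑ i, S.koszulHom Y x u (S.horBasis x i) • S.horBasis x i) = 0 :=
    S.nu_hor Z (Submodule.sum_mem _ fun i _ =>
      Submodule.smul_mem _ _ ((S.isHorOrthonormal_horBasis x).1 i))
  have h2 : (fun y => S.nu Z y (Y y))
      = fun y => ∑ m, S.gV Z (S.vertBasis m) * S.nu (S.vertBasis m) y (Y y) := by
    funext y
    rw [nu_apply, ← S.isVertOrthonormal_vertBasis.sum_nu]
    simp [map_sum, mul_comm]
  have hm : ∀ m, MDifferentiableAt (𝓡 (d + h)) 𝓘(ℝ, ℝ)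
      (fun y => S.gV Z (S.vertBasis m) * S.nu (S.vertBasis m) y (Y y)) x := fun m =>
    mdifferentiableAt_const.mul (S.diff_nu _ hY)
  rw [canonicalConnection_apply, map_add, h1, zero_add, h2, differential_sum fun m _ => hm m]
  simp only [map_sum, map_smul, FunLike.coe_sum, Finset.sum_apply, smul_eq_mul, S.nu_vert,
    differential_const_mul _ (S.diff_nu _ hY), smul_apply]
  exact Finset.sum_congr rfl fun i _ => mul_comm _ _

/-- Antisymmetrizing the Koszul formula leaves gH([U, V], W), as in the Levi-Civita case. Hence the
torsion is vertical on all pairs of vectors. -/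
lemma gH_torsion_canonicalConnection (u v w : TangentSpace (𝓡 (d + h)) x) :
    S.gH x (S.canonicalConnection.torsion x u v) w = 0 := by
  have hu := diffVecAt_extendVec u
  have hv := diffVecAt_extendVec v
  have hw := diffVecAt_extendVec w
  have k1 := S.koszulHom_apply hu hv hw
  have k2 := S.koszulHom_apply hv hu hw
  have ht := S.canonicalConnection.torsion_apply hu hv
  simp only [extendVec_self] at k1 k2 ht
  rw [ht, map_sub, map_sub, sub_apply, sub_apply, S.gH_canonicalConnection hv,
    S.gH_canonicalConnection hu]
  rw [k1, k2, koszul, koszul,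
    VectorField.mlieBracket_swap_apply (V := extendVec v) (W := extendVec u)]
  simp only [extendVec_self, S.gH_symm _ (extendVec v _) (extendVec u _), map_neg, neg_apply]
  ring

lemma gVer_eq (u v : TangentSpace (𝓡 (d + h)) x) :
    S.gVer x u v = ∑ m, S.nu (S.vertBasis m) x u * S.nu (S.vertBasis m) x v := by
  rw [gVer, ← S.isVertOrthonormal_vertBasis.sum_nu u]
  simp [map_sum, nu_apply]

/-- The definition uses the irregular `horBasis`. Invariance of the trace replaces it by an adapted
frame, in which all coefficients are Koszul expressions of smooth fields. -/
lemma smooth_canonicalConnection : SmoothConnection S.canonicalConnection := by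
  intro V hV
  refine ⟨fun {Y} hY y hy => ContMDiffAt.contMDiffWithinAt ?_⟩
  have hYs : ∀ z ∈ V, SmoothVecNear Y z := fun z hz =>
    SmoothVectorFieldOn.smoothVecNear hY (hV.mem_nhds hz)
  refine SmoothNear.contMDiffAt (SmoothNear.of_apply ?_)
  filter_upwards [hV.mem_nhds hy] with z hz U hU
  replace hU : SmoothVecNear U z := hU
  obtain ⟨V', X, hzV', hf⟩ := S.exists_adaptedFrame z
  have hd : ∀ m, SmoothFunNear (n := d + h)
      (fun w => differential (n := d + h) (fun y => S.nu (S.vertBasis m) y (Y y)) w (U w)) z :=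
    fun m => (((S.smooth_nu _).form_apply (hYs z hz)).differential).form_apply hU
  have hk : ∀ i, SmoothFunNear (n := d + h) (S.koszul U Y (X i)) z := fun i => by
    have hX := hf.smoothVecNear hzV' i
    have hYz := hYs z hz
    exact (SmoothFunNear.const _).mul (((((((S.smooth_gH hYz hX).differential.form_apply hU).add
      ((S.smooth_gH hU hX).differential.form_apply hYz)).sub
      ((S.smooth_gH hU hYz).differential.form_apply hX)).add
      (S.smooth_gH (hU.mlieBracket hYz) hX)).sub
      (S.smooth_gH (hU.mlieBracket hX) hYz)).sub
      (S.smooth_gH (hYz.mlieBracket hX) hU))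
  have hs : SmoothVecNear (fun w => ∑ i, S.koszul U Y (X i) w • X i w
      + ∑ m, differential (n := d + h) (fun y => S.nu (S.vertBasis m) y (Y y)) w (U w)
        • (S.vertBasis m).1 w) z :=
    (SmoothNear.sum fun i _ => .smul (hk i) (hf.smoothVecNear hzV' i)).add
      (SmoothNear.sum fun m _ => .smul (hd m) (S.smooth_vert _))
  refine hs.congr ?_
  filter_upwards [hV.mem_nhds hz, hU.eventually, hf.isOpen.mem_nhds hzV'] with w hw hUw hwV'
  have h1 := (hf.horizontal w hwV').sum_bilin_eq (S.isHorOrthonormal_horBasis w)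
    (LinearMap.mk₂ ℝ (fun u v => S.koszulHom Y w (U w) u • v) (by intros; simp [add_smul])
      (by intros; simp [smul_smul]) (by intros; simp) (fun c u v => smul_comm _ _ _))
  simp only [LinearMap.mk₂_apply] at h1
  change S.canonicalConnection Y w (U w) = _
  rw [canonicalConnection_apply, ← h1]
  congr 1
  refine Finset.sum_congr rfl fun i _ => ?_
  rw [S.koszulHom_apply (SmoothNear.mdiff hUw) (hYs w hw).mdiff (hf.smoothVecNear hwV' i).mdiff]

lemma isCanonicalConnection_canonicalConnection :
    S.IsCanonicalConnection S.canonicalConnection where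
  smooth := S.smooth_canonicalConnection
  metric := by
    intro ε hε x Y W U hU hx hY hW u
    have hY' := (hY.smoothVecNear (hU.mem_nhds hx)).mdiff
    have hW' := (hW.smoothVecNear (hU.mem_nhds hx)).mdiff
    have h1 : (fun y => S.metric ε y (Y y) (W y)) = fun y => S.gH y (Y y) (W y)
        + ε⁻¹ * ∑ m, S.nu (S.vertBasis m) y (Y y) * S.nu (S.vertBasis m) y (W y) := by
      funext y
      rw [metric, gVer_eq]
    have hm : ∀ m, MDifferentiableAt (𝓡 (d + h)) 𝓘(ℝ, ℝ)
        (fun y => S.nu (S.vertBasis m) y (Y y) * S.nu (S.vertBasis m) y (W y)) x := fun m =>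
      (S.diff_nu _ hY').mul (S.diff_nu _ hW')
    have hsum := mdifferentiableAt_sum (s := Finset.univ) fun m _ => hm m
    have hsum' : MDifferentiableAt (𝓡 (d + h)) 𝓘(ℝ, ℝ) (fun y => ε⁻¹ *
        ∑ m, S.nu (S.vertBasis m) y (Y y) * S.nu (S.vertBasis m) y (W y)) x :=
      mdifferentiableAt_const.mul hsum
    rw [h1, differential_add (S.diff_gH hY' hW') hsum',
      differential_const_mul _ hsum, differential_sum fun m _ => hm m]
    simp only [metric, gVer_eq, S.nu_canonicalConnection _ hY', S.nu_canonicalConnection _ hW',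
      differential_mul (S.diff_nu _ hY') (S.diff_nu _ hW'), S.gH_canonicalConnection hY',
      S.gH_symm x (Y x), S.gH_canonicalConnection hW']
    have k1 := S.koszulHom_apply (diffVecAt_extendVec u) hY' hW'
    have k2 := S.koszulHom_apply (diffVecAt_extendVec u) hW' hY'
    rw [extendVec_self] at k1 k2
    -- In the sum of the Koszul expressions for (U, Y, W) and (U, W, Y) everything cancels except
    -- U(gH(Y, W)).
    rw [k1, k2, koszul, koszul, VectorField.mlieBracket_swap_apply (V := W) (W := Y)]
    simp only [extendVec_self, S.gH_symm _ (W _) (Y _), add_apply, smul_apply, FunLike.coe_sum,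
      Finset.sum_apply, smul_eq_mul, Finset.sum_add_distrib, map_neg, neg_apply]
    have h3 : ∀ m, S.nu (S.vertBasis m) x (W x) * differential (n := d + h)
        (fun y => S.nu (S.vertBasis m) y (Y y)) x u = differential (n := d + h)
        (fun y => S.nu (S.vertBasis m) y (Y y)) x u * S.nu (S.vertBasis m) x (W x) :=
      fun m => mul_comm _ _
    simp only [h3]
    ring
  horizontal := by
    intro x Y U hU hx hY hhor u _
    have h0 : ∀ m, differential (n := d + h) (fun y => S.nu (S.vertBasis m) y (Y y)) x = 0 := by
      intro m
      rw [← differential_const (n := d + h) (x := x) 0]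
      refine differential_congr ?_
      filter_upwards [hU.mem_nhds hx] with y hy using S.nu_hor _ (hhor y hy)
    rw [canonicalConnection_apply]
    simp only [h0, zero_apply, zero_smul, Finset.sum_const_zero, add_zero]
    exact Submodule.sum_mem _ fun i _ =>
      Submodule.smul_mem _ _ ((S.isHorOrthonormal_horBasis x).1 i)
  vertical := by
    intro Z hZ x
    ext1 u
    have hZs := (S.smooth_vert (x := x) ⟨Z, hZ⟩).mdiff
    rw [canonicalConnection_apply]
    have h0 : ∀ m, differential (n := d + h) (fun y => S.nu (S.vertBasis m) y (Z y)) x = 0 := by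
      intro m
      have : (fun y => S.nu (S.vertBasis m) y (Z y)) = fun _ => S.gV (S.vertBasis m) ⟨Z, hZ⟩ := by
        funext y
        exact S.nu_vert _ ⟨Z, hZ⟩
      rw [this, differential_const]
    have h1 : ∀ w, S.koszulHom Z x u w = 0 := fun w => by
      rw [S.koszulHom_eq hZs]
      exact S.koszul_vert_mid ⟨Z, hZ⟩ (diffVecAt_extendVec u) (diffVecAt_extendVec w)
    simp [h0, h1]
  torsion_hor_hor := by
    intro x u _ v _
    exact S.mem_verSpace_of_gH_eq_zero fun w _ => S.gH_torsion_canonicalConnection u v w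
  torsion_hor_vert := by
    intro x u hu Z hZ
    have hT : S.canonicalConnection.torsion x u (Z x) ∈ S.verSpace x :=
      S.mem_verSpace_of_gH_eq_zero fun w _ => S.gH_torsion_canonicalConnection u (Z x) w
    rw [← S.vertLift_ver hT, ← S.isVertOrthonormal_vertBasis.sum_nu_eval]
    refine Finset.sum_eq_zero fun m _ => ?_
    have hUs : SmoothVecNear (fun y => S.horProj y (extendVec u y)) x :=
      S.smooth_horProj (smoothVecNear_extendVec u)
    have hZs := S.smooth_vert (x := x) ⟨Z, hZ⟩
    have ht := S.canonicalConnection.torsion_apply hUs.mdiff hZs.mdiff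
    have hUx : S.horProj x (extendVec u x) = u := by rw [extendVec_self, S.horProj_of_mem hu]
    -- With u extended horizontally, T(U, Z) = ∇_U Z - ∇_Z U - [U, Z]. The ν-components of the first
    -- two terms are derivatives of constants, and [U, Z] is horizontal.
    have hn : S.nu (S.vertBasis m) x (S.canonicalConnection.torsion x u (Z x)) = 0 := by
      have h0 : (fun y => S.nu (S.vertBasis m) y (S.horProj y (extendVec u y)))
          = fun _ => (0 : ℝ) := by
        funext y
        exact S.nu_horProj _ _
      have hb := S.bracket_vert_mem_hor ⟨Z, hZ⟩ hUs (Eventually.of_forall fun y => S.horProj_mem _)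
      simp only [hUx] at ht
      rw [ht, map_sub, map_sub, S.nu_canonicalConnection _ hUs.mdiff,
        S.nu_canonicalConnection _ hZs.mdiff, h0, VectorField.mlieBracket_swap_apply, map_neg,
        S.nu_hor _ hb]
      have h1 : (fun y => S.nu (S.vertBasis m) y (Z y)) = fun _ => S.gV (S.vertBasis m) ⟨Z, hZ⟩ := by
        funext y
        exact S.nu_vert _ ⟨Z, hZ⟩
      simp only [h1, differential_const]
      simp
    rw [hn, zero_smul]

end TransverseStructure
end TransverseSR

/-! ### Consequences of the axioms of the canonical connection -/

namespace TransverseSR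
namespace TransverseStructure

variable {d h : ℕ} {M : Type*} [TopologicalSpace M]
  [ChartedSpace (EuclideanSpace ℝ (Fin (d + h))) M] [IsManifold (𝓡 (d + h)) ∞ M]
  {S : TransverseStructure d h M} {cov : Connection (d + h) M} {x : M}

namespace IsCanonicalConnection

lemma smoothConnection (hc : S.IsCanonicalConnection cov) : SmoothConnection cov := hc.smooth

variable {Y W : VectorField (d + h) M}

lemma smooth_gVer (hY : SmoothVecNear Y x) (hW : SmoothVecNear W x) :
    SmoothFunNear (n := d + h) (fun y => S.gVer y (Y y) (W y)) x := by
  simp only [gVer_eq]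
  exact .sum fun m _ => ((S.smooth_nu _).form_apply hY).mul ((S.smooth_nu _).form_apply hW)

lemma differential_metric (hc : S.IsCanonicalConnection cov) {ε : ℝ} (hε : 0 < ε)
    (hY : SmoothVecNear Y x) (hW : SmoothVecNear W x) (u : TangentSpace (𝓡 (d + h)) x) :
    differential (n := d + h) (fun y => S.gH y (Y y) (W y)) x u
      + ε⁻¹ * differential (n := d + h) (fun y => S.gVer y (Y y) (W y)) x u
    = S.gH x (cov Y x u) (W x) + ε⁻¹ * S.gVer x (cov Y x u) (W x)
      + (S.gH x (Y x) (cov W x u) + ε⁻¹ * S.gVer x (Y x) (cov W x u)) := by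
  obtain ⟨U, hU, hxU, hYU⟩ := hY.exists_isOpen
  obtain ⟨V, hV, hxV, hWV⟩ := hW.exists_isOpen
  have h1 := hc.metric ε hε x Y W (U ∩ V) (hU.inter hV) ⟨hxU, hxV⟩
    (hYU.mono inter_subset_left) (hWV.mono inter_subset_right) u
  have hg : SmoothFunNear (n := d + h) (fun y => ε⁻¹ * S.gVer y (Y y) (W y)) x :=
    (SmoothFunNear.const _).mul (smooth_gVer hY hW)
  simp only [TransverseStructure.metric] at h1
  rw [differential_add (S.smooth_gH hY hW).mdiff hg.mdiff,
    differential_const_mul _ (smooth_gVer hY hW).mdiff] at h1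
  exact h1

/-- Compatibility with g_ε is affine in ε⁻¹, so the two values ε = 1 and ε = 2 separate the
horizontal from the vertical identity. -/
lemma differential_gH (hc : S.IsCanonicalConnection cov) (hY : SmoothVecNear Y x)
    (hW : SmoothVecNear W x) (u : TangentSpace (𝓡 (d + h)) x) :
    differential (n := d + h) (fun y => S.gH y (Y y) (W y)) x u
    = S.gH x (cov Y x u) (W x) + S.gH x (Y x) (cov W x u) := by
  have h1 := hc.differential_metric one_pos hY hW u
  have h2 := hc.differential_metric two_pos hY hW u
  linarith

lemma differential_gVer (hc : S.IsCanonicalConnection cov) (hY : SmoothVecNear Y x)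
    (hW : SmoothVecNear W x) (u : TangentSpace (𝓡 (d + h)) x) :
    differential (n := d + h) (fun y => S.gVer y (Y y) (W y)) x u
    = S.gVer x (cov Y x u) (W x) + S.gVer x (Y x) (cov W x u) := by
  have h1 := hc.differential_metric one_pos hY hW u
  have h2 := hc.differential_metric two_pos hY hW u
  linarith

lemma cov_vert (hc : S.IsCanonicalConnection cov) (Z : S.vert) :
    cov (fun y => Z.1 y) x = 0 := hc.vertical Z.1 Z.2 x

/-- ν_Z is the pairing with Z in the parallel form `gVer`, and Z itself is parallel. -/
lemma nu_cov (hc : S.IsCanonicalConnection cov) (Z : S.vert) (hY : SmoothVecNear Y x)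
    (u : TangentSpace (𝓡 (d + h)) x) :
    S.nu Z x (cov Y x u) = differential (n := d + h) (fun y => S.nu Z y (Y y)) x u := by
  have h1 := hc.differential_gVer hY (S.smooth_vert Z) u
  have h2 : ∀ y (v : TangentSpace (𝓡 (d + h)) y), S.gVer y v (Z.1 y) = S.nu Z y v := fun y v => by
    rw [gVer, S.vertLift_vert, S.gV_symm, nu_apply]
  simp only [h2, hc.cov_vert, zero_apply] at h1
  rw [h1, gVer, map_zero, map_zero, add_zero]

lemma vertLift_eq_zero_of_nu {u : TangentSpace (𝓡 (d + h)) x}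
    (hu : ∀ Z, S.nu Z x u = 0) : S.vertLift x u = 0 := by
  rw [← S.isVertOrthonormal_vertBasis.sum_nu u]
  simp [hu]

/-- The axiom covers horizontal directions only. For an arbitrary direction, the components ν_Z(Y)
vanish identically near `x` and ν_Z is parallel. -/
lemma cov_mem_hor (hc : S.IsCanonicalConnection cov) (hY : SmoothVecNear Y x)
    (hhor : ∀ᶠ y in 𝓝 x, Y y ∈ S.hor y) (u : TangentSpace (𝓡 (d + h)) x) :
    cov Y x u ∈ S.hor x := by
  have h1 : S.vertLift x (cov Y x u) = 0 := vertLift_eq_zero_of_nu fun Z => by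
    rw [hc.nu_cov Z hY, differential_congr (g := fun _ => 0)
      (hhor.mono fun y hy => S.nu_hor Z hy), differential_const, zero_apply]
  rw [← S.horProj_add_vertLift (cov Y x u), h1]
  simpa using S.horProj_mem _

/-! ### The torsion -/

lemma torsion_hor_ver (hc : S.IsCanonicalConnection cov) {u v : TangentSpace (𝓡 (d + h)) x}
    (hu : u ∈ S.hor x) (hv : v ∈ S.verSpace x) : cov.torsion x u v = 0 := by
  obtain ⟨Z, rfl⟩ := S.mem_verSpace.1 hv
  exact hc.torsion_hor_vert x u hu Z.1 Z.2

lemma torsion_ver_hor (hc : S.IsCanonicalConnection cov) {u v : TangentSpace (𝓡 (d + h)) x}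
    (hu : u ∈ S.verSpace x) (hv : v ∈ S.hor x) : cov.torsion x u v = 0 := by
  rw [cov.torsion_antisymm, hc.torsion_hor_ver hv hu, neg_zero]

lemma torsion_hor_left (hc : S.IsCanonicalConnection cov) {u : TangentSpace (𝓡 (d + h)) x}
    (hu : u ∈ S.hor x) (v : TangentSpace (𝓡 (d + h)) x) :
    cov.torsion x u (S.horProj x v) = cov.torsion x u v := by
  conv_rhs => rw [← S.horProj_add_vertLift v, map_add,
    hc.torsion_hor_ver hu (S.vert_mem_verSpace _), add_zero]

/-- The pair not covered by the axioms is vertical-vertical: there T(Z, W) = -[Z, W], which stays in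
the Lie algebra. -/
lemma torsion_mem_ver (hc : S.IsCanonicalConnection cov) (u v : TangentSpace (𝓡 (d + h)) x) :
    cov.torsion x u v ∈ S.verSpace x := by
  rw [← S.horProj_add_vertLift u, ← S.horProj_add_vertLift v]
  simp only [map_add, add_apply, hc.torsion_hor_ver (S.horProj_mem _) (S.vert_mem_verSpace _),
    hc.torsion_ver_hor (S.vert_mem_verSpace _) (S.horProj_mem _), add_zero, zero_add]
  refine Submodule.add_mem _ (hc.torsion_hor_hor x _ (S.horProj_mem _) _ (S.horProj_mem _)) ?_
  have h1 := cov.torsion_apply (S.smooth_vert (x := x) (S.vertLift x u)).mdiff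
    (S.smooth_vert (x := x) (S.vertLift x v)).mdiff
  rw [h1, hc.cov_vert, hc.cov_vert]
  simp only [zero_apply, sub_zero, zero_sub]
  exact Submodule.neg_mem _
    (S.vert_mem_verSpace ⟨_, S.vert_bracket _ (S.vertLift x u).2 _ (S.vertLift x v).2⟩)

lemma torsion_eq_sum (hc : S.IsCanonicalConnection cov) {Z : Fin h → S.vert}
    (hZ : S.IsVertOrthonormal Z) (u v : TangentSpace (𝓡 (d + h)) x) :
    cov.torsion x u v = ∑ m, S.nu (Z m) x (cov.torsion x u v) • (Z m).1 x := by
  rw [hZ.sum_nu_eval, S.vertLift_ver (hc.torsion_mem_ver u v)]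

lemma gH_JVec_hor (hc : S.IsCanonicalConnection cov) (Z : S.vert)
    {u : TangentSpace (𝓡 (d + h)) x} (hu : u ∈ S.hor x) (w : TangentSpace (𝓡 (d + h)) x) :
    S.gH x (S.JVec cov Z x u) w = S.nu Z x (cov.torsion x u w) := by
  rw [S.gH_JVec, S.horProj_of_mem hu, hc.torsion_hor_left hu]

/-! ### Smoothness of `J` and `𝔗` -/

lemma smooth_JVec (hc : S.IsCanonicalConnection cov) (Z : S.vert) (hY : SmoothVecNear Y x) :
    SmoothVecNear (fun y => S.JVec cov Z y (Y y)) x := by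
  obtain ⟨U, X, hx, hf⟩ := S.exists_adaptedFrame x
  have h1 : SmoothVecNear (fun y => ∑ i, S.nu Z y (cov.torsion y (S.horProj y (Y y)) (X i y))
      • X i y) x :=
    .sum fun i _ => .smul ((S.smooth_nu Z).form_apply
      (hc.smoothConnection.torsion_vec (S.smooth_horProj hY) (hf.smoothVecNear hx i)))
      (hf.smoothVecNear hx i)
  refine h1.congr ?_
  filter_upwards [hf.eventually hx] with y hy
  rw [← S.JVec_horProj, hy.JVec_eq cov Z (S.horProj_mem _)]

lemma smooth_frakT (hc : S.IsCanonicalConnection cov) (ε : ℝ) (hY : SmoothVecNear Y x)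
    {η : OneForm (d + h) M} (hη : SmoothFormNear η x) :
    SmoothFormNear (fun y => S.frakT cov ε y (Y y) (η y)) x := by
  refine smoothFormNear_of_apply ?_
  filter_upwards [hY.eventually, hη.eventually] with y hYy hηy W hW
  have h1 : SmoothFunNear (n := d + h) (fun z => - η z (cov.torsion z (Y z) (S.horProj z (W z)))
      + 1 / (2 * ε) * ∑ m, S.nu (S.vertBasis m) z (W z) * η z (S.JVec cov (S.vertBasis m) z (Y z)))
      y :=
    (SmoothNear.form_apply hηy
      (hc.smoothConnection.torsion_vec hYy (S.smooth_horProj hW))).neg.add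
      ((SmoothFunNear.const _).mul (.sum fun m _ => ((S.smooth_nu _).form_apply hW).mul
        (SmoothNear.form_apply hηy (hc.smooth_JVec _ hYy))))
  refine h1.congr (Eventually.of_forall fun z => ?_)
  rw [S.frakT_apply, ← S.isVertOrthonormal_vertBasis.sum_nu (W z), ← JVecL_apply]
  simp only [map_sum, map_smul, LinearMap.sum_apply, LinearMap.smul_apply, JVecL_apply, smul_eq_mul]

lemma covForm_vert (hc : S.IsCanonicalConnection cov) {η : OneForm (d + h) M}
    (hη : SmoothFormNear η x) (Z : S.vert) (u : TangentSpace (𝓡 (d + h)) x) :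
    covForm cov η x u (Z.1 x) = differential (n := d + h) (fun y => η y (Z.1 y)) x u := by
  rw [covForm_eval (SmoothNear.mdiff hη) (S.smooth_vert Z).mdiff, hc.cov_vert]
  simp

lemma smooth_twistedAlong (hc : S.IsCanonicalConnection cov) (ε : ℝ) (hY : SmoothVecNear Y x)
    {η : OneForm (d + h) M} (hη : SmoothFormNear η x) :
    SmoothFormNear (S.twistedAlong cov ε Y η) x :=
  (hc.smoothConnection.covFormAlong hη hY).sub (hc.smooth_frakT ε hY hη)

end IsCanonicalConnection

end TransverseStructure
end TransverseSR

/-! ### The sum of squares formula -/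

namespace TransverseSR
namespace TransverseStructure

variable {d h : ℕ} {M : Type*} [TopologicalSpace M]
  [ChartedSpace (EuclideanSpace ℝ (Fin (d + h))) M] [IsManifold (𝓡 (d + h)) ∞ M]
  {S : TransverseStructure d h M} {cov : Connection (d + h) M} {x : M}

/-- Bilinearity in the first two arguments lets the Yang-Mills trace be taken over any horizontal
orthonormal basis. -/
lemma covTorsion_trilinear (hcov : SmoothConnection cov) (w : TangentSpace (𝓡 (d + h)) x) :
    ∃ B : TangentSpace (𝓡 (d + h)) x →ₗ[ℝ] TangentSpace (𝓡 (d + h)) x →ₗ[ℝ]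
      TangentSpace (𝓡 (d + h)) x, ∀ u v, B u v = covTorsion cov x u v w := by
  have key := fun (u v : TangentSpace (𝓡 (d + h)) x) => covTorsion_eq hcov u
    (diffVecAt_extendVec v) (diffVecAt_extendVec w)
  have hw := diffVecAt_extendVec w
  refine ⟨LinearMap.mk₂ ℝ (fun u v => covTorsion cov x u v w) ?_ ?_ ?_ ?_, fun u v => rfl⟩
  · intro u u' v
    simp only [covTorsion, map_add, add_apply]
    abel
  · intro c u v
    simp only [covTorsion, map_smul, smul_apply, smul_sub]
  · intro u v v'
    have hv := diffVecAt_extendVec v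
    have hv' := diffVecAt_extendVec v'
    have h1 := covTorsion_eq hcov u (mdifferentiableAt_add_section hv hv') hw
    have h2 := cov_add cov hv hv'
    have h3 := cov_add cov (hcov.torsion_diff hv hw) (hcov.torsion_diff hv' hw)
    simp only [Pi.add_apply, map_add, add_apply, extendVec_self] at h1
    rw [h3] at h1
    change cov (extendVec v + extendVec v') x = _ at h2
    rw [h1, h2, covTorsion, covTorsion]
    simp only [map_add, add_apply]
    abel
  · intro c u v
    have hv := diffVecAt_extendVec v
    have hcv : DiffVecAt ((fun _ : M => c) • extendVec v) x :=
      mdifferentiableAt_const.smul_section hv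
    have h1 := covTorsion_eq hcov u hcv hw
    have h2 := cov_smul cov (f := fun _ => c) mdifferentiableAt_const hv u
    have h3 := cov_smul cov (f := fun _ => c) mdifferentiableAt_const (hcov.torsion_diff hv hw) u
    simp only [Pi.smul_apply', map_smul, smul_apply, extendVec_self] at h1
    rw [h3] at h1
    change cov ((fun _ : M => c) • extendVec v) x u = _ at h2
    rw [h1, h2, covTorsion, differential_const]
    simp only [map_smul, smul_apply, extendVec_self, zero_apply, zero_smul, add_zero, smul_sub]

lemma IsYangMills.sum_eq_zero (hYM : S.IsYangMills cov) (hcov : SmoothConnection cov)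
    {e : Fin d → TangentSpace (𝓡 (d + h)) x} (he : S.IsHorOrthonormal x e)
    {w : TangentSpace (𝓡 (d + h)) x} (hw : w ∈ S.hor x) :
    ∑ i, covTorsion cov x (e i) (e i) w = 0 := by
  obtain ⟨B, hB⟩ := covTorsion_trilinear hcov w
  have h1 := he.sum_bilin_eq (S.isHorOrthonormal_horBasis x) B
  simp only [hB] at h1
  rw [h1, hYM x w hw]

namespace IsCanonicalConnection

variable (hc : S.IsCanonicalConnection cov) {ε : ℝ} {X : VectorField (d + h) M}
  {η : OneForm (d + h) M}
include hc

/-- The derivative of 𝔗_X η is grouped with 𝔗_{∇_X X} η, so that the bracketed difference involves X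
only through its value and ∇T. -/
lemma twisted_twistedAlong (hX : SmoothVecNear X x) (hη : SmoothFormNear η x) :
    S.twistedAlong cov ε X (S.twistedAlong cov ε X η) x - S.twisted cov ε η x (cov X x (X x))
      = secondCovForm cov η x (X x) (X x)
        - (covForm cov (fun y => S.frakT cov ε y (X y) (η y)) x (X x)
          - S.frakT cov ε x (cov X x (X x)) (η x))
        - S.frakT cov ε x (X x) (covForm cov η x (X x))
        + S.frakT cov ε x (X x) (S.frakT cov ε x (X x) (η x)) := by
  have h1 : covForm cov (S.twistedAlong cov ε X η) x (X x)
      = covForm cov (covFormAlong cov X η) x (X x)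
        - covForm cov (fun y => S.frakT cov ε y (X y) (η y)) x (X x) :=
    covForm_sub (SmoothNear.mdiff (hc.smoothConnection.covFormAlong hη hX))
      (SmoothNear.mdiff (hc.smooth_frakT ε hX hη)) _
  rw [twistedAlong, twisted, h1, secondCovForm_eq hc.smoothConnection hη _ hX.mdiff, twistedAlong,
    twisted, twisted, ← frakTL_apply, ← frakTL_apply, map_sub]
  simp only [frakTL_apply]
  abel

/-- On horizontal vectors 𝔗_X η is -η ∘ T(X, ·). A horizontal extension of `w` stays horizontal
under ∇, so the product rule yields only ∇η and ∇T. -/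
lemma covForm_frakT_hor (hX : SmoothVecNear X x) (hη : SmoothFormNear η x)
    {w : TangentSpace (𝓡 (d + h)) x} (hw : w ∈ S.hor x)
    (u : TangentSpace (𝓡 (d + h)) x) :
    covForm cov (fun y => S.frakT cov ε y (X y) (η y)) x u w
        - S.frakT cov ε x (cov X x u) (η x) w
      = - covForm cov η x u (cov.torsion x (X x) w) - η x (covTorsion cov x u (X x) w) := by
  have hW : SmoothVecNear (fun y => S.horProj y (extendVec w y)) x :=
    S.smooth_horProj (smoothVecNear_extendVec w)
  have hWx : S.horProj x (extendVec w x) = w := by rw [extendVec_self, S.horProj_of_mem hw]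
  have hT := hc.smoothConnection.torsion_vec hX hW
  have hWh := hc.cov_mem_hor hW (Eventually.of_forall fun y => S.horProj_mem _) u
  have h1 := covForm_eval (SmoothNear.mdiff (hc.smooth_frakT ε hX hη)) hW.mdiff u (cov := cov)
  have h2 : (fun y => S.frakT cov ε y (X y) (η y) (S.horProj y (extendVec w y)))
      = fun y => - η y (cov.torsion y (X y) (S.horProj y (extendVec w y))) := by
    funext y
    rw [S.frakT_apply, S.vertLift_horProj, ← JVecL_apply]
    simp
  have h3 := covForm_eval (SmoothNear.mdiff hη) hT.mdiff u (cov := cov)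
  have h4 := covTorsion_eq hc.smoothConnection u hX.mdiff hW.mdiff
  rw [h2, differential_neg, neg_apply, S.frakT_apply, S.vertLift_hor x hWh, ← JVecL_apply,
    map_zero, LinearMap.zero_apply, map_zero, S.horProj_of_mem hWh] at h1
  rw [S.frakT_apply, S.vertLift_hor x hw, S.horProj_of_mem hw, ← JVecL_apply, map_zero,
    LinearMap.zero_apply, map_zero]
  simp only [hWx] at h1 h3 h4
  rw [h1, h3, h4]
  simp only [map_sub]
  ring

/-- On Z, which is parallel, 𝔗_X η is (2ε)⁻¹ η(J_Z X), and the product rule separates ∇η from the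
derivative of J_Z. -/
lemma covForm_frakT_vert (hX : SmoothVecNear X x) (hη : SmoothFormNear η x) (Z : S.vert)
    (u : TangentSpace (𝓡 (d + h)) x) :
    covForm cov (fun y => S.frakT cov ε y (X y) (η y)) x u (Z.1 x)
        - S.frakT cov ε x (cov X x u) (η x) (Z.1 x)
      = 1 / (2 * ε) * (covForm cov η x u (S.JVec cov Z x (X x))
        + η x (cov (fun y => S.JVec cov Z y (X y)) x u - S.JVec cov Z x (cov X x u))) := by
  have hJ := hc.smooth_JVec Z hX
  have hFZ : ∀ y (v : TangentSpace (𝓡 (d + h)) y) (α : TangentSpace (𝓡 (d + h)) y →L[ℝ] ℝ),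
      S.frakT cov ε y v α (Z.1 y) = 1 / (2 * ε) * α (S.JVec cov Z y v) := fun y v α => by
    rw [S.frakT_apply, S.horProj_vert, S.vertLift_vert, map_zero, map_zero, neg_zero, zero_add]
  rw [hc.covForm_vert (hc.smooth_frakT ε hX hη)]
  simp only [hFZ]
  rw [differential_const_mul _ (SmoothNear.form_apply hη hJ).mdiff,
    covForm_eval (SmoothNear.mdiff hη) hJ.mdiff, map_sub, smul_apply, smul_eq_mul]
  ring

/-- J_Z is dual to T through `gH` and ν_Z, both parallel, so ∇J_Z is dual to ∇T. This turns the
Yang-Mills condition into a statement about J (`sum_cov_JVec`). -/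
lemma gH_cov_JVec (hX : SmoothVecNear X x) (hXh : ∀ᶠ y in 𝓝 x, X y ∈ S.hor y) (Z : S.vert)
    (u : TangentSpace (𝓡 (d + h)) x) {w : TangentSpace (𝓡 (d + h)) x} (hw : w ∈ S.hor x) :
    S.gH x (cov (fun y => S.JVec cov Z y (X y)) x u - S.JVec cov Z x (cov X x u)) w
      = S.nu Z x (covTorsion cov x u (X x) w) := by
  have hW : SmoothVecNear (fun y => S.horProj y (extendVec w y)) x :=
    S.smooth_horProj (smoothVecNear_extendVec w)
  have hWx : S.horProj x (extendVec w x) = w := by rw [extendVec_self, S.horProj_of_mem hw]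
  have hT := hc.smoothConnection.torsion_vec hX hW
  have h1 := hc.differential_gH (hc.smooth_JVec Z hX) hW u
  have h2 : ∀ᶠ y in 𝓝 x, S.gH y (S.JVec cov Z y (X y)) (S.horProj y (extendVec w y))
      = S.nu Z y (cov.torsion y (X y) (S.horProj y (extendVec w y))) := by
    filter_upwards [hXh] with y hy using hc.gH_JVec_hor Z hy _
  rw [differential_congr h2, ← hc.nu_cov Z hT u] at h1
  have h4 := covTorsion_eq hc.smoothConnection u hX.mdiff hW.mdiff
  simp only [hWx] at h1 h4
  rw [hc.gH_JVec_hor Z hXh.self_of_nhds] at h1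
  rw [map_sub (S.gH x), sub_apply, hc.gH_JVec_hor Z (hc.cov_mem_hor hX hXh u), h4]
  simp only [map_sub]
  linarith

lemma sum_cov_JVec (hYM : S.IsYangMills cov) {U : Set M} {X : Fin d → VectorField (d + h) M}
    {Z' : Fin h → S.vert} (hf : S.IsAdaptedFrame U X Z') (hx : x ∈ U) (Z : S.vert) :
    ∑ i, (cov (fun y => S.JVec cov Z y (X i y)) x (X i x)
      - S.JVec cov Z x (cov (X i) x (X i x))) = 0 := by
  have hXh : ∀ i, ∀ᶠ y in 𝓝 x, X i y ∈ S.hor y := fun i =>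
    (hf.eventually hx).mono fun y hy => hy.1 i
  refine S.hor_ext (Submodule.sum_mem _ fun i _ => Submodule.sub_mem _ ?_ (S.JVec_mem cov Z _))
    (Submodule.zero_mem _) fun w hw => ?_
  · exact hc.cov_mem_hor (hc.smooth_JVec Z (hf.smoothVecNear hx i))
      (Eventually.of_forall fun y => S.JVec_mem cov Z _) _
  · rw [map_sum, FunLike.coe_sum, Finset.sum_apply]
    simp only [hc.gH_cov_JVec (hf.smoothVecNear hx _) (hXh _) Z _ hw]
    rw [← map_sum, hYM.sum_eq_zero hc.smoothConnection (hf.horizontal x hx) hw]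
    simp

lemma subLaplacianForm_eq (hη : SmoothFormNear η x) {e : Fin d → TangentSpace (𝓡 (d + h)) x}
    (he : S.IsHorOrthonormal x e) :
    S.subLaplacianForm cov η x = ∑ i, secondCovForm cov η x (e i) (e i) :=
  (S.isHorOrthonormal_horBasis x).sum_bilin_eq he
    (LinearMap.mk₂ ℝ (fun u v => secondCovForm cov η x u v) (secondCovForm_add_left η)
      (secondCovForm_smul_left η) (secondCovForm_add_right hc.smoothConnection hη)
      (secondCovForm_smul_right hc.smoothConnection hη))

/-- The horizontal trace of a one-form contracted with the torsion. -/
lemma sum_torsion {e : Fin d → TangentSpace (𝓡 (d + h)) x} (he : S.IsHorOrthonormal x e)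
    {Z : Fin h → S.vert} (hZ : S.IsVertOrthonormal Z)
    (φ : Fin d → TangentSpace (𝓡 (d + h)) x →L[ℝ] ℝ) {w : TangentSpace (𝓡 (d + h)) x}
    (ψ : Fin h → TangentSpace (𝓡 (d + h)) x →ₗ[ℝ] ℝ)
    (hφ : ∀ i m, φ i ((Z m).1 x) = ψ m (e i)) (hw : w ∈ S.hor x) :
    ∑ i, φ i (cov.torsion x (e i) w) = - ∑ m, ψ m (S.JVec cov (Z m) x w) := by
  -- The trace is over the first argument of the torsion, while J_Z `w` expands with `w` first;
  -- antisymmetry accounts for the sign.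
  have h1 : ∀ m, S.JVec cov (Z m) x w = ∑ i, (- S.nu (Z m) x (cov.torsion x (e i) w)) • e i := by
    intro m
    rw [he.JVec_eq cov (Z m) hw]
    refine Finset.sum_congr rfl fun i _ => ?_
    rw [cov.torsion_antisymm, map_neg]
  simp only [h1, map_sum, map_smul, neg_smul, map_neg, Finset.sum_neg_distrib, neg_neg]
  rw [Finset.sum_comm]
  refine Finset.sum_congr rfl fun i _ => ?_
  conv_lhs => rw [hc.torsion_eq_sum hZ]
  simp only [map_sum, map_smul, hφ]

omit hc in
lemma torsionDual_hor (om : TangentSpace (𝓡 (d + h)) x → TangentSpace (𝓡 (d + h)) x → ℝ)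
    {w : TangentSpace (𝓡 (d + h)) x} (hw : w ∈ S.hor x) : S.torsionDual cov x om w = 0 := by
  have : ∀ u, S.flatVer x u w = 0 := fun u => S.nu_hor _ hw
  simp [torsionDual, this]

-- The factor 1/2 in `torsionDual` corrects the double sum over i, j. The antisymmetrized ∇η, paired
-- with the antisymmetric T, doubles and absorbs this factor; the η ∘ T part of dη keeps it.
omit hc in
lemma torsionDual_extDeriv_vert (hη : SmoothFormNear η x)
    {e : Fin d → TangentSpace (𝓡 (d + h)) x} (he : S.IsHorOrthonormal x e) (Z : S.vert) :
    S.torsionDual cov x (extDeriv η x) (Z.1 x)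
      = ∑ i, (covForm cov η x (e i) (S.JVec cov Z x (e i))
        + 1 / 2 * η x (cov.torsion x (e i) (S.JVec cov Z x (e i)))) := by
  have hb := S.isHorOrthonormal_horBasis x
  have h0 := hb.sum_bilin_eq he (LinearMap.mk₂ ℝ
    (fun u v => covForm cov η x u (S.JVec cov Z x v) + 1 / 2 * η x (cov.torsion x u (S.JVec cov Z x v)))
    (by intros; simp only [covForm_add_dir, map_add, add_apply]; ring)
    (by intros; simp only [covForm_smul_dir, map_smul, smul_apply, smul_eq_mul]; ring)
    (by intros; simp only [S.JVec_add, map_add]; ring)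
    (by intros; simp only [S.JVec_smul, map_smul, smul_eq_mul]; ring))
  simp only [LinearMap.mk₂_apply] at h0
  rw [← h0]
  have hfl : ∀ u, S.flatVer x u (Z.1 x) = S.nu Z x u := fun u => by
    rw [nu_apply, S.gV_symm]
    change S.gV (S.vertLift x u) (S.vertLift x (Z.1 x)) = _
    rw [S.vertLift_vert]
  have hJ : ∀ i, S.JVec cov Z x (S.horBasis x i)
      = ∑ j, S.nu Z x (cov.torsion x (S.horBasis x i) (S.horBasis x j)) • S.horBasis x j :=
    fun i => hb.JVec_eq cov Z (hb.1 i)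
  simp only [torsionDual, smul_apply, FunLike.coe_sum, Finset.sum_apply, hfl, smul_eq_mul,
    extDeriv_eq (cov := cov) (SmoothNear.mdiff hη), add_mul, sub_mul, Finset.sum_add_distrib,
    Finset.sum_sub_distrib]
  have h1 : ∑ i, ∑ j, covForm cov η x (S.horBasis x j) (S.horBasis x i)
        * S.nu Z x (cov.torsion x (S.horBasis x i) (S.horBasis x j))
      = - ∑ i, ∑ j, covForm cov η x (S.horBasis x i) (S.horBasis x j)
        * S.nu Z x (cov.torsion x (S.horBasis x i) (S.horBasis x j)) := by
    rw [Finset.sum_comm, ← Finset.sum_neg_distrib]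
    refine Finset.sum_congr rfl fun i _ => ?_
    rw [← Finset.sum_neg_distrib]
    refine Finset.sum_congr rfl fun j _ => ?_
    rw [cov.torsion_antisymm, map_neg, mul_neg]
  rw [h1]
  simp only [hJ, map_sum, map_smul, smul_eq_mul, ← Finset.mul_sum]
  simp only [mul_comm (S.nu Z x _)]
  ring

/-- Rewriting d(η(Z)) as (∇η)(Z) makes the sum the trace of a bilinear map on `vert`, so it is the
same for all orthonormal bases. -/
lemma opJ_apply (hη : SmoothFormNear η x) {Z : Fin h → S.vert} (hZ : S.IsVertOrthonormal Z)
    (w : TangentSpace (𝓡 (d + h)) x) :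
    S.opJ cov η x w
      = - ∑ m, differential (n := d + h) (fun y => η y ((Z m).1 y)) x (S.JVec cov (Z m) x w) := by
  simp only [opJ, FunLike.coe_sum, Finset.sum_apply, S.JForm_apply, Finset.sum_neg_distrib,
    ← hc.covForm_vert hη]
  exact congrArg Neg.neg (S.isVertOrthonormal_vertBasis.sum_bilin_eq hZ (LinearMap.mk₂ ℝ
    (fun Z W : S.vert => covForm cov η x (S.JVec cov W x w) (Z.1 x))
    (by intros; simp) (by intros; simp)
    (by intros; simp only [S.JVec_add_vert, covForm_add_dir, add_apply])
    (by intros; simp only [S.JVec_smul_vert, covForm_smul_dir, smul_apply])))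

theorem box_eq_sum_of_squares (hYM : S.IsYangMills cov) {U : Set M}
    {X : Fin d → VectorField (d + h) M} {Z : Fin h → S.vert} (hf : S.IsAdaptedFrame U X Z)
    (hη : SmoothFormNear η x) (hx : x ∈ U) :
    S.box cov ε η x =
      ∑ i, (S.twistedAlong cov ε (X i) (S.twistedAlong cov ε (X i) η) x
        - S.twisted cov ε η x (cov (X i) x (X i x)))
      + (1 / (2 * ε)) • S.sumJStarJ cov Z x (η x) - S.ricHor cov x (η x) := by
  have he := hf.horizontal x hx
  have hX := fun i => hf.smoothVecNear hx i
  have hZ := hf.vertical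
  simp only [hc.twisted_twistedAlong (hX _) hη]
  rw [box, boxInfty, hc.subLaplacianForm_eq hη he]
  ext w
  -- The two components carry different identities: on `w` the exterior derivative term is absent,
  -- on `W` the J*J and `opJ` terms are.
  obtain ⟨w, hw, W, rfl⟩ := S.exists_hor_add_ver w
  rw [map_add, map_add]
  congr 1
  · have h1 : ∀ i, S.frakT cov ε x (X i x) (covForm cov η x (X i x)) w
        = - covForm cov η x (X i x) (cov.torsion x (X i x) w) := fun i => by
      rw [S.frakT_apply, S.vertLift_hor x hw, S.horProj_of_mem hw, ← JVecL_apply]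
      simp
    have h2 : ∀ i, S.frakT cov ε x (X i x) (S.frakT cov ε x (X i x) (η x)) w
        = - S.frakT cov ε x (X i x) (η x) (cov.torsion x (X i x) w) := fun i => by
      rw [S.frakT_apply, S.vertLift_hor x hw, S.horProj_of_mem hw, ← JVecL_apply]
      simp
    -- The first-order term: (∇_{X_i} η)(T(X_i, w)) only sees η(Z_m), which yields the operator
    -- `opJ`.
    have h3 := hc.sum_torsion he hZ (fun i => covForm cov η x (X i x))
      (fun m => (differential (n := d + h) (fun y => η y ((Z m).1 y)) x).toLinearMap)
      (fun i m => hc.covForm_vert hη (Z m) _) hw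
    -- The zeroth-order term: applying 𝔗 twice on `w` produces (2ε)⁻¹ ∑ η(J² w), the negative of the
    -- explicit J*J term.
    have h4 := hc.sum_torsion he hZ (fun i => S.frakT cov ε x (X i x) (η x))
      (fun m => (1 / (2 * ε)) • (η x).toLinearMap ∘ₗ S.JVecL cov x (Z m))
      (fun i m => by
        rw [S.frakT_apply, S.horProj_vert, S.vertLift_vert]
        simp [JVecL_apply]) hw
    have h5 := hc.opJ_apply hη hZ w
    have h6 := congrArg (η x) (hYM.sum_eq_zero hc.smoothConnection he hw)
    simp only [map_sum, map_zero] at h6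
    have h7 := fun i => hc.covForm_frakT_hor (hX i) hη hw (X i x) (ε := ε)
    simp only [sub_apply, add_apply, smul_apply, smul_eq_mul, FunLike.coe_sum, Finset.sum_apply,
      torsionDual_hor _ hw, Finset.sum_add_distrib, Finset.sum_sub_distrib, h1, h2, h5,
      S.sumJStarJ_apply, Finset.sum_neg_distrib]
    have h8 := Finset.sum_congr rfl fun (i : Fin d) (_ : i ∈ Finset.univ) => h7 i
    simp only [Finset.sum_sub_distrib, Finset.sum_neg_distrib, h6] at h8
    rw [h8, h3, h4]
    simp only [LinearMap.smul_apply, LinearMap.comp_apply, JVecL_apply, ContinuousLinearMap.coe_coe,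
      smul_eq_mul, ← Finset.mul_sum]
    ring
  · have hFZ : ∀ (v : TangentSpace (𝓡 (d + h)) x) (α : TangentSpace (𝓡 (d + h)) x →L[ℝ] ℝ),
        S.frakT cov ε x v α (W.1 x) = 1 / (2 * ε) * α (S.JVec cov W x v) := fun v α => by
      rw [S.frakT_apply, S.horProj_vert, S.vertLift_vert, map_zero, map_zero, neg_zero, zero_add]
    -- J_W X_i is horizontal, so the inner 𝔗 contributes only its torsion part; this is the η ∘ T
    -- term of -ε⁻¹ T(dη).
    have h2 : ∀ i, S.frakT cov ε x (X i x) (S.frakT cov ε x (X i x) (η x)) (W.1 x)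
        = - (1 / (2 * ε) * η x (cov.torsion x (X i x) (S.JVec cov W x (X i x)))) := fun i => by
      rw [hFZ, S.frakT_apply, S.vertLift_hor x (S.JVec_mem cov W _),
        S.horProj_of_mem (S.JVec_mem cov W _), ← S.JVecL_apply cov 0]
      simp
    have h3 : ∀ m, S.JVec cov m x (W.1 x) = 0 := fun m => S.JVec_vert cov m W
    have h4 : S.opJ cov η x (W.1 x) = 0 := by
      rw [hc.opJ_apply hη hZ]
      simp [h3]
    have h5 : S.sumJStarJ cov Z x (η x) (W.1 x) = 0 := by
      rw [S.sumJStarJ_apply]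
      simp [h3, ← JVecL_apply]
    have h6 := congrArg (η x) (hc.sum_cov_JVec hYM hf hx W)
    simp only [map_sum, map_zero] at h6
    have h7 := fun i => hc.covForm_frakT_vert (hX i) hη W (X i x) (ε := ε)
    simp only [sub_apply, add_apply, smul_apply, smul_eq_mul, FunLike.coe_sum, Finset.sum_apply,
      torsionDual_extDeriv_vert hη he, Finset.sum_add_distrib, Finset.sum_sub_distrib, h2, h4, h5,
      Finset.sum_neg_distrib, ← Finset.mul_sum]
    have h8 := Finset.sum_congr rfl fun (i : Fin d) (_ : i ∈ Finset.univ) => h7 i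
    simp only [Finset.sum_sub_distrib, Finset.sum_add_distrib, h6, ← Finset.mul_sum] at h8
    rw [h8]
    simp only [hFZ, ← Finset.mul_sum]
    field_simp
    ring

end IsCanonicalConnection

end TransverseStructure
end TransverseSR

/-! ### Metric compatibility on one-forms and the Bochner identity -/

namespace TransverseSR
namespace TransverseStructure

variable {d h : ℕ} {M : Type*} [TopologicalSpace M]
  [ChartedSpace (EuclideanSpace ℝ (Fin (d + h))) M] [IsManifold (𝓡 (d + h)) ∞ M]
  {S : TransverseStructure d h M} {cov : Connection (d + h) M} {x : M}

lemma smooth_cometric (ε : ℝ) {η ξ : OneForm (d + h) M} (hη : SmoothFormNear η x)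
    (hξ : SmoothFormNear ξ x) :
    SmoothFunNear (n := d + h) (fun y => S.cometric ε y (η y) (ξ y)) x := by
  obtain ⟨U, X, hx, hf⟩ := S.exists_adaptedFrame x
  have h1 : SmoothFunNear (n := d + h) (fun y => ∑ i, η y (X i y) * ξ y (X i y)
      + ε * ∑ m, η y ((S.vertBasis m).1 y) * ξ y ((S.vertBasis m).1 y)) x :=
    (SmoothFunNear.sum fun i _ => (SmoothNear.form_apply hη (hf.smoothVecNear hx i)).mul
      (SmoothNear.form_apply hξ (hf.smoothVecNear hx i))).add ((SmoothFunNear.const _).mul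
      (.sum fun m _ => (SmoothNear.form_apply hη (S.smooth_vert _)).mul
      (SmoothNear.form_apply hξ (S.smooth_vert _))))
  refine h1.congr ?_
  filter_upwards [hf.eventually hx] with y hy using
    hy.cometric_eq S.isVertOrthonormal_vertBasis ε _ _

lemma twisted_add_dir (ε : ℝ) (η : OneForm (d + h) M) (u v : TangentSpace (𝓡 (d + h)) x) :
    S.twisted cov ε η x (u + v) = S.twisted cov ε η x u + S.twisted cov ε η x v := by
  simp only [twisted, covForm_add_dir, ← frakTL_apply, map_add, LinearMap.add_apply]
  abel

lemma twisted_smul_dir (ε : ℝ) (η : OneForm (d + h) M) (c : ℝ) (u : TangentSpace (𝓡 (d + h)) x) :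
    S.twisted cov ε η x (c • u) = c • S.twisted cov ε η x u := by
  simp only [twisted, covForm_smul_dir, ← frakTL_apply, map_smul, LinearMap.smul_apply, smul_sub]

namespace IsCanonicalConnection

variable (hc : S.IsCanonicalConnection cov) {ε : ℝ} {X : VectorField (d + h) M}
  {η ξ : OneForm (d + h) M}
include hc

/-- The canonical connection is compatible with the inner products on one-forms. -/
lemma differential_cometric (hη : SmoothFormNear η x) (hξ : SmoothFormNear ξ x)
    (u : TangentSpace (𝓡 (d + h)) x) :
    differential (n := d + h) (fun y => S.cometric ε y (η y) (ξ y)) x u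
      = S.cometric ε x (covForm cov η x u) (ξ x) + S.cometric ε x (η x) (covForm cov ξ x u) := by
  obtain ⟨U, X, hx, hf⟩ := S.exists_adaptedFrame x
  have he := hf.horizontal x hx
  have hX := fun i => hf.smoothVecNear hx i
  have hv := S.isVertOrthonormal_vertBasis
  have s1 : ∀ i, SmoothFunNear (n := d + h) (fun y => η y (X i y) * ξ y (X i y)) x := fun i =>
    (SmoothNear.form_apply hη (hX i)).mul (SmoothNear.form_apply hξ (hX i))
  have s2 : ∀ m, SmoothFunNear (n := d + h)
      (fun y => η y ((S.vertBasis m).1 y) * ξ y ((S.vertBasis m).1 y)) x := fun m =>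
    (SmoothNear.form_apply hη (S.smooth_vert _)).mul (SmoothNear.form_apply hξ (S.smooth_vert _))
  have s3 : SmoothFunNear (n := d + h)
      (fun y => ∑ i, η y (X i y) * ξ y (X i y)) x := .sum fun i _ => s1 i
  have s4 : SmoothFunNear (n := d + h) (fun y => ∑ m, η y ((S.vertBasis m).1 y)
      * ξ y ((S.vertBasis m).1 y)) x := .sum fun m _ => s2 m
  have s5 : SmoothFunNear (n := d + h) (fun y => ε * ∑ m, η y ((S.vertBasis m).1 y)
      * ξ y ((S.vertBasis m).1 y)) x := (SmoothFunNear.const _).mul s4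
  rw [differential_congr ((hf.eventually hx).mono fun y hy => hy.cometric_eq hv ε (η y) (ξ y)),
    differential_add s3.mdiff s5.mdiff, differential_const_mul _ s4.mdiff,
    differential_sum fun i _ => (s1 i).mdiff, differential_sum fun i _ => (s2 i).mdiff,
    he.cometric_eq hv, he.cometric_eq hv]
  have hd : ∀ {ζ : OneForm (d + h) M}, SmoothFormNear ζ x → ∀ i,
      differential (n := d + h) (fun y => ζ y (X i y)) x u
        = covForm cov ζ x u (X i x) + ζ x (cov (X i) x u) := fun hζ i => by
    rw [covForm_eval (SmoothNear.mdiff hζ) (hX i).mdiff]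
    ring
  have hd' : ∀ {ζ : OneForm (d + h) M}, SmoothFormNear ζ x → ∀ m,
      differential (n := d + h) (fun y => ζ y ((S.vertBasis m).1 y)) x u
        = covForm cov ζ x u ((S.vertBasis m).1 x) := fun hζ m => (hc.covForm_vert hζ _ u).symm
  have e1 : ∀ i, differential (n := d + h) (fun y => η y (X i y) * ξ y (X i y)) x u
      = η x (X i x) * (covForm cov ξ x u (X i x) + ξ x (cov (X i) x u))
        + ξ x (X i x) * (covForm cov η x u (X i x) + η x (cov (X i) x u)) := fun i => by
    rw [differential_mul (SmoothNear.form_apply hη (hX i)).mdiff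
      (SmoothNear.form_apply hξ (hX i)).mdiff]
    simp only [add_apply, smul_apply, smul_eq_mul, hd hη, hd hξ]
  have e2 : ∀ m, differential (n := d + h)
      (fun y => η y ((S.vertBasis m).1 y) * ξ y ((S.vertBasis m).1 y)) x u
      = η x ((S.vertBasis m).1 x) * covForm cov ξ x u ((S.vertBasis m).1 x)
        + ξ x ((S.vertBasis m).1 x) * covForm cov η x u ((S.vertBasis m).1 x) := fun m => by
    rw [differential_mul (SmoothNear.form_apply hη (S.smooth_vert _)).mdiff
      (SmoothNear.form_apply hξ (S.smooth_vert _)).mdiff]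
    simp only [add_apply, smul_apply, smul_eq_mul, hd' hη, hd' hξ]
  have hexp : ∀ i, cov (X i) x u = ∑ j, S.gH x (X j x) (cov (X i) x u) • X j x := fun i =>
    (he.sum_eq (hc.cov_mem_hor (hX i) ((hf.eventually hx).mono fun y hy => hy.1 i) u)).symm
  -- Differentiating the constant gH(X_i, X_j): the connection coefficients of an orthonormal frame
  -- are skew, so the cross terms cancel in `hcross`.
  have hskew : ∀ i j, S.gH x (X j x) (cov (X i) x u) = - S.gH x (X i x) (cov (X j) x u) := by
    intro i j
    have h1 := hc.differential_gH (hX i) (hX j) u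
    rw [differential_congr (g := fun _ => if i = j then 1 else 0)
      ((hf.eventually hx).mono fun y hy => hy.2 i j), differential_const, zero_apply,
      S.gH_symm x (cov (X i) x u)] at h1
    linarith
  have hcross : ∑ i, (η x (X i x) * ξ x (cov (X i) x u) + ξ x (X i x) * η x (cov (X i) x u)) = 0 := by
    have h1 : ∑ i, η x (X i x) * ξ x (cov (X i) x u)
        = - ∑ i, ξ x (X i x) * η x (cov (X i) x u) := by
      have k1 : ∀ i, ξ x (cov (X i) x u)
          = ∑ j, S.gH x (X j x) (cov (X i) x u) * ξ x (X j x) := fun i => by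
        conv_lhs => rw [hexp i]
        simp
      have k2 : ∀ i, η x (cov (X i) x u)
          = ∑ j, S.gH x (X j x) (cov (X i) x u) * η x (X j x) := fun i => by
        conv_lhs => rw [hexp i]
        simp
      simp only [k1, k2, Finset.mul_sum, ← Finset.sum_neg_distrib]
      rw [Finset.sum_comm]
      refine Finset.sum_congr rfl fun i _ => Finset.sum_congr rfl fun j _ => ?_
      rw [hskew j i]
      ring
    rw [Finset.sum_add_distrib, h1, neg_add_cancel]
  simp only [add_apply, smul_apply, FunLike.coe_sum, Finset.sum_apply, e1, e2, smul_eq_mul]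
  have e3 : ∑ i, (η x (X i x) * (covForm cov ξ x u (X i x) + ξ x (cov (X i) x u))
      + ξ x (X i x) * (covForm cov η x u (X i x) + η x (cov (X i) x u)))
      = ∑ i, covForm cov η x u (X i x) * ξ x (X i x) + ∑ i, η x (X i x) * covForm cov ξ x u (X i x)
        + ∑ i, (η x (X i x) * ξ x (cov (X i) x u) + ξ x (X i x) * η x (cov (X i) x u)) := by
    simp only [← Finset.sum_add_distrib]
    exact Finset.sum_congr rfl fun i _ => by ring
  rw [e3, hcross, Finset.sum_add_distrib]
  simp only [mul_comm (ξ x _)]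
  ring

/-- The map `𝔗^ε_v` is skew-symmetric for `g_{2ε}`. -/
lemma cometric_frakT (hε : ε ≠ 0) {v : TangentSpace (𝓡 (d + h)) x} (hv : v ∈ S.hor x)
    (α β : TangentSpace (𝓡 (d + h)) x →L[ℝ] ℝ) :
    S.cometric (2 * ε) x (S.frakT cov ε x v α) β
      = - S.cometric (2 * ε) x α (S.frakT cov ε x v β) := by
  -- The weight 2ε of the vertical directions cancels the factor 1/(2ε) in 𝔗, and the torsion part
  -- is rewritten through J. The result is visibly antisymmetric in α and β.
  have key : ∀ α β : TangentSpace (𝓡 (d + h)) x →L[ℝ] ℝ,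
      S.cometric (2 * ε) x (S.frakT cov ε x v α) β
        = ∑ m, α (S.JVec cov (S.vertBasis m) x v) * β ((S.vertBasis m).1 x)
          - ∑ m, β (S.JVec cov (S.vertBasis m) x v) * α ((S.vertBasis m).1 x) := by
    intro α β
    have he := S.isHorOrthonormal_horBasis x
    have h1 : ∀ i, S.frakT cov ε x v α (S.horBasis x i)
        = - α (cov.torsion x v (S.horBasis x i)) := fun i => by
      rw [S.frakT_apply, S.vertLift_hor x (he.1 i), S.horProj_of_mem (he.1 i), ← JVecL_apply]
      simp
    have h2 : ∀ m, S.frakT cov ε x v α ((S.vertBasis m).1 x)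
        = 1 / (2 * ε) * α (S.JVec cov (S.vertBasis m) x v) := fun m => by
      rw [S.frakT_apply, S.horProj_vert, S.vertLift_vert, map_zero, map_zero, neg_zero, zero_add]
    have h3 : ∑ i, α (cov.torsion x v (S.horBasis x i)) * β (S.horBasis x i)
        = ∑ m, β (S.JVec cov (S.vertBasis m) x v) * α ((S.vertBasis m).1 x) := by
      simp only [he.JVec_eq cov _ hv, map_sum, map_smul, smul_eq_mul, Finset.sum_mul]
      rw [Finset.sum_comm]
      refine Finset.sum_congr rfl fun i _ => ?_
      conv_lhs => rw [hc.torsion_eq_sum S.isVertOrthonormal_vertBasis]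
      simp only [map_sum, map_smul, smul_eq_mul, Finset.sum_mul]
      exact Finset.sum_congr rfl fun m _ => by ring
    simp only [cometric, coHor, h1, h2, neg_mul, Finset.sum_neg_distrib, h3, mul_assoc,
      ← Finset.mul_sum]
    field_simp
    ring
  rw [S.cometric_symm _ α, key, key]
  ring

/-- The two 𝔗 terms cancel by skewness, so ∇ - 𝔗 is also metric. It serves both the Bochner identity
and the formal adjoint. -/
lemma differential_cometric_twisted (hε : ε ≠ 0) (hη : SmoothFormNear η x)
    (hξ : SmoothFormNear ξ x) {v : TangentSpace (𝓡 (d + h)) x} (hv : v ∈ S.hor x) :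
    differential (n := d + h) (fun y => S.cometric (2 * ε) y (η y) (ξ y)) x v
      = S.cometric (2 * ε) x (S.twisted cov ε η x v) (ξ x)
        + S.cometric (2 * ε) x (η x) (S.twisted cov ε ξ x v) := by
  have h1 := hc.cometric_frakT hε hv (η x) (ξ x)
  rw [hc.differential_cometric hη hξ, twisted, twisted]
  simp only [← cometricL_apply, map_sub, LinearMap.sub_apply] at h1 ⊢
  rw [h1]
  ring

omit hc in
lemma subLaplacian_eq {f : M → ℝ} (hf : SmoothFunNear (n := d + h) f x) {U : Set M}
    {X : Fin d → VectorField (d + h) M} {Z : Fin h → S.vert} (hX : S.IsAdaptedFrame U X Z)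
    (hx : x ∈ U) :
    S.subLaplacian cov f x = ∑ i, (differential (n := d + h)
        (fun y => differential (n := d + h) f y (X i y)) x (X i x)
      - differential (n := d + h) f x (cov (X i) x (X i x))) := by
  have h1 := (S.isHorOrthonormal_horBasis x).sum_bilin_eq (hX.horizontal x hx)
    (LinearMap.mk₂ ℝ (fun u v => covForm cov (differential f) x u v)
      (by intros; simp only [covForm_add_dir, add_apply])
      (by intros; simp only [covForm_smul_dir, smul_apply])
      (by intros; simp) (by intros; simp))
  simp only [LinearMap.mk₂_apply] at h1
  rw [subLaplacian, h1]
  exact Finset.sum_congr rfl fun i _ =>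
    covForm_eval (SmoothNear.mdiff hf.differential) (hX.smoothVecNear hx i).mdiff _

theorem bochner (hYM : S.IsYangMills cov) (hε : ε ≠ 0) (hη : SmoothFormNear η x)
    {e : Fin d → TangentSpace (𝓡 (d + h)) x} (he : S.IsHorOrthonormal x e) :
    (1 / 2) * S.subLaplacian cov (fun y => S.cometric (2 * ε) y (η y) (η y)) x
        - S.cometric (2 * ε) x (S.box cov ε η x) (η x)
      = ∑ i, S.cometric (2 * ε) x (S.twisted cov ε η x (e i)) (S.twisted cov ε η x (e i))
        + S.cometric (2 * ε) x
            (S.ricHor cov x (η x) - (1 / (2 * ε)) • S.JStarJ cov x (η x)) (η x) := by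
  obtain ⟨U, X, hx, hf⟩ := S.exists_adaptedFrame x
  have hX := fun i => hf.smoothVecNear hx i
  have hX' := hf.horizontal x hx
  have h1 := he.sum_bilin_eq hX' (LinearMap.mk₂ ℝ (fun u v =>
    S.cometricL (2 * ε) x (S.twisted cov ε η x u) (S.twisted cov ε η x v))
      (by intros; simp only [twisted_add_dir, map_add, LinearMap.add_apply])
      (by intros; simp only [twisted_smul_dir, map_smul, LinearMap.smul_apply])
      (by intros; simp only [twisted_add_dir, map_add])
      (by intros; simp only [twisted_smul_dir, map_smul]))
  simp only [LinearMap.mk₂_apply, cometricL_apply] at h1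
  have hD := fun i => hc.smooth_twistedAlong ε (hX i) hη
  -- The metric rule applied twice: with D = ∇_{X_i} - 𝔗_{X_i}, X_i² ‖η‖² = 2⟨D²η, η⟩ + 2‖Dη‖².
  have h2 : ∀ i, differential (n := d + h) (fun y => differential (n := d + h)
        (fun y => S.cometric (2 * ε) y (η y) (η y)) y (X i y)) x (X i x)
      = 2 * S.cometric (2 * ε) x (S.twistedAlong cov ε (X i) (S.twistedAlong cov ε (X i) η) x) (η x)
        + 2 * S.cometric (2 * ε) x (S.twisted cov ε η x (X i x)) (S.twisted cov ε η x (X i x)) := by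
    intro i
    have k1 : ∀ᶠ y in 𝓝 x, differential (n := d + h)
        (fun y => S.cometric (2 * ε) y (η y) (η y)) y (X i y)
        = 2 * S.cometric (2 * ε) y (S.twistedAlong cov ε (X i) η y) (η y) := by
      filter_upwards [hf.eventually hx, hη.eventually] with y hy hηy
      rw [hc.differential_cometric_twisted hε hηy hηy (hy.1 i), S.cometric_symm _ (η y)]
      simp only [twistedAlong]
      ring
    rw [differential_congr k1, differential_const_mul _ (smooth_cometric _ (hD i) hη).mdiff,
      smul_apply, hc.differential_cometric_twisted hε (hD i) hη (hX'.1 i)]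
    simp only [twistedAlong, smul_eq_mul]
    ring
  -- The rule applies in the direction ∇_{X_i} X_i because that vector is horizontal.
  have h3 : ∀ i, differential (n := d + h) (fun y => S.cometric (2 * ε) y (η y) (η y)) x
      (cov (X i) x (X i x))
      = 2 * S.cometric (2 * ε) x (S.twisted cov ε η x (cov (X i) x (X i x))) (η x) := fun i => by
    rw [hc.differential_cometric_twisted hε hη hη (hc.cov_mem_hor (hX i)
      ((hf.eventually hx).mono fun y hy => hy.1 i) _), S.cometric_symm _ (η x)]
    ring
  rw [h1, subLaplacian_eq (smooth_cometric _ hη hη) hf hx, hc.box_eq_sum_of_squares hYM hf hη hx]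
  simp only [h2, h3]
  simp only [← cometricL_apply, JStarJ, map_sub, map_add, map_sum, LinearMap.add_apply,
    LinearMap.sub_apply, LinearMap.sum_apply, Finset.sum_add_distrib, Finset.sum_sub_distrib,
    ← Finset.mul_sum]
  ring

end IsCanonicalConnection

end TransverseStructure
end TransverseSR

/-! ### Coordinate vector fields -/

namespace TransverseSR

section Coordinates

variable {n : ℕ} {M : Type*} [TopologicalSpace M] [ChartedSpace (EuclideanSpace ℝ (Fin n)) M]
  [IsManifold (𝓡 n) ∞ M]

/-- The vector field with constant components `v` in the preferred chart at `x`. -/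
def coordVec (x : M) (v : EuclideanSpace ℝ (Fin n)) : VectorField n M := fun p =>
  (trivializationAt (EuclideanSpace ℝ (Fin n)) (fun x : M => TangentSpace (𝓡 n) x) x).symmL ℝ p v

/-- The components of a tangent vector in the preferred chart at `x`. -/
def coordRep (x p : M) : TangentSpace (𝓡 n) p →L[ℝ] EuclideanSpace ℝ (Fin n) :=
  (trivializationAt (EuclideanSpace ℝ (Fin n))
    (fun x : M => TangentSpace (𝓡 n) x) x).continuousLinearMapAt ℝ p

/-- A constant vector field. -/
def constVec (w : EuclideanSpace ℝ (Fin n)) : VectorField n (EuclideanSpace ℝ (Fin n)) := fun _ => w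

variable {x p : M} (hp : p ∈ (chartAt (EuclideanSpace ℝ (Fin n)) x).source)
include hp

lemma coordVec_coordRep (u : TangentSpace (𝓡 n) p) : coordVec x (coordRep x p u) p = u :=
  Trivialization.symmL_continuousLinearMapAt _ (by simpa using hp) u

lemma coordRep_coordVec (v : EuclideanSpace ℝ (Fin n)) : coordRep x p (coordVec x v p) = v :=
  Trivialization.continuousLinearMapAt_symmL _ (by simpa using hp) v

lemma smooth_coordVec (v : EuclideanSpace ℝ (Fin n)) : SmoothVecNear (coordVec x v) p := by
  let t := trivializationAt (EuclideanSpace ℝ (Fin n)) (fun x : M => TangentSpace (𝓡 n) x) x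
  have hp' : p ∈ t.baseSet := by simpa [t] using hp
  filter_upwards [t.open_baseSet.mem_nhds hp'] with y hy
  rw [t.contMDiffAt_section_iff hy]
  refine (contMDiffAt_const (c := v)).congr_of_eventuallyEq ?_
  filter_upwards [t.open_baseSet.mem_nhds hy] with z hz
  have h1 : t ⟨z, t.symmL ℝ z v⟩ = (z, v) := by
    rw [t.symmL_apply hz, t.apply_mk_symm hz]
  exact congrArg Prod.snd h1

lemma coordVec_eq_mfderiv (v : EuclideanSpace ℝ (Fin n)) :
    coordVec x v p = mfderiv (𝓡 n) (𝓡 n) (chartAt (EuclideanSpace ℝ (Fin n)) x).symm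
      (chartAt (EuclideanSpace ℝ (Fin n)) x p) v := by
  have h := TangentBundle.symmL_trivializationAt (I := 𝓡 n) hp
  rw [coordVec, h]
  simp [mfderivWithin_univ]
  rfl

omit hp in
lemma diff_constVec (w y : EuclideanSpace ℝ (Fin n)) : DiffVecAt (constVec w) y := by
  have h1 := (smooth_coordVec (x := y) (p := y) (mem_chart_source _ y) w).mdiff
  refine DiffVecAt.congr h1 (Eventually.of_forall fun z => ?_)
  rw [coordVec, TangentBundle.symmL_model_space]
  rfl

/-- Coordinate fields are pullbacks of constant fields by the chart, and pullback commutes with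
brackets. -/
lemma mlieBracket_coordVec (v w : EuclideanSpace ℝ (Fin n)) :
    VectorField.mlieBracket (𝓡 n) (coordVec x v) (coordVec x w) p = 0 := by
  have : IsManifold (𝓡 n) (minSmoothness ℝ 2) M := by
    rw [minSmoothness_of_isRCLikeNormedField]; infer_instance
  have : IsManifold (𝓡 n) (minSmoothness ℝ 2 + 1) M := by
    rw [minSmoothness_of_isRCLikeNormedField]
    exact IsManifold.of_le (n := ∞) (by norm_num; exact WithTop.coe_le_coe.2 (le_top : (3 : ℕ∞) ≤ ⊤))
  have key : ∀ w : EuclideanSpace ℝ (Fin n), ∀ᶠ q in 𝓝 p, coordVec x w q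
      = VectorField.mpullback (𝓡 n) (𝓡 n) (extChartAt (𝓡 n) x)
        (constVec w) q := by
    intro w
    filter_upwards [(chartAt (EuclideanSpace ℝ (Fin n)) x).open_source.mem_nhds hp] with q hq
    rw [VectorField.mpullback_apply,
      ← TangentBundle.continuousLinearMapAt_trivializationAt (I := 𝓡 n) hq]
    have h1 : (coordRep x q).inverse = (trivializationAt (EuclideanSpace ℝ (Fin n))
        (fun x : M => TangentSpace (𝓡 n) x) x).symmL ℝ q := by
      refine ContinuousLinearMap.inverse_eq ?_ ?_
      · ext1 v; exact coordRep_coordVec hq v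
      · ext1 v; exact coordVec_coordRep hq v
    exact (congrArg (fun L => L w) h1).symm
  have hd := fun w : EuclideanSpace ℝ (Fin n) => diff_constVec w (extChartAt (𝓡 n) x p)
  rw [Filter.EventuallyEq.mlieBracket_vectorField_eq (key v) (key w),
    ← VectorField.mpullback_mlieBracket (n := minSmoothness ℝ 2) (hd v) (hd w) ?_ le_rfl,
    VectorField.mpullback_apply]
  · have h0 : VectorField.mlieBracket (𝓡 n) (constVec v) (constVec w)
        (extChartAt (𝓡 n) x p) = 0 := by
      rw [← VectorField.mlieBracketWithin_univ, VectorField.mlieBracketWithin_eq_lieBracketWithin]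
      change fderivWithin ℝ (fun _ => w) univ _ v - fderivWithin ℝ (fun _ => v) univ _ w = 0
      simp
    rw [h0, map_zero]
  · exact contMDiffAt_extChartAt' hp

end Coordinates
end TransverseSR

/-! ### Gram matrix and volume density in a chart -/

namespace TransverseSR
namespace TransverseStructure

variable {d h : ℕ} {M : Type*} [TopologicalSpace M]
  [ChartedSpace (EuclideanSpace ℝ (Fin (d + h))) M] [IsManifold (𝓡 (d + h)) ∞ M]
  (S : TransverseStructure d h M) {x p : M}

/-- The metric `g_ε` as a bilinear map. -/
def metricL (ε : ℝ) (x : M) :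
    TangentSpace (𝓡 (d + h)) x →ₗ[ℝ] TangentSpace (𝓡 (d + h)) x →ₗ[ℝ] ℝ :=
  LinearMap.mk₂ ℝ (S.metric ε x)
    (fun u v w => by simp only [metric, gVer, map_add, add_apply, LinearMap.add_apply]; ring)
    (fun c u v => by
      simp only [metric, gVer, map_smul, smul_apply, LinearMap.smul_apply, smul_eq_mul]; ring)
    (fun u v w => by simp only [metric, gVer, map_add]; ring)
    (fun c u v => by simp only [metric, gVer, map_smul, smul_eq_mul]; ring)

lemma metricL_apply (ε : ℝ) (u v : TangentSpace (𝓡 (d + h)) x) :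
    S.metricL ε x u v = S.metric ε x u v := rfl

lemma metric_symm (ε : ℝ) (u v : TangentSpace (𝓡 (d + h)) x) :
    S.metric ε x u v = S.metric ε x v u := by
  simp only [metric, gVer]
  rw [S.gH_symm, S.gV_symm]

lemma metric_pos {ε : ℝ} (hε : 0 < ε) {u : TangentSpace (𝓡 (d + h)) x} (hu : u ≠ 0) :
    0 < S.metric ε x u u := by
  have h1 : 0 ≤ S.gH x u u := by
    by_cases h0 : S.horProj x u = 0
    · rw [← S.gH_horProj_left, h0]; simp
    · rw [← S.gH_horProj_left, ← S.gH_horProj_right]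
      exact (S.gH_pos x _ (S.horProj_mem u) h0).le
  have h2 : 0 ≤ S.gVer x u u := by
    by_cases h0 : S.vertLift x u = 0
    · rw [gVer, h0]; simp
    · exact (S.gV_pos _ h0).le
  have h3 : 0 < ε⁻¹ := inv_pos.2 hε
  by_cases h0 : S.horProj x u = 0
  · have hv : S.vertLift x u ≠ 0 := fun hv => hu (by
      rw [← S.horProj_add_vertLift u, h0, hv]; simp)
    have := mul_pos h3 (S.gV_pos _ hv)
    exact add_pos_of_nonneg_of_pos h1 this
  · have h4 : 0 < S.gH x u u := by
      rw [← S.gH_horProj_left, ← S.gH_horProj_right]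
      exact S.gH_pos x _ (S.horProj_mem u) h0
    exact add_pos_of_pos_of_nonneg h4 (mul_nonneg h3.le h2)

lemma smooth_metric (ε : ℝ) {X Y : VectorField (d + h) M} (hX : SmoothVecNear X p)
    (hY : SmoothVecNear Y p) :
    SmoothFunNear (n := d + h) (fun y => S.metric ε y (X y) (Y y)) p :=
  (S.smooth_gH hX hY).add ((SmoothFunNear.const _).mul (IsCanonicalConnection.smooth_gVer hX hY))

/-- The Gram matrix of `g_1` in the preferred chart at `x`. -/
def gram (x p : M) : Matrix (Fin (d + h)) (Fin (d + h)) ℝ := Matrix.of fun a b =>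
  S.metric 1 p (coordVec x (EuclideanSpace.single a 1) p)
    (coordVec x (EuclideanSpace.single b 1) p)

/-- The density of the Riemannian volume in the preferred chart at `x`. -/
def density (x p : M) : ℝ := Real.sqrt (S.gram x p).det

lemma coordVec_sum (x p : M) (v : EuclideanSpace ℝ (Fin (d + h))) :
    coordVec x v p = ∑ a, v a • coordVec x (EuclideanSpace.single a 1) p := by
  have h1 : v = ∑ a, v a • EuclideanSpace.single a (1 : ℝ) := by
    ext b
    simp [Pi.single_apply]
  conv_lhs => rw [h1]
  simp only [coordVec, map_sum, map_smul]

lemma metric_coordVec (v w : EuclideanSpace ℝ (Fin (d + h))) :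
    S.metric 1 p (coordVec x v p) (coordVec x w p)
      = ∑ a, ∑ b, v a * w b * S.gram x p a b := by
  rw [coordVec_sum x p v, coordVec_sum x p w, ← metricL_apply]
  simp only [map_sum, map_smul, LinearMap.sum_apply, LinearMap.smul_apply, metricL_apply,
    smul_eq_mul, Finset.mul_sum, gram, Matrix.of_apply]
  exact Finset.sum_comm.trans
    (Finset.sum_congr rfl fun i _ => Finset.sum_congr rfl fun j _ => by ring)

variable (hp : p ∈ (chartAt (EuclideanSpace ℝ (Fin (d + h))) x).source)
include hp

/-- The quadratic form is g_1 evaluated on the coordinate field with components v, which is nonzero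
since the trivialization is injective. -/
lemma gram_posDef : (S.gram x p).PosDef := by
  refine Matrix.PosDef.of_dotProduct_mulVec_pos ?_ fun v hv => ?_
  · ext a b
    simp only [gram, Matrix.conjTranspose_apply, Matrix.of_apply, star_trivial]
    exact S.metric_symm _ _ _
  · let w : EuclideanSpace ℝ (Fin (d + h)) := WithLp.toLp 2 v
    have hw : coordVec x w p ≠ 0 := fun h0 => hv (by
      have := coordRep_coordVec hp w
      rw [h0, map_zero] at this
      funext i
      exact (congrFun (congrArg WithLp.ofLp this) i).symm)
    have h1 := S.metric_pos one_pos hw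
    rw [S.metric_coordVec] at h1
    refine h1.trans_eq ?_
    simp only [dotProduct, Matrix.mulVec, Finset.mul_sum, w, star_trivial]
    exact Finset.sum_congr rfl fun i _ => Finset.sum_congr rfl fun j _ => by ring

lemma density_pos : 0 < S.density x p := Real.sqrt_pos.2 (S.gram_posDef hp).det_pos

lemma smooth_gram (a b : Fin (d + h)) :
    SmoothFunNear (n := d + h) (fun q => S.gram x q a b) p :=
  S.smooth_metric 1 (smooth_coordVec hp _) (smooth_coordVec hp _)

lemma smooth_det_gram : SmoothFunNear (n := d + h) (fun q => (S.gram x q).det) p := by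
  simp only [Matrix.det_apply']
  refine .sum fun σ _ => (SmoothFunNear.const _).mul ?_
  have : ∀ s : Finset (Fin (d + h)),
      SmoothFunNear (n := d + h) (fun q => ∏ i ∈ s, S.gram x q (σ i) i) p := by
    intro s
    induction s using Finset.induction_on with
    | empty => simpa using SmoothFunNear.const 1
    | insert a s ha ih =>
      simp only [Finset.prod_insert ha]
      exact (S.smooth_gram hp _ _).mul ih
  exact this _

lemma smooth_density : SmoothFunNear (n := d + h) (S.density x) p := by
  refine (S.smooth_det_gram hp).comp (φ := Real.sqrt) ?_
  filter_upwards [lt_mem_nhds (S.gram_posDef hp).det_pos] with t ht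
  exact Real.contDiffAt_sqrt ht.ne'

end TransverseStructure
end TransverseSR

/-! ### Change of charts and the volume measure -/

namespace TransverseSR

section ChartChange

variable {n : ℕ} {M : Type*} [TopologicalSpace M] [ChartedSpace (EuclideanSpace ℝ (Fin n)) M]
  [IsManifold (𝓡 n) ∞ M] {x x' p : M}

lemma coordVec_eq_mfderiv_of_eq (hp : p ∈ (chartAt (EuclideanSpace ℝ (Fin n)) x).source)
    {y : EuclideanSpace ℝ (Fin n)} (hy : chartAt (EuclideanSpace ℝ (Fin n)) x p = y)
    (v : EuclideanSpace ℝ (Fin n)) :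
    coordVec x v p
      = mfderiv (𝓡 n) (𝓡 n) (chartAt (EuclideanSpace ℝ (Fin n)) x).symm y v := by
  subst hy
  exact coordVec_eq_mfderiv hp v

lemma coordVec_tangentCoordChange (hp : p ∈ (chartAt (EuclideanSpace ℝ (Fin n)) x).source)
    (hp' : p ∈ (chartAt (EuclideanSpace ℝ (Fin n)) x').source) (v : EuclideanSpace ℝ (Fin n)) :
    coordVec x' (tangentCoordChange (𝓡 n) x x' p v) p = coordVec x v p := by
  have h1 := TangentBundle.symmL_trivializationAt_eq_core (I := 𝓡 n) hp
  have h2 := TangentBundle.symmL_trivializationAt_eq_core (I := 𝓡 n) hp'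
  rw [coordVec, coordVec, h1, h2]
  exact tangentCoordChange_comp (I := 𝓡 n) (w := x) (x := x') (y := p) (z := p) (v := v)
    ⟨⟨by simpa using hp, by simpa using hp'⟩, by simp⟩

end ChartChange

namespace TransverseStructure

variable {d h : ℕ} {M : Type*} [TopologicalSpace M]
  [ChartedSpace (EuclideanSpace ℝ (Fin (d + h))) M] [IsManifold (𝓡 (d + h)) ∞ M]
  (S : TransverseStructure d h M) {x x' p : M}

/-- The Gram matrices are congruent, G = Aᵀ G' A, with A the Jacobian matrix of the transition map;
the square root of (det A)² is |det A|. -/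
lemma density_eq_mul (hp : p ∈ (chartAt (EuclideanSpace ℝ (Fin (d + h))) x).source)
    (hp' : p ∈ (chartAt (EuclideanSpace ℝ (Fin (d + h))) x').source) :
    S.density x p = |(tangentCoordChange (𝓡 (d + h)) x x' p).det| * S.density x' p := by
  let D := tangentCoordChange (𝓡 (d + h)) x x' p
  let b := (EuclideanSpace.basisFun (Fin (d + h)) ℝ).toBasis
  let A := LinearMap.toMatrix b b D.toLinearMap
  have hA : ∀ c a, A c a = D (EuclideanSpace.single a 1) c := fun c a => by
    simp [A, LinearMap.toMatrix_apply, b]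
  have h1 : S.gram x p = A.transpose * S.gram x' p * A := by
    ext a c
    have e1 : S.gram x p a c = S.metric 1 p (coordVec x' (D (EuclideanSpace.single a 1)) p)
        (coordVec x' (D (EuclideanSpace.single c 1)) p) := by
      simp only [D]
      rw [coordVec_tangentCoordChange hp hp', coordVec_tangentCoordChange hp hp']
      rfl
    rw [e1, S.metric_coordVec]
    simp only [Matrix.mul_apply, Matrix.transpose_apply, hA, Finset.sum_mul]
    rw [Finset.sum_comm]
    exact Finset.sum_congr rfl fun i _ => Finset.sum_congr rfl fun j _ => by ring
  have h2 : D.det = A.det := (LinearMap.det_toMatrix b D.toLinearMap).symm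
  change _ = |D.det| * _
  rw [density, density, h1, Matrix.det_mul, Matrix.det_mul, Matrix.det_transpose, h2,
    show A.det * (S.gram x' p).det * A.det = A.det ^ 2 * (S.gram x' p).det by ring,
    Real.sqrt_mul (sq_nonneg _), Real.sqrt_sq_eq_abs]

variable [MeasurableSpace M] [BorelSpace M]

omit [IsManifold (𝓡 (d + h)) ∞ M] in
lemma aemeasurable_chart_symm (x : M) :
    AEMeasurable (chartAt (EuclideanSpace ℝ (Fin (d + h))) x).symm
      (volume.restrict (chartAt (EuclideanSpace ℝ (Fin (d + h))) x).target) :=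
  (chartAt (EuclideanSpace ℝ (Fin (d + h))) x).continuousOn_symm.aemeasurable
    (chartAt (EuclideanSpace ℝ (Fin (d + h))) x).open_target.measurableSet

omit [IsManifold (𝓡 (d + h)) ∞ M] in
lemma measurableSet_chart_symm_preimage (x : M) {B : Set M} (hB : MeasurableSet B) :
    MeasurableSet ((chartAt (EuclideanSpace ℝ (Fin (d + h))) x).symm ⁻¹' B
      ∩ (chartAt (EuclideanSpace ℝ (Fin (d + h))) x).target) := by
  have h1 := (continuousOn_iff_continuous_domRestrict.1
    (chartAt (EuclideanSpace ℝ (Fin (d + h))) x).continuousOn_symm).measurable hB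
  have h2 := (chartAt (EuclideanSpace ℝ (Fin (d + h))) x).open_target.measurableSet.subtype_image h1
  convert h2 using 1
  ext y
  simp [and_comm]

omit [MeasurableSpace M] [BorelSpace M] in
lemma continuousOn_density (x : M) :
    ContinuousOn (fun y => S.density x ((chartAt (EuclideanSpace ℝ (Fin (d + h))) x).symm y))
      (chartAt (EuclideanSpace ℝ (Fin (d + h))) x).target := fun _ hy =>
  ((S.smooth_density ((chartAt (EuclideanSpace ℝ (Fin (d + h))) x).map_target hy)).contMDiffAt.continuousAt.comp
    ((chartAt (EuclideanSpace ℝ (Fin (d + h))) x).continuousAt_symm hy)).continuousWithinAt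

omit [BorelSpace M] in
lemma chartVolume_eq (x : M) : S.chartVolume x
    = Measure.map (chartAt (EuclideanSpace ℝ (Fin (d + h))) x).symm
      ((volume.restrict (chartAt (EuclideanSpace ℝ (Fin (d + h))) x).target).withDensity
        fun y => ENNReal.ofReal
          (S.density x ((chartAt (EuclideanSpace ℝ (Fin (d + h))) x).symm y))) := by
  have hT := (chartAt (EuclideanSpace ℝ (Fin (d + h))) x).open_target.measurableSet
  rw [chartVolume]
  congr 1
  refine withDensity_congr_ae ((ae_restrict_iff' hT).2 (Eventually.of_forall fun y hy => ?_))
  have hp := (chartAt (EuclideanSpace ℝ (Fin (d + h))) x).map_target hy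
  have hy' := (chartAt (EuclideanSpace ℝ (Fin (d + h))) x).right_inv hy
  have h1 := coordVec_eq_mfderiv_of_eq hp hy'
  simp only [density, gram, h1]

omit [MeasurableSpace M] [BorelSpace M] in
lemma aemeasurable_density (x : M) : AEMeasurable (fun y => ENNReal.ofReal
      (S.density x ((chartAt (EuclideanSpace ℝ (Fin (d + h))) x).symm y)))
    (volume.restrict (chartAt (EuclideanSpace ℝ (Fin (d + h))) x).target) :=
  ((S.continuousOn_density x).aemeasurable
    (chartAt (EuclideanSpace ℝ (Fin (d + h))) x).open_target.measurableSet).ennreal_ofReal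

lemma chartVolume_apply (x : M) {B : Set M} (hB : MeasurableSet B) : S.chartVolume x B
    = ∫⁻ y in (chartAt (EuclideanSpace ℝ (Fin (d + h))) x).symm ⁻¹' B
      ∩ (chartAt (EuclideanSpace ℝ (Fin (d + h))) x).target, ENNReal.ofReal
        (S.density x ((chartAt (EuclideanSpace ℝ (Fin (d + h))) x).symm y)) := by
  have hT := (chartAt (EuclideanSpace ℝ (Fin (d + h))) x).open_target.measurableSet
  rw [S.chartVolume_eq, Measure.map_apply_of_aemeasurable
    ((aemeasurable_chart_symm x).mono_ac (withDensity_absolutelyContinuous _ _)) hB,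
    withDensity_apply', Measure.restrict_restrict' hT]

/-- Change of variables for the transition map, whose Jacobian is the factor of `density_eq_mul`. -/
lemma chartVolume_overlap {B : Set M} (hB : MeasurableSet B)
    (hx : B ⊆ (chartAt (EuclideanSpace ℝ (Fin (d + h))) x).source)
    (hx' : B ⊆ (chartAt (EuclideanSpace ℝ (Fin (d + h))) x').source) :
    S.chartVolume x' B = S.chartVolume x B := by
  rw [S.chartVolume_apply x' hB, S.chartVolume_apply x hB]
  set φ := chartAt (EuclideanSpace ℝ (Fin (d + h))) x
  set φ' := chartAt (EuclideanSpace ℝ (Fin (d + h))) x'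
  have himg : (fun y => φ' (φ.symm y)) '' (φ.symm ⁻¹' B ∩ φ.target)
      = φ'.symm ⁻¹' B ∩ φ'.target := by
    ext y
    constructor
    · rintro ⟨z, ⟨hz, hzT⟩, rfl⟩
      exact ⟨by simpa [φ'.left_inv (hx' hz)] using hz, φ'.map_source (hx' hz)⟩
    · rintro ⟨hy, hyT⟩
      refine ⟨φ (φ'.symm y), ⟨?_, φ.map_source (hx hy)⟩, ?_⟩
      · simpa [φ.left_inv (hx hy)] using hy
      · simp [φ.left_inv (hx hy), φ'.right_inv hyT]
  rw [← himg, lintegral_image_eq_lintegral_abs_det_fderiv_mul volume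
    (measurableSet_chart_symm_preimage x hB)
    (f' := fun y => tangentCoordChange (𝓡 (d + h)) x x' (φ.symm y)) ?_ ?_]
  · refine setLIntegral_congr_fun (measurableSet_chart_symm_preimage x hB) fun y hy => ?_
    rw [φ'.left_inv (hx' hy.1), S.density_eq_mul (hx hy.1) (hx' hy.1),
      ENNReal.ofReal_mul (abs_nonneg _)]
  · intro y hy
    have h1 := hasFDerivWithinAt_tangentCoordChange (I := 𝓡 (d + h)) (x := x) (y := x')
      (z := φ.symm y) ⟨by simpa using hx hy.1, by simpa using hx' hy.1⟩
    have h2 : extChartAt (𝓡 (d + h)) x (φ.symm y) = y := φ.right_inv hy.2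
    rw [h2] at h1
    exact h1.mono (by simp)
  · intro y hy z hz hyz
    have h1 := φ'.injOn (hx' hy.1) (hx' hz.1) hyz
    rw [← φ.right_inv hy.2, h1, φ.right_inv hz.2]

lemma chartVolume_compl (x : M) :
    S.chartVolume x (chartAt (EuclideanSpace ℝ (Fin (d + h))) x).sourceᶜ = 0 := by
  rw [S.chartVolume_apply x
    (chartAt (EuclideanSpace ℝ (Fin (d + h))) x).open_source.measurableSet.compl]
  have : (chartAt (EuclideanSpace ℝ (Fin (d + h))) x).symm ⁻¹'
      (chartAt (EuclideanSpace ℝ (Fin (d + h))) x).sourceᶜ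
      ∩ (chartAt (EuclideanSpace ℝ (Fin (d + h))) x).target = ∅ := by
    ext y
    simp only [mem_inter_iff, mem_preimage, mem_compl_iff, mem_empty_iff_false, iff_false, not_and]
    exact fun h1 h2 => h1 ((chartAt (EuclideanSpace ℝ (Fin (d + h))) x).map_target h2)
  rw [this]
  simp

/-- The volume measure restricts to the volume of each chart. -/
lemma volumeMeasure_restrict (x : M) :
    S.volumeMeasure.restrict (chartAt (EuclideanSpace ℝ (Fin (d + h))) x).source
      = S.chartVolume x := by
  set s := (chartAt (EuclideanSpace ℝ (Fin (d + h))) x).source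
  have hs : MeasurableSet s := (chartAt (EuclideanSpace ℝ (Fin (d + h))) x).open_source.measurableSet
  have hself : (S.chartVolume x).restrict s = S.chartVolume x :=
    Measure.restrict_eq_self_of_ae_mem (measure_eq_zero_iff_ae_notMem.1 (S.chartVolume_compl x) |>.mono
      fun y hy => by simpa using hy)
  refine le_antisymm ?_ ?_
  -- Bounding a supremum requires one measure that dominates every chart measure. Inside `s` the
  -- overlap lemma provides it; outside, the largest measure does, and restriction to `s` removes it
  -- again.
  · have hle : S.volumeMeasure ≤ S.chartVolume x + (⊤ : Measure M).restrict sᶜ := by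
      refine iSup_le fun x' => Measure.le_iff.2 fun B hB => ?_
      rw [← measure_inter_add_sdiff B hs, Measure.add_apply, Measure.restrict_apply hB]
      have hs' := (chartAt (EuclideanSpace ℝ (Fin (d + h))) x').open_source.measurableSet
      refine add_le_add ?_ (le_top (a := S.chartVolume x') _)
      have h1 : S.chartVolume x' (B ∩ s)
          ≤ S.chartVolume x' (B ∩ s ∩ (chartAt (EuclideanSpace ℝ (Fin (d + h))) x').source) := by
        rw [← measure_inter_add_sdiff (B ∩ s) hs']
        refine le_trans (add_le_add le_rfl (measure_mono (t :=
          (chartAt (EuclideanSpace ℝ (Fin (d + h))) x').sourceᶜ) fun y hy => hy.2)) ?_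
        rw [S.chartVolume_compl, add_zero]
      refine h1.trans ?_
      rw [S.chartVolume_overlap (x := x) ((hB.inter hs).inter hs') (fun y hy => hy.1.2)
        (fun y hy => hy.2)]
      exact measure_mono fun y hy => hy.1.1
    refine (Measure.restrict_mono le_rfl hle).trans ?_
    rw [Measure.restrict_add, hself, Measure.restrict_restrict hs]
    simp
  · rw [← hself]
    exact Measure.restrict_mono le_rfl (le_iSup S.chartVolume x)

lemma integral_eq_setIntegral_chart (x : M) {F : M → ℝ}
    (hF : AEStronglyMeasurable F (S.chartVolume x))
    (hs : ∀ p ∉ (chartAt (EuclideanSpace ℝ (Fin (d + h))) x).source, F p = 0) :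
    ∫ p, F p ∂S.volumeMeasure
      = ∫ y in (chartAt (EuclideanSpace ℝ (Fin (d + h))) x).target,
        S.density x ((chartAt (EuclideanSpace ℝ (Fin (d + h))) x).symm y)
          * F ((chartAt (EuclideanSpace ℝ (Fin (d + h))) x).symm y) := by
  have hT := (chartAt (EuclideanSpace ℝ (Fin (d + h))) x).open_target.measurableSet
  rw [← setIntegral_eq_integral_of_forall_compl_eq_zero hs, S.volumeMeasure_restrict]
  rw [S.chartVolume_eq] at hF ⊢
  rw [integral_map ((aemeasurable_chart_symm x).mono_ac (withDensity_absolutelyContinuous _ _)) hF,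
    integral_withDensity_eq_integral_toReal_smul₀ (S.aemeasurable_density x)
      (Eventually.of_forall fun y => ENNReal.ofReal_lt_top)]
  refine setIntegral_congr_fun hT fun y hy => ?_
  simp only [smul_eq_mul]
  rw [ENNReal.toReal_ofReal
    (S.density_pos ((chartAt (EuclideanSpace ℝ (Fin (d + h))) x).map_target hy)).le]

/-- Near `x` the measure is the integral of a continuous density over a part of a compact subset of
the chart target. -/
lemma isLocallyFiniteMeasure_volumeMeasure : IsLocallyFiniteMeasure S.volumeMeasure := by
  refine ⟨fun x => ?_⟩
  set φ := chartAt (EuclideanSpace ℝ (Fin (d + h))) x with hφ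
  have hx : x ∈ φ.source := mem_chart_source _ x
  obtain ⟨K, hK, hxK, hKT⟩ := exists_compact_subset φ.open_target (φ.map_source hx)
  have hso : IsOpen (φ.source ∩ φ ⁻¹' interior K) := φ.isOpen_inter_preimage isOpen_interior
  refine ⟨φ.source ∩ φ ⁻¹' interior K, hso.mem_nhds ⟨hx, hxK⟩, ?_⟩
  rw [← Measure.restrict_eq_self S.volumeMeasure (inter_subset_left (s := φ.source)),
    hφ, S.volumeMeasure_restrict, S.chartVolume_apply x hso.measurableSet, ← hφ]
  have hint : IntegrableOn (fun y => S.density x (φ.symm y)) K :=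
    ((S.continuousOn_density x).mono hKT).integrableOn_compact hK
  refine lt_of_le_of_lt (lintegral_mono_set fun y hy => ?_) hint.lintegral_lt_top
  have h1 : φ (φ.symm y) ∈ interior K := hy.1.2
  rw [φ.right_inv hy.2] at h1
  exact interior_subset h1

end TransverseStructure
end TransverseSR

/-! ### Jacobi's formula, traces, and integration in a chart -/

namespace TransverseSR

section Jacobi

variable {ι : Type*} [Fintype ι] [DecidableEq ι]

lemma differentiable_det_of : Differentiable ℝ (fun A : ι → ι → ℝ => (Matrix.of A).det) := by
  simp only [Matrix.det_apply', Matrix.of_apply]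
  fun_prop

/-- A variation CᵀG + GC is that of a Gram matrix. In each of the two directions the determinant
factors, det(G(1 + tC)) = det G · det(1 + tC), so only the derivative of det at the identity is
needed, without an adjugate or an inverse. -/
lemma hasDerivAt_det {G : ℝ → Matrix ι ι ℝ} {C : Matrix ι ι ℝ}
    (hG : ∀ a b, HasDerivAt (fun t => G t a b) ((C.transpose * G 0 + G 0 * C) a b) 0) :
    HasDerivAt (fun t => (G t).det) (2 * C.trace * (G 0).det) 0 := by
  let f : (ι → ι → ℝ) → ℝ := fun A => (Matrix.of A).det
  have hf : HasFDerivAt f (fderiv ℝ f (G 0)) (G 0) := (differentiable_det_of _).hasFDerivAt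
  have hline : ∀ H : Matrix ι ι ℝ, HasDerivAt (fun t : ℝ => f (fun a b => G 0 a b + t * H a b))
      (fderiv ℝ f (G 0) H) 0 := fun H => by
    have h1 : HasDerivAt (fun t : ℝ => (fun a b => G 0 a b + t * H a b : ι → ι → ℝ)) H 0 :=
      hasDerivAt_pi.2 fun a => hasDerivAt_pi.2 fun b => by
        simpa using ((hasDerivAt_id (0 : ℝ)).mul_const (H a b)).const_add (G 0 a b)
    have h2 : (fun a b => G 0 a b + 0 * H a b : ι → ι → ℝ) = G 0 := by
      funext a b; ring
    refine HasFDerivAt.comp_hasDerivAt (0 : ℝ) (l := f) (l' := fderiv ℝ f (G 0)) ?_ h1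
    rw [h2]
    exact hf
  -- det(1 + tB) = 1 + t tr B + t² q(t) for a polynomial q.
  have hone : ∀ B : Matrix ι ι ℝ, HasDerivAt (fun t : ℝ => (1 + t • B).det) B.trace 0 := fun B => by
    let q := (Matrix.det (1 + (Polynomial.X : Polynomial ℝ) • B.map Polynomial.C)).divX.divX
    have h1 : (fun t : ℝ => (1 + t • B).det) = fun t => 1 + B.trace * t + q.eval t * t ^ 2 := by
      funext t
      exact Matrix.det_one_add_smul t B
    rw [h1]
    have h2 := (((hasDerivAt_id (0 : ℝ)).const_mul B.trace).const_add 1).add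
      ((q.hasDerivAt 0).mul ((hasDerivAt_id (0 : ℝ)).pow 2))
    have h3 : B.trace * 1 + (Polynomial.eval 0 (Polynomial.derivative q) * (id ^ 2 : ℝ → ℝ) 0
        + Polynomial.eval 0 q * (((2 : ℕ) : ℝ) * id 0 ^ (2 - 1) * 1)) = B.trace := by simp
    rw [h3] at h2
    exact h2
  have e1 : fderiv ℝ f (G 0) (G 0 * C) = (G 0).det * C.trace := by
    have h1 : (fun t : ℝ => f (fun a b => G 0 a b + t * (G 0 * C) a b))
        = fun t => (G 0).det * (1 + t • C).det := by
      funext t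
      rw [← Matrix.det_mul, mul_add, mul_one, Matrix.mul_smul]
      rfl
    have h2 := hline (G 0 * C)
    rw [h1] at h2
    exact h2.unique ((hone C).const_mul _)
  have e2 : fderiv ℝ f (G 0) (C.transpose * G 0) = (G 0).det * C.trace := by
    have h1 : (fun t : ℝ => f (fun a b => G 0 a b + t * (C.transpose * G 0) a b))
        = fun t => (1 + t • C.transpose).det * (G 0).det := by
      funext t
      rw [← Matrix.det_mul, add_mul, one_mul, Matrix.smul_mul]
      rfl
    have h2 := hline (C.transpose * G 0)
    rw [h1] at h2
    rw [h2.unique ((hone C.transpose).mul_const _), Matrix.trace_transpose, mul_comm]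
  have h3 : HasDerivAt (fun t => (G t : ι → ι → ℝ)) (C.transpose * G 0 + G 0 * C) 0 :=
    hasDerivAt_pi.2 fun a => hasDerivAt_pi.2 fun b => hG a b
  have h4 := HasFDerivAt.comp_hasDerivAt (0 : ℝ) (l := f) (l' := fderiv ℝ f (G 0)) hf h3
  have h5 : fderiv ℝ f (G 0) (C.transpose * G 0 + G 0 * C) = 2 * C.trace * (G 0).det := by
    refine (map_add (fderiv ℝ f (G 0)) _ _).trans ?_
    rw [e1, e2]
    ring
  rw [← h5]
  exact h4

end Jacobi

/-- L is the sum of the rank-one maps θ_k(L ·) f_k. Only the reproducing property is needed, so it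
serves adapted and coordinate frames alike. -/
lemma trace_eq_sum_of_dual {ι V : Type*} [Fintype ι] [AddCommGroup V] [Module ℝ V]
    [FiniteDimensional ℝ V] {f : ι → V} {θ : ι → V →ₗ[ℝ] ℝ} (hθ : ∀ u, ∑ k, θ k u • f k = u)
    (L : V →ₗ[ℝ] V) : LinearMap.trace ℝ V L = ∑ k, θ k (L (f k)) := by
  have h1 : L = ∑ k, (θ k ∘ₗ L).smulRight (f k) := by
    ext u
    simp [hθ]
  conv_lhs => rw [h1]
  rw [map_sum]
  simp [LinearMap.trace_smulRight]

section ChartIntegral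

variable {n : ℕ} {M : Type*} [TopologicalSpace M] [ChartedSpace (EuclideanSpace ℝ (Fin n)) M]
  [IsManifold (𝓡 n) ∞ M] {x : M}

lemma hasFDerivAt_comp_chart_symm {f : M → ℝ} {y : EuclideanSpace ℝ (Fin n)}
    (hy : y ∈ (chartAt (EuclideanSpace ℝ (Fin n)) x).target)
    (hf : MDifferentiableAt (𝓡 n) 𝓘(ℝ, ℝ) f ((chartAt (EuclideanSpace ℝ (Fin n)) x).symm y)) :
    ∃ L : EuclideanSpace ℝ (Fin n) →L[ℝ] ℝ,
      HasFDerivAt (fun z => f ((chartAt (EuclideanSpace ℝ (Fin n)) x).symm z)) L y ∧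
      ∀ v, L v = differential (n := n) f ((chartAt (EuclideanSpace ℝ (Fin n)) x).symm y)
        (coordVec x v ((chartAt (EuclideanSpace ℝ (Fin n)) x).symm y)) := by
  have hψ : MDifferentiableAt (𝓡 n) (𝓡 n) (chartAt (EuclideanSpace ℝ (Fin n)) x).symm y :=
    mdifferentiableAt_atlas_symm (chart_mem_atlas _ x) hy
  have h1 := hf.hasMFDerivAt.comp y hψ.hasMFDerivAt
  refine ⟨_, hasMFDerivAt_iff_hasFDerivAt.1 h1, fun v => ?_⟩
  rw [coordVec_eq_mfderiv_of_eq ((chartAt (EuclideanSpace ℝ (Fin n)) x).map_target hy)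
    ((chartAt (EuclideanSpace ℝ (Fin n)) x).right_inv hy)]
  rfl

/-- Extended by zero, the function read in the chart is smooth with compact support on the whole
Euclidean space, where a directional derivative has integral zero. -/
lemma setIntegral_differential_coordVec {u : M → ℝ} {K : Set M} [T2Space M] (hK : IsCompact K)
    (hKs : K ⊆ (chartAt (EuclideanSpace ℝ (Fin n)) x).source)
    (hu : ∀ p ∈ (chartAt (EuclideanSpace ℝ (Fin n)) x).source, SmoothFunNear (n := n) u p)
    (h0 : ∀ p ∉ K, u p = 0) (v : EuclideanSpace ℝ (Fin n)) :
    IntegrableOn (fun y => differential (n := n) u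
        ((chartAt (EuclideanSpace ℝ (Fin n)) x).symm y)
        (coordVec x v ((chartAt (EuclideanSpace ℝ (Fin n)) x).symm y)))
      (chartAt (EuclideanSpace ℝ (Fin n)) x).target ∧
    ∫ y in (chartAt (EuclideanSpace ℝ (Fin n)) x).target, differential (n := n) u
        ((chartAt (EuclideanSpace ℝ (Fin n)) x).symm y)
        (coordVec x v ((chartAt (EuclideanSpace ℝ (Fin n)) x).symm y)) = 0 := by
  set φ := chartAt (EuclideanSpace ℝ (Fin n)) x with hφ
  classical
  have hT := φ.open_target.measurableSet
  let U : EuclideanSpace ℝ (Fin n) → ℝ := fun y => if y ∈ φ.target then u (φ.symm y) else 0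
  have hKc : IsCompact (φ '' K) := hK.image_of_continuousOn (φ.continuousOn.mono hKs)
  have hU0 : ∀ y ∉ φ '' K, U y = 0 := fun y hy => by
    by_cases hyT : y ∈ φ.target
    · have : φ.symm y ∉ K := fun hk => hy ⟨_, hk, φ.right_inv hyT⟩
      simp [U, hyT, h0 _ this]
    · simp [U, hyT]
  have hUT : ∀ y ∈ φ.target, U =ᶠ[𝓝 y] fun z => u (φ.symm z) := fun y hy => by
    filter_upwards [φ.open_target.mem_nhds hy] with z hz
    simp [U, hz]
  -- The image of `K` is compact, hence closed, so the extension vanishes near boundary points of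
  -- the target too.
  have hUn : ∀ y ∉ φ.target, U =ᶠ[𝓝 y] fun _ => 0 := fun y hy => by
    have hyK : y ∉ φ '' K := by
      rintro ⟨p, hp, rfl⟩
      exact hy (φ.map_source (hKs hp))
    filter_upwards [hKc.isClosed.isOpen_compl.mem_nhds hyK] with z hz using hU0 z hz
  have hUs : ContDiff ℝ ∞ U := contDiff_iff_contDiffAt.2 fun y => by
    by_cases hy : y ∈ φ.target
    · refine ContDiffAt.congr_of_eventuallyEq ?_ (hUT y hy)
      have h1 : ContMDiffAt (𝓡 n) (𝓡 n) ∞ φ.symm y :=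
        (contMDiffOn_chart_symm (x := x)).contMDiffAt (φ.open_target.mem_nhds hy)
      exact ((hu _ (φ.map_target hy)).contMDiffAt.comp y h1).contDiffAt
    · exact contDiffAt_const.congr_of_eventuallyEq (hUn y hy)
  have hUc : HasCompactSupport U := HasCompactSupport.intro hKc hU0
  have hd : ∀ y ∈ φ.target, fderiv ℝ U y v
      = differential (n := n) u (φ.symm y) (coordVec x v (φ.symm y)) := fun y hy => by
    obtain ⟨L, hL, hLv⟩ := hasFDerivAt_comp_chart_symm hy (hu _ (φ.map_target hy)).mdiff
    rw [(hUT y hy).fderiv_eq, hL.fderiv, hLv]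
  have hdn : ∀ y ∉ φ.target, fderiv ℝ U y v = 0 := fun y hy => by
    rw [(hUn y hy).fderiv_eq]
    simp
  have hcont : Continuous (fun y => fderiv ℝ U y v) :=
    (hUs.continuous_fderiv (by simp)).clm_apply continuous_const
  have hint : Integrable (fun y => fderiv ℝ U y v) :=
    hcont.integrable_of_hasCompactSupport (hUc.fderiv_apply (𝕜 := ℝ) v)
  have hz : ∫ y, fderiv ℝ U y v = 0 := by
    -- Integration by parts against the constant function 1.
    have h1 := integral_smul_fderiv_eq_neg_fderiv_smul_of_integrable (𝕜 := ℝ) (μ := volume)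
      (f := fun _ : EuclideanSpace ℝ (Fin n) => (1 : ℝ)) (g := U) (v := v) (by simp)
      (by simpa using hint) (by simpa using hUs.continuous.integrable_of_hasCompactSupport hUc)
      (fun _ _ => differentiableAt_const _)
      (fun y _ => hUs.differentiable (by simp) y)
    simpa using h1
  refine ⟨(hint.integrableOn (s := φ.target)).congr_fun hd hT, ?_⟩
  rw [← setIntegral_congr_fun hT hd, setIntegral_eq_integral_of_forall_compl_eq_zero hdn, hz]

end ChartIntegral

end TransverseSR

/-! ### The trace of ∇W as a divergence -/

namespace TransverseSR
namespace TransverseStructure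

variable {d h : ℕ} {M : Type*} [TopologicalSpace M]
  [ChartedSpace (EuclideanSpace ℝ (Fin (d + h))) M] [IsManifold (𝓡 (d + h)) ∞ M]
  {S : TransverseStructure d h M} {cov : Connection (d + h) M} {x p : M}

variable (cov) in
/-- The divergence of a vector field. -/
def divergence (W : VectorField (d + h) M) (x : M) : ℝ :=
  LinearMap.trace ℝ (TangentSpace (𝓡 (d + h)) x) (cov W x).toLinearMap

lemma trace_eq_sum_frame {e : Fin d → TangentSpace (𝓡 (d + h)) x} (he : S.IsHorOrthonormal x e)
    (L : TangentSpace (𝓡 (d + h)) x →ₗ[ℝ] TangentSpace (𝓡 (d + h)) x) :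
    LinearMap.trace ℝ _ L = ∑ i, S.gH x (e i) (L (e i))
      + ∑ m, S.nu (S.vertBasis m) x (L ((S.vertBasis m).1 x)) := by
  rw [trace_eq_sum_of_dual (ι := Fin d ⊕ Fin h)
    (f := Sum.elim e fun m => (S.vertBasis m).1 x)
    (θ := Sum.elim (fun i => (S.gH x (e i)).toLinearMap)
      fun m => (S.nu (S.vertBasis m) x).toLinearMap) (fun u => ?_) L]
  · simp
  · simpa using (decomp he S.isVertOrthonormal_vertBasis u).symm

lemma trace_eq_sum_coord (hp : p ∈ (chartAt (EuclideanSpace ℝ (Fin (d + h))) x).source)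
    (L : TangentSpace (𝓡 (d + h)) p →ₗ[ℝ] TangentSpace (𝓡 (d + h)) p) :
    LinearMap.trace ℝ _ L
      = ∑ a, coordRep x p (L (coordVec x (EuclideanSpace.single a 1) p)) a := by
  refine trace_eq_sum_of_dual (f := fun a => coordVec x (EuclideanSpace.single a 1) p)
    (θ := fun a => ((EuclideanSpace.proj a).comp (coordRep x p)).toLinearMap) (fun u => ?_) L
  conv_rhs => rw [← coordVec_coordRep hp u, coordVec_sum x p]
  rfl

namespace IsCanonicalConnection

variable (hc : S.IsCanonicalConnection cov) {W : VectorField (d + h) M}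
include hc

lemma divergence_eq (hW : SmoothVecNear W x) (hhor : ∀ᶠ y in 𝓝 x, W y ∈ S.hor y)
    {e : Fin d → TangentSpace (𝓡 (d + h)) x} (he : S.IsHorOrthonormal x e) :
    divergence cov W x = ∑ i, S.gH x (e i) (cov W x (e i)) := by
  rw [divergence, trace_eq_sum_frame he]
  simp [S.nu_hor _ (hc.cov_mem_hor hW hhor _)]

/-- T(w, ·) has vertical values and kills vertical vectors, so its matrix has zero diagonal. This is
why torsion does not disturb the divergence theorem. -/
lemma trace_torsion {w : TangentSpace (𝓡 (d + h)) x} (hw : w ∈ S.hor x) :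
    LinearMap.trace ℝ (TangentSpace (𝓡 (d + h)) x) (cov.torsion x w).toLinearMap = 0 := by
  rw [trace_eq_sum_frame (S.isHorOrthonormal_horBasis x)]
  simp [hc.torsion_hor_ver hw (S.vert_mem_verSpace _), S.gH_ver_right (hc.torsion_mem_ver _ _)]

omit hc in
/-- The components of a smooth vector field in a chart. -/
lemma smooth_coordRep (hp : p ∈ (chartAt (EuclideanSpace ℝ (Fin (d + h))) x).source)
    (hW : SmoothVecNear W p) (a : Fin (d + h)) :
    SmoothFunNear (n := d + h) (fun q => coordRep x q (W q) a) p := by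
  filter_upwards [hW.eventually,
    (chartAt (EuclideanSpace ℝ (Fin (d + h))) x).open_source.mem_nhds hp] with q hWq hq
  refine contMDiffAt_frame_coeff (n := d + h) (ι := Fin (d + h)) (by simp)
    (E := fun a => coordVec x (EuclideanSpace.single a 1)) (Y := W)
    (c := fun a q => coordRep x q (W q) a) (fun a => smooth_coordVec hq _) hWq ?_ ?_ a
  · refine LinearIndependent.of_comp (coordRep x q).toLinearMap ?_
    have h1 : (coordRep x q).toLinearMap ∘ (fun a => coordVec x (EuclideanSpace.single a 1) q)
        = EuclideanSpace.basisFun (Fin (d + h)) ℝ := by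
      funext a
      simp only [Function.comp_apply, ContinuousLinearMap.coe_coe]
      rw [coordRep_coordVec hq]
      simp
    rw [h1]
    exact (EuclideanSpace.basisFun (Fin (d + h)) ℝ).toBasis.linearIndependent
  · filter_upwards [(chartAt (EuclideanSpace ℝ (Fin (d + h))) x).open_source.mem_nhds hq] with z hz
    conv_lhs => rw [← coordVec_coordRep hz (W z), coordVec_sum x z]

omit hc in
lemma cov_coordVec_swap (hp : p ∈ (chartAt (EuclideanSpace ℝ (Fin (d + h))) x).source)
    (v w : EuclideanSpace ℝ (Fin (d + h))) :
    cov (coordVec x v) p (coordVec x w p)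
      = cov (coordVec x w) p (coordVec x v p)
        - cov.torsion p (coordVec x v p) (coordVec x w p) := by
  have h1 := cov.torsion_apply (smooth_coordVec hp v).mdiff (smooth_coordVec hp w).mdiff
  rw [mlieBracket_coordVec hp] at h1
  rw [h1]
  abel

/-- Writing W = ∑ W^b E_b, the coefficients ∇_{E_a} E_b appear; exchanging a and b turns them into
derivatives of E_a along W, at the cost of the trace of T(W, ·), which is zero. -/
lemma divergence_eq_sum_coord (hp : p ∈ (chartAt (EuclideanSpace ℝ (Fin (d + h))) x).source)
    (hW : SmoothVecNear W p) (hhor : W p ∈ S.hor p) :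
    divergence cov W p
      = ∑ a, differential (n := d + h) (fun q => coordRep x q (W q) a) p
          (coordVec x (EuclideanSpace.single a 1) p)
        + ∑ a, coordRep x p (cov (coordVec x (EuclideanSpace.single a 1)) p (W p)) a := by
  let E : Fin (d + h) → VectorField (d + h) M := fun a => coordVec x (EuclideanSpace.single a 1)
  let c : Fin (d + h) → M → ℝ := fun b q => coordRep x q (W q) b
  have hWs : ∀ᶠ q in 𝓝 p, W q = ∑ b, c b q • E b q := by
    filter_upwards [(chartAt (EuclideanSpace ℝ (Fin (d + h))) x).open_source.mem_nhds hp] with q hq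
    conv_lhs => rw [← coordVec_coordRep hq (W q), coordVec_sum x q]
  have hc' : ∀ b, MDifferentiableAt (𝓡 (d + h)) 𝓘(ℝ, ℝ) (c b) p :=
    fun b => (smooth_coordRep hp hW b).mdiff
  have hE : ∀ b, SmoothVecNear (E b) p := fun b => smooth_coordVec hp _
  have hcE : ∀ b, DiffVecAt (fun q => c b q • E b q) p := fun b =>
    (SmoothNear.smul (smooth_coordRep hp hW b) (hE b)).mdiff
  have h1 : ∀ a, cov W p (E a p) = cov (E a) p (W p) - cov.torsion p (W p) (E a p)
      + ∑ b, differential (c b) p (E a p) • E b p := fun a => by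
    have hWp := hWs.self_of_nhds
    have h2 : DiffVecAt (fun q => ∑ b, c b q • E b q) p :=
      DiffVecAt.congr (SmoothNear.mdiff hW) (hWs.mono fun q hq => hq.symm)
    rw [cov_congr cov h2 hWs, cov_sum cov fun b _ => hcE b, FunLike.coe_sum, Finset.sum_apply]
    have h3 : ∀ b, cov (fun q => c b q • E b q) p (E a p)
        = c b p • cov (E a) p (E b p) - cov.torsion p (c b p • E b p) (E a p)
          + differential (c b) p (E a p) • E b p := fun b => by
      rw [cov_smul cov (hc' b) (hE b).mdiff, cov_coordVec_swap hp, smul_sub, map_smul, smul_apply]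
    simp only [h3, Finset.sum_add_distrib, Finset.sum_sub_distrib]
    rw [hWp]
    simp only [map_sum, map_smul, FunLike.coe_sum, Finset.sum_apply]
  have h4 := hc.trace_torsion hhor
  rw [trace_eq_sum_coord hp] at h4
  simp only [ContinuousLinearMap.coe_coe] at h4
  rw [divergence, trace_eq_sum_coord hp]
  have h5 : ∀ a, coordRep x p (cov W p (E a p)) a
      = coordRep x p (cov (E a) p (W p)) a - coordRep x p (cov.torsion p (W p) (E a p)) a
        + differential (c a) p (E a p) := fun a => by
    rw [h1, map_add, map_sub, map_sum]
    simp only [map_smul, E, coordRep_coordVec hp]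
    simp [Pi.single_apply]
  refine (Finset.sum_congr rfl fun a _ => h5 a).trans ?_
  rw [Finset.sum_add_distrib, Finset.sum_sub_distrib, h4]
  simp only [E, c]
  ring

/-- By metric compatibility the Gram matrix varies by CᵀG + GC, where C is the matrix of ∇_u on the
coordinate fields. Jacobi's formula and the square root then give ρ tr C. -/
lemma differential_density (hp : p ∈ (chartAt (EuclideanSpace ℝ (Fin (d + h))) x).source)
    (u : TangentSpace (𝓡 (d + h)) p) :
    differential (n := d + h) (S.density x) p u = S.density x p
      * ∑ a, coordRep x p (cov (coordVec x (EuclideanSpace.single a 1)) p u) a := by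
  set φ := chartAt (EuclideanSpace ℝ (Fin (d + h))) x with hφ
  let E : Fin (d + h) → VectorField (d + h) M := fun a => coordVec x (EuclideanSpace.single a 1)
  have hE : ∀ b, SmoothVecNear (E b) p := fun b => smooth_coordVec hp _
  have hpT : φ p ∈ φ.target := φ.map_source hp
  have hψ : φ.symm (φ p) = p := φ.left_inv hp
  let v := coordRep x p u
  have hline : HasDerivAt (fun t : ℝ => φ p + t • v) v 0 := by
    simpa using ((hasDerivAt_id (0 : ℝ)).smul_const v).const_add (φ p)
  -- Derivatives along `u` are taken on the straight line through φ(p) in the chart, which reduces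
  -- to one real variable.
  have hpath : ∀ {f : M → ℝ}, MDifferentiableAt (𝓡 (d + h)) 𝓘(ℝ, ℝ) f p →
      HasDerivAt (fun t : ℝ => f (φ.symm (φ p + t • v))) (differential (n := d + h) f p u) 0 := by
    intro f hf
    obtain ⟨L, hL, hLv⟩ := hasFDerivAt_comp_chart_symm (x := x) (f := f) hpT (by rwa [hψ])
    have h1 : HasFDerivAt (fun z => f (φ.symm z)) L (φ p + (0 : ℝ) • v) := by simpa using hL
    have h2 := h1.comp_hasDerivAt (0 : ℝ) hline
    rw [hLv, hψ, coordVec_coordRep hp] at h2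
    exact h2
  let C : Matrix (Fin (d + h)) (Fin (d + h)) ℝ :=
    Matrix.of fun c a => coordRep x p (cov (E a) p u) c
  have hC : ∀ a, cov (E a) p u = ∑ c, C c a • E c p := fun a => by
    conv_lhs => rw [← coordVec_coordRep hp (cov (E a) p u), coordVec_sum x p]
    rfl
  have h0 : φ.symm (φ p + (0 : ℝ) • v) = p := by simpa using hψ
  have hG : ∀ a b, HasDerivAt (fun t : ℝ => S.gram x (φ.symm (φ p + t • v)) a b)
      ((C.transpose * S.gram x (φ.symm (φ p + (0 : ℝ) • v))
        + S.gram x (φ.symm (φ p + (0 : ℝ) • v)) * C) a b) 0 := fun a b => by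
    have h1 := hpath (S.smooth_gram hp a b).mdiff
    have h2 : differential (n := d + h) (fun q => S.gram x q a b) p u
        = S.metric 1 p (cov (E a) p u) (E b p) + S.metric 1 p (E a p) (cov (E b) p u) := by
      have h3 := hc.differential_metric one_pos (hE a) (hE b) u
      refine Eq.trans ?_ h3
      change differential (n := d + h) (fun q => S.gH q (E a q) (E b q)
        + (1 : ℝ)⁻¹ * S.gVer q (E a q) (E b q)) p u = _
      have h4 := (smooth_gVer (S := S) (hE a) (hE b)).mdiff
      rw [differential_add (g := fun q => (1 : ℝ)⁻¹ * S.gVer q (E a q) (E b q))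
        (S.smooth_gH (hE a) (hE b)).mdiff (mdifferentiableAt_const.mul h4),
        differential_const_mul _ h4]
      rfl
    rw [h0]
    convert h1 using 1
    rw [h2, hC, hC, Matrix.add_apply, Matrix.mul_apply, Matrix.mul_apply]
    simp only [← metricL_apply, map_sum, map_smul, LinearMap.sum_apply, LinearMap.smul_apply,
      smul_eq_mul]
    congr 1
    exact Finset.sum_congr rfl fun c _ => mul_comm _ _
  have h1 := (hasDerivAt_det hG).sqrt (by rw [h0]; exact (S.gram_posDef hp).det_pos.ne')
  have h2 := (hpath (S.smooth_density hp).mdiff).unique h1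
  rw [h2, h0]
  change 2 * C.trace * (S.gram x p).det / (2 * S.density x p) = S.density x p * C.trace
  have h3 := S.density_pos hp
  have h4 : S.density x p * S.density x p = (S.gram x p).det :=
    Real.mul_self_sqrt (S.gram_posDef hp).det_pos.le
  rw [← h4]
  field_simp

/-- The connection coefficients in the two preceding formulas are the same trace, so they combine
into ∑ ∂_a(ρ W^a). -/
lemma density_mul_divergence (hp : p ∈ (chartAt (EuclideanSpace ℝ (Fin (d + h))) x).source)
    (hW : SmoothVecNear W p) (hhor : W p ∈ S.hor p) :
    S.density x p * divergence cov W p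
      = ∑ a, differential (n := d + h) (fun q => S.density x q * coordRep x q (W q) a) p
          (coordVec x (EuclideanSpace.single a 1) p) := by
  have h1 : ∀ a, differential (n := d + h) (fun q => S.density x q * coordRep x q (W q) a) p
      (coordVec x (EuclideanSpace.single a 1) p)
      = S.density x p * differential (n := d + h) (fun q => coordRep x q (W q) a) p
          (coordVec x (EuclideanSpace.single a 1) p)
        + differential (n := d + h) (S.density x) p
          (coordRep x p (W p) a • coordVec x (EuclideanSpace.single a 1) p) := fun a => by
    rw [differential_mul (S.smooth_density hp).mdiff (smooth_coordRep hp hW a).mdiff]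
    simp
  simp only [h1, Finset.sum_add_distrib, ← Finset.mul_sum, ← map_sum]
  rw [← coordVec_sum x p, coordVec_coordRep hp, hc.differential_density hp,
    hc.divergence_eq_sum_coord hp hW hhor]
  ring

end IsCanonicalConnection

end TransverseStructure
end TransverseSR

/-! ### The divergence theorem for horizontal fields -/

namespace TransverseSR
namespace TransverseStructure
namespace IsCanonicalConnection

variable {d h : ℕ} {M : Type*} [TopologicalSpace M]
  [ChartedSpace (EuclideanSpace ℝ (Fin (d + h))) M] [IsManifold (𝓡 (d + h)) ∞ M]
  {S : TransverseStructure d h M} {cov : Connection (d + h) M} {x : M}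
  {W : VectorField (d + h) M}

lemma smooth_divergence (hc : S.IsCanonicalConnection cov) (hW : SmoothVecNear W x)
    (hhor : ∀ᶠ y in 𝓝 x, W y ∈ S.hor y) :
    SmoothFunNear (n := d + h) (divergence cov W) x := by
  obtain ⟨U, X, hx, hf⟩ := S.exists_adaptedFrame x
  have h1 : SmoothFunNear (n := d + h) (fun y => ∑ i, S.gH y (X i y) (cov W y (X i y))) x :=
    .sum fun i _ => S.smooth_gH (hf.smoothVecNear hx i)
      (hc.smoothConnection.smoothVecNear (hf.smoothVecNear hx i) hW)
  refine h1.congr ?_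
  filter_upwards [hW.eventually, eventually_eventually_nhds.2 hhor, hf.eventually hx]
    with y h1 h2 h3
  exact hc.divergence_eq h1 h2 h3

lemma divergence_eq_zero {K : Set M} (hK : IsClosed K) (h0 : ∀ p ∉ K, W p = 0) (hx : x ∉ K) :
    divergence cov W x = 0 := by
  have h1 : cov W x = 0 := by
    rw [cov_congr cov (W := fun y => (0 : TangentSpace (𝓡 (d + h)) y))
      (SmoothNear.mdiff (SmoothNear.zero (V := fun y : M => TangentSpace (𝓡 (d + h)) y)))
      (by filter_upwards [hK.isOpen_compl.mem_nhds hx] with y hy using h0 y hy)]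
    exact cov.isCovariantDerivativeOnUniv.zero
  rw [divergence, h1]
  simp

variable [T2Space M] [MeasurableSpace M] [BorelSpace M]

lemma integral_divergence_of_subset_chart (hc : S.IsCanonicalConnection cov)
    (hW : ∀ p, SmoothVecNear W p) (hhor : ∀ p, W p ∈ S.hor p) {K : Set M} (hK : IsCompact K)
    (hKx : K ⊆ (chartAt (EuclideanSpace ℝ (Fin (d + h))) x).source) (h0 : ∀ p ∉ K, W p = 0) :
    ∫ p, divergence cov W p ∂S.volumeMeasure = 0 := by
  have hcont : Continuous (divergence cov W) := continuous_iff_continuousAt.2 fun p =>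
    (hc.smooth_divergence (hW p) (Eventually.of_forall hhor)).contMDiffAt.continuousAt
  rw [S.integral_eq_setIntegral_chart x hcont.measurable.aestronglyMeasurable
    fun p hp => divergence_eq_zero hK.isClosed h0 fun h => hp (hKx h)]
  have h1 := fun a : Fin (d + h) => setIntegral_differential_coordVec hK hKx
    (u := fun q => S.density x q * coordRep x q (W q) a)
    (fun p hp => (S.smooth_density hp).mul (smooth_coordRep hp (hW p) a))
    (fun p hp => by simp [h0 p hp]) (EuclideanSpace.single a 1)
  have h2 := integral_finsetSum Finset.univ fun a _ => (h1 a).1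
  simp only [(h1 _).2, Finset.sum_const_zero] at h2
  rw [← h2]
  refine setIntegral_congr_fun
    (chartAt (EuclideanSpace ℝ (Fin (d + h))) x).open_target.measurableSet fun y hy => ?_
  exact hc.density_mul_divergence ((chartAt (EuclideanSpace ℝ (Fin (d + h))) x).map_target hy)
    (hW _) (hhor _)

variable [SecondCountableTopology M]

omit [SecondCountableTopology M] in
lemma integrable_of_continuous {f : M → ℝ} (hf : Continuous f) {K : Set M} (hK : IsCompact K)
    (h0 : ∀ p ∉ K, f p = 0) : Integrable f S.volumeMeasure := by
  have : IsLocallyFiniteMeasure S.volumeMeasure := S.isLocallyFiniteMeasure_volumeMeasure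
  exact hf.integrable_of_hasCompactSupport (HasCompactSupport.intro hK h0)

/-- The divergence theorem for compactly supported horizontal vector fields. -/
theorem integral_divergence (hc : S.IsCanonicalConnection cov) (hW : ∀ p, SmoothVecNear W p)
    (hhor : ∀ p, W p ∈ S.hor p) {K : Set M} (hK : IsCompact K) (h0 : ∀ p ∉ K, W p = 0) :
    ∫ p, divergence cov W p ∂S.volumeMeasure = 0 := by
  have : LocallyCompactSpace M := ChartedSpace.locallyCompactSpace (EuclideanSpace ℝ (Fin (d + h))) M
  obtain ⟨f, hf⟩ := SmoothPartitionOfUnity.exists_isSubordinate_chartAt_source (𝓡 (d + h)) M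
  have hfin := f.locallyFinite.finite_nonempty_inter_compact hK
  let s := hfin.toFinset
  -- Only finitely many functions of the partition meet the compact set `K`; off `K` both sides
  -- vanish.
  have hsum : ∀ p, W p = ∑ i ∈ s, f i p • W p := fun p => by
    by_cases hp : p ∈ K
    · rw [← Finset.sum_smul, ← finsum_eq_sum_of_support_subset, f.sum_eq_one (mem_univ p), one_smul]
      exact fun i hi => by
        simpa [s] using ⟨p, by simpa using hi, hp⟩
    · simp [h0 p hp]
  have hfW : ∀ i p, SmoothVecNear (fun q => f i q • W q) p := fun i p =>
    SmoothNear.smul (Eventually.of_forall fun y => (f i).contMDiff y) (hW p)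
  have hhor' : ∀ i p, f i p • W p ∈ S.hor p := fun i p => Submodule.smul_mem _ _ (hhor p)
  have hKi : ∀ i, IsCompact (K ∩ tsupport (f i)) := fun i => hK.inter_right (isClosed_tsupport _)
  have h0i : ∀ i, ∀ p ∉ K ∩ tsupport (f i), f i p • W p = 0 := fun i p hp => by
    by_cases hpK : p ∈ K
    · rw [image_eq_zero_of_notMem_tsupport fun h => hp ⟨hpK, h⟩, zero_smul]
    · rw [h0 p hpK, smul_zero]
  have hdiv : ∀ p, divergence cov W p = ∑ i ∈ s, divergence cov (fun q => f i q • W q) p :=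
    fun p => by
      have h1 : cov W p = ∑ i ∈ s, cov (fun q => f i q • W q) p := by
        rw [← cov_sum cov fun i _ => SmoothNear.mdiff (hfW i p)]
        exact cov_congr cov (SmoothNear.mdiff (SmoothNear.sum fun i _ => hfW i p))
          (Eventually.of_forall hsum)
      simp only [divergence, h1, ContinuousLinearMap.toLinearMap_sum, map_sum]
  have hint : ∀ i, Integrable (divergence cov (fun q => f i q • W q)) S.volumeMeasure := fun i =>
    integrable_of_continuous (continuous_iff_continuousAt.2 fun p =>
      (hc.smooth_divergence (hfW i p) (Eventually.of_forall (hhor' i))).contMDiffAt.continuousAt)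
      (hKi i) fun p hp => divergence_eq_zero (hKi i).isClosed (h0i i) hp
  simp only [hdiv]
  rw [integral_finsetSum _ fun i _ => hint i]
  refine Finset.sum_eq_zero fun i _ => ?_
  exact hc.integral_divergence_of_subset_chart (hfW i) (hhor' i) (hKi i)
    (fun p hp => hf i hp.2) (h0i i)

end IsCanonicalConnection
end TransverseStructure
end TransverseSR

/-! ### Tensor derivatives, horizontal duals and the Dirichlet form -/

namespace TransverseSR

section CovTensor

variable {n : ℕ} {M : Type*} [TopologicalSpace M] [ChartedSpace (EuclideanSpace ℝ (Fin n)) M]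
  [IsManifold (𝓡 n) ∞ M] {cov : Connection n M} {x : M} {A : Tensor2 n M}

lemma SmoothNear.tensor_apply
    (hA : SmoothNear (n := n) (EuclideanSpace ℝ (Fin n) →L[ℝ] EuclideanSpace ℝ (Fin n) →L[ℝ] ℝ) A x)
    {V : VectorField n M} (hV : SmoothVecNear V x) : SmoothFormNear (fun y => A y (V y)) x :=
  SmoothNear.apply (V₂ := fun x : M => TangentSpace (𝓡 n) x →L[ℝ] ℝ) hA hV

lemma SmoothNear.tensor_diff
    (hA : SmoothNear (n := n) (EuclideanSpace ℝ (Fin n) →L[ℝ] EuclideanSpace ℝ (Fin n) →L[ℝ] ℝ) A x)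
    {V : VectorField n M} (hV : DiffVecAt V x) : DiffOneFormAt (fun y => A y (V y)) x :=
  mdiff_clm_apply (V₂ := fun x : M => TangentSpace (𝓡 n) x →L[ℝ] ℝ) hA.mdiff hV

variable (cov) in
/-- The covariant derivative of a `(0,2)` tensor, `(∇_u A)(V) = ∇_u (A(V)) - A(∇_u V)`. -/
def covTensor (A : Tensor2 n M) (x : M) (u v : TangentSpace (𝓡 n) x) :
    TangentSpace (𝓡 n) x →L[ℝ] ℝ :=
  covForm cov (fun y => A y (extendVec v y)) x u - A x (cov (extendVec v) x u)

lemma covTensor_tensorial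
    (hA : SmoothNear (n := n) (EuclideanSpace ℝ (Fin n) →L[ℝ] EuclideanSpace ℝ (Fin n) →L[ℝ] ℝ) A x)
    (u : TangentSpace (𝓡 n) x) :
    TensorialAt (𝓡 n) (EuclideanSpace ℝ (Fin n)) (fun V : VectorField n M =>
      covForm cov (fun y => A y (V y)) x u - A x (cov V x u)) x where
  smul {f V} hf hV := by
    have h1 : (fun y => A y ((f • V) y)) = fun y => f y • A y (V y) := by
      funext y; exact map_smul (A y) _ _
    have h2 := cov_smul cov hf hV u
    change cov (f • V) x u = _ at h2
    simp only [h1, h2, covForm_smul hf (hA.tensor_diff hV), map_add, map_smul]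
    module
  add {V W} hV hW := by
    have h1 : (fun y => A y ((V + W) y)) = fun y => A y (V y) + A y (W y) := by
      funext y; exact map_add (A y) _ _
    have h2 := cov_add cov hV hW
    change cov (V + W) x = _ at h2
    simp only [h1, h2, covForm_add (hA.tensor_diff hV) (hA.tensor_diff hW), map_add, add_apply]
    module

lemma covTensor_eq
    (hA : SmoothNear (n := n) (EuclideanSpace ℝ (Fin n) →L[ℝ] EuclideanSpace ℝ (Fin n) →L[ℝ] ℝ) A x)
    {V : VectorField n M} (hV : DiffVecAt V x) (u : TangentSpace (𝓡 n) x) :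
    covTensor cov A x u (V x) = covForm cov (fun y => A y (V y)) x u - A x (cov V x u) :=
  (covTensor_tensorial hA u).pointwise (diffVecAt_extendVec _) hV (by simp)

variable (cov) in
/-- The covariant derivative of a smooth `(0,2)` tensor, as a bilinear map. -/
def covTensorL
    (hA : SmoothNear (n := n) (EuclideanSpace ℝ (Fin n) →L[ℝ] EuclideanSpace ℝ (Fin n) →L[ℝ] ℝ)
      A x) :
    TangentSpace (𝓡 n) x →ₗ[ℝ] TangentSpace (𝓡 n) x →ₗ[ℝ] (TangentSpace (𝓡 n) x →L[ℝ] ℝ) :=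
  -- Linearity in the second argument is inherited from the linear map attached to a tensorial
  -- expression.
  have hmk : ∀ u v, TensorialAt.mkHom _ x (covTensor_tensorial (cov := cov) hA u) v
      = covTensor cov A x u v := fun u v => by
    have h1 := TensorialAt.mkHom_apply (covTensor_tensorial (cov := cov) hA u)
      (diffVecAt_extendVec v)
    rw [extendVec_self] at h1
    exact h1
  LinearMap.mk₂ ℝ (covTensor cov A x)
    (fun u u' v => by simp only [covTensor, covForm_add_dir, map_add]; abel)
    (fun c u v => by simp only [covTensor, covForm_smul_dir, map_smul, smul_sub])
    (fun u v v' => by rw [← hmk, map_add, hmk, hmk])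
    (fun c u v => by rw [← hmk, map_smul, hmk])

lemma covTensorL_apply
    (hA : SmoothNear (n := n) (EuclideanSpace ℝ (Fin n) →L[ℝ] EuclideanSpace ℝ (Fin n) →L[ℝ] ℝ) A x)
    (u v : TangentSpace (𝓡 n) x) : covTensorL cov hA u v = covTensor cov A x u v := rfl

end CovTensor

namespace TransverseStructure

variable {d h : ℕ} {M : Type*} [TopologicalSpace M]
  [ChartedSpace (EuclideanSpace ℝ (Fin (d + h))) M] [IsManifold (𝓡 (d + h)) ∞ M]
  {S : TransverseStructure d h M} {cov : Connection (d + h) M} {x : M}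

/-! ### Horizontal fields dual to one-forms -/

variable (S) in
/-- The horizontal vector dual to a family of linear forms on the horizontal spaces. -/
def sharpHor (α : OneForm (d + h) M) : VectorField (d + h) M := fun x =>
  ∑ i, α x (S.horBasis x i) • S.horBasis x i

lemma sharpHor_mem (α : OneForm (d + h) M) (x : M) : S.sharpHor α x ∈ S.hor x :=
  Submodule.sum_mem _ fun i _ => Submodule.smul_mem _ _ ((S.isHorOrthonormal_horBasis x).1 i)

lemma IsHorOrthonormal.sharpHor_eq {e : Fin d → TangentSpace (𝓡 (d + h)) x}
    (he : S.IsHorOrthonormal x e) (α : OneForm (d + h) M) :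
    S.sharpHor α x = ∑ i, α x (e i) • e i :=
  (S.isHorOrthonormal_horBasis x).sum_bilin_eq he
    (LinearMap.mk₂ ℝ (fun u v => α x u • v) (by intros; simp [add_smul])
      (by intros; simp [mul_smul]) (by intros; simp) (fun _ _ _ => smul_comm _ _ _))

lemma smooth_sharpHor {α : OneForm (d + h) M} (hα : SmoothFormNear α x) :
    SmoothVecNear (S.sharpHor α) x := by
  obtain ⟨U, X, hx, hf⟩ := S.exists_adaptedFrame x
  have h1 : SmoothVecNear (fun y => ∑ i, α y (X i y) • X i y) x :=
    .sum fun i _ => .smul (SmoothNear.form_apply hα (hf.smoothVecNear hx i))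
      (hf.smoothVecNear hx i)
  refine h1.congr ?_
  filter_upwards [hf.eventually hx] with y hy using hy.sharpHor_eq α

lemma gH_sharpHor (α : OneForm (d + h) M) {v : TangentSpace (𝓡 (d + h)) x} (hv : v ∈ S.hor x) :
    S.gH x v (S.sharpHor α x) = α x v := by
  conv_rhs => rw [← (S.isHorOrthonormal_horBasis x).sum_eq hv]
  simp only [sharpHor, map_sum, map_smul, smul_eq_mul]
  exact Finset.sum_congr rfl fun i _ => by rw [S.gH_symm x v, mul_comm]

namespace IsCanonicalConnection

/-- Since `gH` is parallel, the divergence of the dual field is the horizontal trace of ∇α. With α =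
df it is the sub-Laplacian; with α = ⟨η, A(·)⟩ it yields the formal adjoint. -/
lemma divergence_sharpHor (hc : S.IsCanonicalConnection cov) {α : OneForm (d + h) M}
    (hα : SmoothFormNear α x) {U : Set M} {X : Fin d → VectorField (d + h) M}
    {Z : Fin h → S.vert} (hX : S.IsAdaptedFrame U X Z) (hx : x ∈ U) :
    divergence cov (S.sharpHor α) x = ∑ i, (differential (n := d + h)
      (fun y => α y (X i y)) x (X i x) - α x (cov (X i) x (X i x))) := by
  rw [hc.divergence_eq (smooth_sharpHor hα) (Eventually.of_forall (sharpHor_mem α))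
    (hX.horizontal x hx)]
  refine Finset.sum_congr rfl fun i _ => ?_
  have hXi := hX.smoothVecNear hx i
  have h1 := hc.differential_gH hXi (smooth_sharpHor (S := S) hα) (X i x)
  have h2 : ∀ᶠ y in 𝓝 x, S.gH y (X i y) (S.sharpHor α y) = α y (X i y) := by
    filter_upwards [hX.eventually hx] with y hy using gH_sharpHor α (hy.1 i)
  rw [differential_congr h2, gH_sharpHor α (hc.cov_mem_hor hXi
    ((hX.eventually hx).mono fun y hy => hy.1 i) _)] at h1
  rw [h1]
  ring

/-! ### The sub-Laplacian as the generator of the horizontal Dirichlet form -/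

lemma subLaplacian_eq_divergence (hc : S.IsCanonicalConnection cov) {f : M → ℝ}
    (hf : SmoothFunNear (n := d + h) f x) :
    S.subLaplacian cov f x = divergence cov (S.gradHor f) x := by
  obtain ⟨U, X, hx, hX⟩ := S.exists_adaptedFrame x
  rw [subLaplacian_eq hf hX hx]
  exact (hc.divergence_sharpHor hf.differential hX hx).symm

lemma divergence_smul {g : M → ℝ} {W : VectorField (d + h) M}
    (hg : MDifferentiableAt (𝓡 (d + h)) 𝓘(ℝ, ℝ) g x) (hW : SmoothVecNear W x) :
    divergence cov (fun y => g y • W y) x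
      = g x * divergence cov W x + differential (n := d + h) g x (W x) := by
  have h1 : (cov (fun y => g y • W y) x).toLinearMap
      = g x • (cov W x).toLinearMap
        + (differential (n := d + h) g x).toLinearMap.smulRight (W x) := by
    ext u
    exact cov_smul cov hg (SmoothNear.mdiff hW) u
  rw [divergence, h1, map_add, map_smul, LinearMap.trace_smulRight]
  rfl

variable [T2Space M] [SecondCountableTopology M] [MeasurableSpace M] [BorelSpace M]

/-- Integrate div(g ∇_H f) = g L f + ⟨∇_H f, ∇_H g⟩; compact support of g suffices. -/
theorem isDirichletGenerator_subLaplacian (hc : S.IsCanonicalConnection cov) :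
    S.IsDirichletGenerator (S.subLaplacian cov) := by
  intro f hf
  have hf' : ∀ p, SmoothFunNear (n := d + h) f p := fun p => Eventually.of_forall fun y => hf y
  have hW : ∀ p, SmoothVecNear (S.gradHor f) p := fun p => smooth_sharpHor (hf' p).differential
  have hhor : ∀ p, S.gradHor f p ∈ S.hor p := sharpHor_mem _
  have hLs : ∀ p, SmoothFunNear (n := d + h) (S.subLaplacian cov f) p := fun p =>
    (hc.smooth_divergence (hW p) (Eventually.of_forall hhor)).congr
      (Eventually.of_forall fun y => hc.subLaplacian_eq_divergence (hf' y))
  refine ⟨fun p => (hLs p).contMDiffAt, fun g hg hgc => ?_⟩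
  have hg' : ∀ p, SmoothFunNear (n := d + h) g p := fun p => Eventually.of_forall fun y => hg y
  have hgW : ∀ p, SmoothVecNear (fun y => g y • S.gradHor f y) p := fun p =>
    SmoothNear.smul (hg' p) (hW p)
  have h0 : ∀ p ∉ tsupport g, g p = 0 := fun p hp => image_eq_zero_of_notMem_tsupport hp
  have h1 := hc.integral_divergence hgW (fun p => Submodule.smul_mem _ _ (hhor p)) hgc
    (fun p hp => by rw [h0 p hp, zero_smul])
  have h2 : ∀ p, S.gH p (S.gradHor f p) (S.gradHor g p)
      = divergence cov (fun y => g y • S.gradHor f y) p - S.subLaplacian cov f p * g p := fun p => by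
    rw [divergence_smul (hg' p).mdiff (hW p), hc.subLaplacian_eq_divergence (hf' p)]
    have h3 := gH_sharpHor (S := S) (differential (n := d + h) g) (hhor p)
    change S.gH p (S.gradHor f p) (S.gradHor g p) = _ at h3
    rw [h3]
    ring
  simp only [h2]
  have hdc : Continuous (divergence cov fun y => g y • S.gradHor f y) :=
    continuous_iff_continuousAt.2 fun p => (hc.smooth_divergence (hgW p)
      (Eventually.of_forall fun y => Submodule.smul_mem _ _ (hhor y))).contMDiffAt.continuousAt
  have hLc : Continuous fun p => S.subLaplacian cov f p * g p :=
    continuous_iff_continuousAt.2 fun p => ((hLs p).mul (hg' p)).contMDiffAt.continuousAt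
  rw [integral_sub, h1, zero_sub]
  · exact integrable_of_continuous hdc hgc fun p hp => divergence_eq_zero (isClosed_tsupport g)
      (fun q hq => by rw [h0 q hq, zero_smul]) hp
  · exact integrable_of_continuous hLc hgc fun p hp => by rw [h0 p hp, mul_zero]

end IsCanonicalConnection
end TransverseStructure
end TransverseSR

/-! ### The formal adjoint and the global formula -/

namespace TransverseSR
namespace TransverseStructure

variable {d h : ℕ} {M : Type*} [TopologicalSpace M]
  [ChartedSpace (EuclideanSpace ℝ (Fin (d + h))) M] [IsManifold (𝓡 (d + h)) ∞ M]
  {S : TransverseStructure d h M} {cov : Connection (d + h) M} {x : M}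
  {ε : ℝ} {η : OneForm (d + h) M} {A : Tensor2 (d + h) M}

/-! ### The operator `∇_H - 𝔗^ε_H` and its formal adjoint -/

lemma twistedHor_apply (u : TangentSpace (𝓡 (d + h)) x) :
    S.twistedHor cov ε η x u = S.twisted cov ε η x (S.horProj x u) := by
  let L : TangentSpace (𝓡 (d + h)) x →ₗ[ℝ] (TangentSpace (𝓡 (d + h)) x →L[ℝ] ℝ) :=
    { toFun := S.twisted cov ε η x
      map_add' := twisted_add_dir ε η
      map_smul' := twisted_smul_dir ε η }
  change _ = L (S.horProj x u)
  simp only [horProj, map_sum, map_smul, twistedHor, FunLike.coe_sum, Finset.sum_apply]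
  rfl

lemma twistedHor_vert (Z : S.vert) : S.twistedHor cov ε η x (Z.1 x) = 0 := by
  rw [twistedHor_apply, S.horProj_vert]
  simpa using twisted_smul_dir (cov := cov) ε η 0 (0 : TangentSpace (𝓡 (d + h)) x)

lemma twistedHor_hor {u : TangentSpace (𝓡 (d + h)) x} (hu : u ∈ S.hor x) :
    S.twistedHor cov ε η x u = S.twisted cov ε η x u := by
  rw [twistedHor_apply, S.horProj_of_mem hu]

lemma tensorInner_twistedHor {e : Fin d → TangentSpace (𝓡 (d + h)) x}
    (he : S.IsHorOrthonormal x e) (δ : ℝ) :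
    S.tensorInner δ x (S.twistedHor cov ε η x) (A x)
      = ∑ i, S.cometric δ x (S.twisted cov ε η x (e i)) (A x (e i)) := by
  have hb := S.isHorOrthonormal_horBasis x
  have h1 := hb.sum_bilin_eq he
    (LinearMap.mk₂ ℝ (fun u v => S.cometricL δ x (S.twisted cov ε η x u) (A x v))
      (by intros; simp only [twisted_add_dir, map_add, LinearMap.add_apply])
      (by intros; simp only [twisted_smul_dir, map_smul, LinearMap.smul_apply])
      (by intros; simp only [map_add]) (by intros; simp only [map_smul]))
  simp only [LinearMap.mk₂_apply, cometricL_apply] at h1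
  rw [← h1, tensorInner]
  simp only [twistedHor_hor (hb.1 _), twistedHor_vert, ← cometricL_apply, map_zero,
    LinearMap.zero_apply, Finset.sum_const_zero, mul_zero, add_zero]

variable (S cov) in
/-- The formal adjoint of `∇_H - 𝔗^ε_H`, that is
`A ↦ - ∑ ((∇_{X_i} A)(X_i) - 𝔗^ε_{X_i} (A(X_i)))`. -/
def twistedHorAdj (ε : ℝ) (A : Tensor2 (d + h) M) : OneForm (d + h) M := fun x =>
  - ∑ i, (covTensor cov A x (S.horBasis x i) (S.horBasis x i)
    - S.frakT cov ε x (S.horBasis x i) (A x (S.horBasis x i)))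

lemma twistedHorAdj_eq
    (hA : SmoothNear (n := d + h) (EuclideanSpace ℝ (Fin (d + h)) →L[ℝ]
      EuclideanSpace ℝ (Fin (d + h)) →L[ℝ] ℝ) A x)
    {U : Set M} {X : Fin d → VectorField (d + h) M} {Z : Fin h → S.vert}
    (hX : S.IsAdaptedFrame U X Z) (hx : x ∈ U) :
    S.twistedHorAdj cov ε A x = - ∑ i, (S.twistedAlong cov ε (X i) (fun y => A y (X i y)) x
      - A x (cov (X i) x (X i x))) := by
  have hb := S.isHorOrthonormal_horBasis x
  have h1 := hb.sum_bilin_eq (hX.horizontal x hx) (covTensorL cov hA)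
  have h2 := hb.sum_bilin_eq (hX.horizontal x hx)
    ((S.frakTL cov ε x).compl₂ (A x).toLinearMap)
  simp only [LinearMap.compl₂_apply, ContinuousLinearMap.coe_coe, covTensorL_apply,
    frakTL_apply] at h1 h2
  rw [twistedHorAdj, Finset.sum_sub_distrib, h1, h2, ← Finset.sum_sub_distrib]
  congr 1
  refine Finset.sum_congr rfl fun i _ => ?_
  rw [covTensor_eq hA (hX.smoothVecNear hx i).mdiff, twistedAlong, twisted]
  abel

variable (S) in
/-- The one-form `V ↦ ⟨η, A(V)⟩`. -/
def pairing (δ : ℝ) (η : OneForm (d + h) M) (A : Tensor2 (d + h) M) : OneForm (d + h) M := fun x =>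
  LinearMap.toContinuousLinearMap ((S.cometricL δ x (η x)).comp (A x).toLinearMap)

lemma pairing_apply (δ : ℝ) (u : TangentSpace (𝓡 (d + h)) x) :
    S.pairing δ η A x u = S.cometric δ x (η x) (A x u) := rfl

lemma smooth_pairing (δ : ℝ) (hη : SmoothFormNear η x)
    (hA : SmoothNear (n := d + h) (EuclideanSpace ℝ (Fin (d + h)) →L[ℝ]
      EuclideanSpace ℝ (Fin (d + h)) →L[ℝ] ℝ) A x) : SmoothFormNear (S.pairing δ η A) x := by
  refine smoothFormNear_of_apply ?_
  filter_upwards [hη.eventually, hA.eventually] with y hy hAy V hV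
  exact smooth_cometric δ hy (hAy.tensor_apply hV)

namespace IsCanonicalConnection

variable (hc : S.IsCanonicalConnection cov)
include hc

lemma smooth_twistedHorAdj (ε : ℝ)
    (hA : SmoothNear (n := d + h) (EuclideanSpace ℝ (Fin (d + h)) →L[ℝ]
      EuclideanSpace ℝ (Fin (d + h)) →L[ℝ] ℝ) A x) :
    SmoothFormNear (S.twistedHorAdj cov ε A) x := by
  obtain ⟨U, X, hx, hf⟩ := S.exists_adaptedFrame x
  have hX := fun i => hf.smoothVecNear hx i
  have h1 : SmoothFormNear (fun y => - ∑ i, (S.twistedAlong cov ε (X i) (fun z => A z (X i z)) y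
      - A y (cov (X i) y (X i y)))) x :=
    .neg (.sum fun i _ => .sub (hc.smooth_twistedAlong ε (hX i) (hA.tensor_apply (hX i)))
      (hA.tensor_apply (hc.smoothConnection.smoothVecNear (hX i) (hX i))))
  refine h1.congr ?_
  filter_upwards [hA.eventually, hf.isOpen.mem_nhds hx] with y hy hyU using twistedHorAdj_eq hy hf hyU

lemma smooth_twistedHor (ε : ℝ) (hη : SmoothFormNear η x) :
    SmoothNear (n := d + h) (EuclideanSpace ℝ (Fin (d + h)) →L[ℝ]
      EuclideanSpace ℝ (Fin (d + h)) →L[ℝ] ℝ) (S.twistedHor cov ε η) x := by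
  refine SmoothNear.of_apply (V₂ := fun x : M => TangentSpace (𝓡 (d + h)) x →L[ℝ] ℝ) ?_
  filter_upwards [hη.eventually] with y hy V hV
  refine SmoothNear.congr (hc.smooth_twistedAlong ε (S.smooth_horProj hV) hy)
    (Eventually.of_forall fun z => ?_)
  exact twistedHor_apply _

/-- The divergence of the horizontal field dual to `V ↦ ⟨η, A(V)⟩`. -/
lemma divergence_pairing (hε : ε ≠ 0) (hη : SmoothFormNear η x)
    (hA : SmoothNear (n := d + h) (EuclideanSpace ℝ (Fin (d + h)) →L[ℝ]
      EuclideanSpace ℝ (Fin (d + h)) →L[ℝ] ℝ) A x) :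
    divergence cov (S.sharpHor (S.pairing (2 * ε) η A)) x
      = S.tensorInner (2 * ε) x (S.twistedHor cov ε η x) (A x)
        - S.cometric (2 * ε) x (η x) (S.twistedHorAdj cov ε A x) := by
  obtain ⟨U, X, hx, hX⟩ := S.exists_adaptedFrame x
  rw [hc.divergence_sharpHor (smooth_pairing (2 * ε) hη hA) hX hx,
    tensorInner_twistedHor (hX.horizontal x hx), twistedHorAdj_eq hA hX hx]
  simp only [pairing_apply]
  have h1 : ∀ i, differential (n := d + h)
      (fun y => S.cometric (2 * ε) y (η y) (A y (X i y))) x (X i x)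
      = S.cometric (2 * ε) x (S.twisted cov ε η x (X i x)) (A x (X i x))
        + S.cometric (2 * ε) x (η x) (S.twistedAlong cov ε (X i) (fun y => A y (X i y)) x) :=
    fun i => hc.differential_cometric_twisted hε hη (hA.tensor_apply (hX.smoothVecNear hx i))
      ((hX.horizontal x hx).1 i)
  simp only [h1]
  simp only [← cometricL_apply, map_neg, map_sum, map_sub, Finset.sum_add_distrib,
    Finset.sum_sub_distrib]
  ring

/-- In an adapted frame, inserting X_i into the tensor (∇ - 𝔗)η gives the form (∇_{X_i} - 𝔗_{X_i})η
near `x`, so the frame expression of the adjoint reproduces the sum of squares. -/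
theorem box_eq_adjoint (hYM : S.IsYangMills cov) (hη : SmoothFormNear η x) :
    S.box cov ε η x = - S.twistedHorAdj cov ε (S.twistedHor cov ε η) x
      + (1 / (2 * ε)) • S.JStarJ cov x (η x) - S.ricHor cov x (η x) := by
  obtain ⟨U, X, hx, hX⟩ := S.exists_adaptedFrame x
  rw [hc.box_eq_sum_of_squares hYM hX hη hx, twistedHorAdj_eq (hc.smooth_twistedHor ε hη) hX hx,
    neg_neg, JStarJ]
  congr 2
  refine Finset.sum_congr rfl fun i _ => ?_
  have hXi := hX.smoothVecNear hx i
  have hhor : ∀ᶠ y in 𝓝 x, X i y ∈ S.hor y := (hX.eventually hx).mono fun y hy => hy.1 i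
  have h1 : ∀ᶠ y in 𝓝 x, S.twistedHor cov ε η y (X i y) = S.twistedAlong cov ε (X i) η y :=
    hhor.mono fun y hy => twistedHor_hor hy
  have hs := hc.smooth_twistedAlong ε hXi hη
  congr 1
  · simp only [twistedAlong, twisted]
    rw [covForm_congr (SmoothNear.mdiff hs) h1, h1.self_of_nhds]
    rfl
  · exact (twistedHor_hor (hc.cov_mem_hor hXi hhor _)).symm

variable [T2Space M] [SecondCountableTopology M] [MeasurableSpace M] [BorelSpace M]

/-- The two integrands differ by the divergence of the horizontal field dual to ⟨η, A(·)⟩, which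
inherits compact support from η; the tensor A needs none. -/
theorem isFormalAdjoint_twistedHorAdj (hε : ε ≠ 0) :
    S.IsFormalAdjoint (2 * ε) (S.twistedHor cov ε) (S.twistedHorAdj cov ε) := by
  intro A hA
  have hs : ∀ p, SmoothFormNear (S.twistedHorAdj cov ε A) p :=
    fun p => hc.smooth_twistedHorAdj ε (hA.smoothNear p)
  refine ⟨smoothOneForm_of_near hs, fun η hη hK => ?_⟩
  have h0 : ∀ p ∉ closure {x | η x ≠ 0}, η p = 0 := fun p hp => by
    by_contra hne
    exact hp (subset_closure hne)
  have hW : ∀ p, SmoothVecNear (S.sharpHor (S.pairing (2 * ε) η A)) p := fun p =>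
    smooth_sharpHor (smooth_pairing (2 * ε) (hη.smoothFormNear p) (hA.smoothNear p))
  have hhor : ∀ p, S.sharpHor (S.pairing (2 * ε) η A) p ∈ S.hor p := sharpHor_mem _
  have hW0 : ∀ p ∉ closure {x | η x ≠ 0}, S.sharpHor (S.pairing (2 * ε) η A) p = 0 := fun p hp => by
    simp [sharpHor, pairing, h0 p hp]
  have h1 := hc.integral_divergence hW hhor hK hW0
  have h2 : ∀ p, S.tensorInner (2 * ε) p (S.twistedHor cov ε η p) (A p)
      = divergence cov (S.sharpHor (S.pairing (2 * ε) η A)) p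
        + S.cometric (2 * ε) p (η p) (S.twistedHorAdj cov ε A p) := fun p => by
    rw [hc.divergence_pairing hε (hη.smoothFormNear p) (hA.smoothNear p), sub_add_cancel]
  simp only [h2]
  rw [integral_add, h1, zero_add]
  · exact integrable_of_continuous (continuous_iff_continuousAt.2 fun p =>
      (hc.smooth_divergence (hW p) (Eventually.of_forall hhor)).contMDiffAt.continuousAt) hK
      fun p hp => divergence_eq_zero isClosed_closure hW0 hp
  · exact integrable_of_continuous (continuous_iff_continuousAt.2 fun p =>
      (smooth_cometric (2 * ε) (hη.smoothFormNear p) (hs p)).contMDiffAt.continuousAt) hK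
      fun p hp => by rw [h0 p hp, ← cometricL_apply, map_zero, LinearMap.zero_apply]

end IsCanonicalConnection
end TransverseStructure
end TransverseSR

end

theorem mainTheorem2 {d h : ℕ} {M : Type*} [TopologicalSpace M]
    [ChartedSpace (EuclideanSpace ℝ (Fin (d + h))) M] [IsManifold (𝓡 (d + h)) ∞ M]
    [T2Space M] [SecondCountableTopology M] [ConnectedSpace M]
    [MeasurableSpace M] [BorelSpace M]
    (S : TransverseSR.TransverseStructure d h M) :
    -- the canonical connection exists
    (∃ cov : TransverseSR.Connection (d + h) M, S.IsCanonicalConnection cov) ∧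
    ∀ cov : TransverseSR.Connection (d + h) M, S.IsCanonicalConnection cov →
      -- `L` is the generator of the horizontal Dirichlet form
      S.IsDirichletGenerator (S.subLaplacian cov) ∧
      (S.IsYangMills cov → ∀ ε : ℝ, 0 < ε →
        -- sum of squares formula in every adapted frame
        (∀ (U : Set M) (X : Fin d → TransverseSR.VectorField (d + h) M) (Z : Fin h → S.vert),
          S.IsAdaptedFrame U X Z →
          ∀ η : TransverseSR.OneForm (d + h) M, TransverseSR.SmoothOneForm η → ∀ x ∈ U,
            S.box cov ε η x =
              ∑ i, (S.twistedAlong cov ε (X i) (S.twistedAlong cov ε (X i) η) x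
                - S.twisted cov ε η x (cov (X i) x (X i x)))
              + (1 / (2 * ε)) • S.sumJStarJ cov Z x (η x) - S.ricHor cov x (η x)) ∧
        -- global formula, with the adjoint for the metric `g_{2ε}`
        (∃ Dstar : TransverseSR.Tensor2 (d + h) M → TransverseSR.OneForm (d + h) M,
          S.IsFormalAdjoint (2 * ε) (S.twistedHor cov ε) Dstar ∧
          ∀ η : TransverseSR.OneForm (d + h) M, TransverseSR.SmoothOneForm η → ∀ x,
            S.box cov ε η x =
              - Dstar (S.twistedHor cov ε η) x
              + (1 / (2 * ε)) • S.JStarJ cov x (η x) - S.ricHor cov x (η x)) ∧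
        -- Bochner identity
        (∀ η : TransverseSR.OneForm (d + h) M, TransverseSR.SmoothOneForm η → ∀ x,
          ∀ e : Fin d → TangentSpace (𝓡 (d + h)) x, S.IsHorOrthonormal x e →
            (1 / 2) * S.subLaplacian cov (fun y => S.cometric (2 * ε) y (η y) (η y)) x
              - S.cometric (2 * ε) x (S.box cov ε η x) (η x)
            = ∑ i, S.cometric (2 * ε) x (S.twisted cov ε η x (e i)) (S.twisted cov ε η x (e i))
              + S.cometric (2 * ε) x
                  (S.ricHor cov x (η x) - (1 / (2 * ε)) • S.JStarJ cov x (η x)) (η x))) := by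
  refine ⟨⟨_, S.isCanonicalConnection_canonicalConnection⟩, fun cov hc =>
    ⟨hc.isDirichletGenerator_subLaplacian, fun hYM ε hε => ⟨?_, ?_, ?_⟩⟩⟩
  · exact fun U X Z hf η hη x hx => hc.box_eq_sum_of_squares hYM hf (hη.smoothFormNear x) hx
  · exact ⟨_, hc.isFormalAdjoint_twistedHorAdj hε.ne',
      fun η hη x => hc.box_eq_adjoint hYM (hη.smoothFormNear x)⟩
  · exact fun η hη x e he => hc.bochner hYM hε.ne' (hη.smoothFormNear x) he
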